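/- Let $\mathcal B$ be a unital C$^*$-algebra and let $\mathcal B\langle X\rangle$ be the $*$-algebra of noncommutative polynomials with coefficients in $\mathcal B$ (the algebraic free product over $\mathbb C$ of $\mathcal B$ and $\mathbb C[X]$, with $X=X^*$); let $\mathcal B_0\langle X\rangle$ be the polynomials with zero constant term. A linear map $\sigma:\mathcal B\langle X\rangle\to\mathcal B$ is *completely positive* (CP) if $[\sigma(P_iP_j^*)]_{i,j=1}^n\ge 0$ in $M_n(\mathcal B)$ for all $n$ and all $P_1,\dots,P_n\in\mathcal B\langle X\rangle$. $\mathcal B$-bimodule maps $\mu:\mathcal B\langle X\rangle\to\mathcal B$ are normalized by $\mu(b)=b$ for $b\in\mathcal B$. *Monotone convolution.* $\rho=\mu\rhd\nu$ means $F_\rho=F_\mu\circ F_\nu$, where $F(b)=H(b^{-1})^{-1}$ and $H^{\mu}(b)=\sum_{k\ge0}(\mu\otimes 1_d)[b(Xb)^k]$; equivalently $H^\rho=H^\mu\circ H^\nu$, understood as an identity of formal power series, i.e. $H^\rho(zb)=H^\mu(H^\nu(zb))$ in $M_d(\mathcal B)[[z]]$ for all $d$ and all $b\in M_d(\mathcal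 B)$. A *monotone convolution semigroup of CP $\mathcal B$-bimodule maps* is a family $\{\mu_t\}_{t\ge0}$ of such maps with $\mu_{s+t}=\mu_s\rhd\mu_t$ for $s,t\ge 0$, $\mu_0(P)=P(0)$ (the constant term), and $\mu_t(P)\to\mu_0(P)$ in norm as $t\downarrow0$ for every $P\in\mathcal B\langle X\rangle$. *Monotone cumulants.* For a noncrossing partition $\pi$ of $\{1,\dots,n\}$, a block $U$ covers a block $V$ if there are $i,j\in U$ with $i<v<j$ for all $v\in V$; $o(\pi)$ is the number of bijections $f$ from the blocks of $\pi$ to $\{1,\dots,|\pi|\}$ with $f(U)<f(V)$ whenever $U$ covers $V$. A monotone cumulant functional of $\mu$ is a $\mathcal B$-bimodule map $K:\mathcal B_0\langle X\rangle\to\mathcal B$ such that $$\mu[b_0Xb_1X\cdots Xb_n]=\sum_{\pi\in NC(n)}\frac{o(\pi)}{|\pi|!}\,K_\pi[b_0Xb_1X\cdots Xb_n]\qquad(n\ge0,\ b_0,\dots,b_n\in\mathcal B),$$ where $K_\pi$ is the nested evaluation of $K$ along the blocks of $\pi$ ($K_\emptyset[b_0]=b_0$). For $\gamma\in\mathcal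 B$ and a linear map $\sigma:\mathcal B\langle X\rangle\to\mathcal B$, $\nu_\rhd^{\gamma,\sigma}$ denotes the map with a monotone cumulant functional $K$ given by $K[b_0Xb_1]=b_0\gamma b_1$ and $K[b_0X\,P\,Xb_1]=b_0\,\sigma[P]\,b_1$ for $P\in\mathcal B\langle X\rangle$. **Proposition.** Monotone convolution semigroups of CP $\mathcal B$-bimodule maps are in one-to-one correspondence with pairs $(\gamma,\sigma)$, where $\gamma\in\mathcal B$ is self-adjoint and $\sigma:\mathcal B\langle X\rangle\to\mathcal B$ is a CP linear map (not necessarily a $\mathcal B$-bimodule map), via $\mu_t=\nu_\rhd^{t\gamma,t\sigma}$. Precisely: 1. For every such pair $(\gamma,\sigma)$ and every $t\ge 0$, the map $\nu_\rhd^{t\gamma,t\sigma}$ exists and is unique, and $\{\nu_\rhd^{t\gamma,t\sigma}\}_{t\ge0}$ is a monotone convolution semigroup of CP $\mathcal B$-bimodule maps. 2. For every monotone convolution semigroup $\{\mu_t\}_{t\ge0}$ of CP $\mathcal B$-bimodule maps there is exactly one such pair with $\mu_t=\nu_\rhd^{t\gamma,t\sigma}$ for all $t\ge0$. Moreover $\mu_1$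 has a unique monotone cumulant functional $K^{\mu_1}$, and $$\gamma=\left.\frac{d}{dt}\right|_{t=0^+}\mu_t[X]=K^{\mu_1}[X],\qquad \sigma[P]=\left.\frac{d}{dt}\right|_{t=0^+}\mu_t[XPX]=K^{\mu_1}[XPX]\quad(P\in\mathcal B\langle X\rangle),$$ where the (norm) derivatives exist. -/

import Mathlib

open scoped NNReal Nat

noncomputable section

/-! ### The `*`-algebra `B⟨X⟩` -/

/-- Relations turning the free `ℂ`-algebra on the letters `some b` (`b : B`) and `none` (the
indeterminate) into the algebraic free product of the unital algebras `B` and `ℂ[X]`: the letters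
`some b` satisfy exactly the relations that hold in the unital `ℂ`-algebra `B`, and the letter
`none` satisfies no relation. -/
inductive NCPoly.Rel (B : Type*) [CStarAlgebra B] :
    FreeAlgebra ℂ (Option B) → FreeAlgebra ℂ (Option B) → Prop
  | add (b c : B) : NCPoly.Rel B (FreeAlgebra.ι ℂ (some (b + c)))
      (FreeAlgebra.ι ℂ (some b) + FreeAlgebra.ι ℂ (some c))
  | mul (b c : B) : NCPoly.Rel B (FreeAlgebra.ι ℂ (some (b * c)))
      (FreeAlgebra.ι ℂ (some b) * FreeAlgebra.ι ℂ (some c))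
  | scalar (z : ℂ) : NCPoly.Rel B (FreeAlgebra.ι ℂ (some (algebraMap ℂ B z)))
      (algebraMap ℂ (FreeAlgebra ℂ (Option B)) z)

/-- The algebra `B⟨X⟩` of noncommutative polynomials with coefficients in `B`: the algebraic free
product (over `ℂ`) of `B` and the polynomials in `X`. -/
def NCPoly (B : Type*) [CStarAlgebra B] : Type _ := RingQuot (NCPoly.Rel B)

namespace NCPoly

variable {B : Type*} [CStarAlgebra B]

instance : Ring (NCPoly B) := inferInstanceAs (Ring (RingQuot (NCPoly.Rel B)))

instance : Algebra ℂ (NCPoly B) := inferInstanceAs (Algebra ℂ (RingQuot (NCPoly.Rel B)))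

/-- The quotient map. -/
def mk : FreeAlgebra ℂ (Option B) →ₐ[ℂ] NCPoly B := RingQuot.mkAlgHom ℂ (NCPoly.Rel B)

lemma mk_rel {x y : FreeAlgebra ℂ (Option B)} (h : NCPoly.Rel B x y) : mk x = mk y :=
  RingQuot.mkAlgHom_rel ℂ h

/-- The inclusion of `B` into `B⟨X⟩` as the constant polynomials. -/
def C : B →ₐ[ℂ] NCPoly B where
  toFun b := mk (FreeAlgebra.ι ℂ (some b))
  map_one' := by
    have h := mk_rel (NCPoly.Rel.scalar (B := B) 1)
    simpa using h
  map_mul' b c := by simpa using mk_rel (NCPoly.Rel.mul b c)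
  map_zero' := by
    have h := mk_rel (NCPoly.Rel.scalar (B := B) 0)
    simpa using h
  map_add' b c := by simpa using mk_rel (NCPoly.Rel.add b c)
  commutes' z := by
    have h := mk_rel (NCPoly.Rel.scalar (B := B) z)
    rw [AlgHom.commutes] at h
    exact h

/-- The indeterminate. -/
def X : NCPoly B := mk (FreeAlgebra.ι ℂ none)

/-- The universal property of the free product. -/
def lift {S : Type*} [Ring S] [Algebra ℂ S] (f : B →ₐ[ℂ] S) (x : S) : NCPoly B →ₐ[ℂ] S :=
  RingQuot.liftAlgHom ℂ
    ⟨FreeAlgebra.lift ℂ (fun o : Option B => o.elim x f), by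
      intro u v h
      cases h <;> simp⟩

@[simp] lemma lift_C {S : Type*} [Ring S] [Algebra ℂ S] (f : B →ₐ[ℂ] S) (x : S) (b : B) :
    lift f x (C b) = f b := by
  have h : lift f x (mk (FreeAlgebra.ι ℂ (some b))) =
      FreeAlgebra.lift ℂ (fun o : Option B => o.elim x f) (FreeAlgebra.ι ℂ (some b)) :=
    RingQuot.liftAlgHom_mkAlgHom_apply _ _ _ _
  rw [FreeAlgebra.lift_ι_apply] at h
  exact h

@[simp] lemma lift_X {S : Type*} [Ring S] [Algebra ℂ S] (f : B →ₐ[ℂ] S) (x : S) :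
    lift f x X = x := by
  have h : lift f x (mk (FreeAlgebra.ι ℂ none)) =
      FreeAlgebra.lift ℂ (fun o : Option B => o.elim x f) (FreeAlgebra.ι ℂ none) :=
    RingQuot.liftAlgHom_mkAlgHom_apply _ _ _ _
  rw [FreeAlgebra.lift_ι_apply] at h
  exact h

lemma induction {p : NCPoly B → Prop} (hC : ∀ b, p (C b)) (hX : p X)
    (hadd : ∀ P Q, p P → p Q → p (P + Q)) (hmul : ∀ P Q, p P → p Q → p (P * Q))
    (P : NCPoly B) : p P := by
  obtain ⟨a, rfl⟩ : ∃ a, mk a = P := RingQuot.mkAlgHom_surjective ℂ (NCPoly.Rel B) P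
  induction a using FreeAlgebra.induction with
  | grade0 z =>
    rw [AlgHom.commutes, ← AlgHom.commutes (C (B := B)) z]
    exact hC _
  | grade1 o =>
    cases o with
    | none => exact hX
    | some b => exact hC b
  | mul a b ha hb => rw [map_mul]; exact hmul _ _ ha hb
  | add a b ha hb => rw [map_add]; exact hadd _ _ ha hb

/-- The opposite ring of `B⟨X⟩` with the conjugate `ℂ`-algebra structure, used to construct the
involution from the universal property. -/
def ConjOp (B : Type*) [CStarAlgebra B] : Type _ := (NCPoly B)ᵐᵒᵖ

instance : Ring (ConjOp B) := inferInstanceAs (Ring (NCPoly B)ᵐᵒᵖ)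

instance : Algebra ℂ (ConjOp B) :=
  RingHom.toAlgebra' ((algebraMap ℂ (NCPoly B)ᵐᵒᵖ).comp (starRingEnd ℂ))
    (fun z x => Algebra.commutes (A := (NCPoly B)ᵐᵒᵖ) (starRingEnd ℂ z) x)

/-- The canonical map onto the opposite ring. -/
def toConjOp (P : NCPoly B) : ConjOp B := (MulOpposite.op P : (NCPoly B)ᵐᵒᵖ)

/-- The inverse of `toConjOp`. -/
def ofConjOp (P : ConjOp B) : NCPoly B := MulOpposite.unop (α := NCPoly B) P

/-- The involution of `B⟨X⟩` with values in the conjugate opposite algebra. -/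
def starHom : NCPoly B →ₐ[ℂ] ConjOp B :=
  lift
    { toFun := fun b => toConjOp (C (star b))
      map_one' := by rw [star_one, map_one]; rfl
      map_mul' := fun b c => by rw [star_mul, map_mul]; rfl
      map_zero' := by rw [star_zero, map_zero]; rfl
      map_add' := fun b c => by rw [star_add, map_add]; rfl
      commutes' := fun z => by
        rw [← algebraMap_star_comm, AlgHom.commutes]; rfl }
    (toConjOp X)

/-- The involution of `B⟨X⟩`: it extends the one of `B`, and `X` is self-adjoint. -/
instance : Star (NCPoly B) := ⟨fun P => ofConjOp (starHom P)⟩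

lemma star_def (P : NCPoly B) : star P = ofConjOp (starHom P) := rfl

@[simp] lemma star_C (b : B) : star (C b) = C (star b) := by
  rw [star_def, starHom, lift_C]; rfl

@[simp] lemma star_X : star (X : NCPoly B) = X := by
  rw [star_def, starHom, lift_X]; rfl

lemma star_mul' (P Q : NCPoly B) : star (P * Q) = star Q * star P := by
  rw [star_def, map_mul]; rfl

lemma star_add' (P Q : NCPoly B) : star (P + Q) = star P + star Q := by
  rw [star_def, map_add]; rfl

instance : StarRing (NCPoly B) where
  star_involutive P := by
    induction P using NCPoly.induction with
    | hC b => simp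
    | hX => simp
    | hadd P Q hP hQ => rw [star_add', star_add', hP, hQ]
    | hmul P Q hP hQ => rw [star_mul', star_mul', hP, hQ]
  star_mul := star_mul'
  star_add := star_add'

instance : StarModule ℂ (NCPoly B) where
  star_smul z P := by
    rw [star_def, map_smul, Algebra.smul_def z (starHom P), Algebra.smul_def (star z) (star P),
      Algebra.commutes]
    rfl

/-- The constant term of a polynomial (evaluation at `X = 0`). -/
def constTerm : NCPoly B →ₐ[ℂ] B := lift (AlgHom.id ℂ B) 0

@[simp] lemma constTerm_C (b : B) : constTerm (C b) = b := by simp [constTerm]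

@[simp] lemma constTerm_X : constTerm (X : NCPoly B) = 0 := by simp [constTerm]

/-- `B₀⟨X⟩`: the polynomials with zero constant term. -/
def ConstFree (B : Type*) [CStarAlgebra B] : Submodule ℂ (NCPoly B) :=
  LinearMap.ker (constTerm (B := B)).toLinearMap

lemma mem_constFree {P : NCPoly B} : P ∈ ConstFree B ↔ constTerm P = 0 := LinearMap.mem_ker

lemma X_mem : (X : NCPoly B) ∈ ConstFree B := by simp [mem_constFree]

lemma X_mul_mul_X_mem (P : NCPoly B) : X * P * X ∈ ConstFree B := by simp [mem_constFree]

lemma C_mul_mul_C_mem (b c : B) (P : ConstFree B) : C b * (P : NCPoly B) * C c ∈ ConstFree B := by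
  have h := mem_constFree.1 P.2
  simp [mem_constFree, h]

/-- The projection of `B⟨X⟩` onto `B₀⟨X⟩` that removes the constant term. -/
def dropConst : NCPoly B →ₗ[ℂ] ConstFree B :=
  LinearMap.codRestrict (ConstFree B)
    (LinearMap.id - (C (B := B)).toLinearMap ∘ₗ (constTerm (B := B)).toLinearMap)
    (fun P => by simp [mem_constFree])

/-- The monomial `b₀ X b₁ X ⋯ X bₙ` for the list `[b₁, …, bₙ]`. -/
def word (b₀ : B) (l : List B) : NCPoly B := l.foldl (fun P c => P * X * C c) (C b₀)

/-- The monomial `b₀ X b₁ X ⋯ X bₙ` for a sequence `b`, of which only the entries `b₀, …, bₙ`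
matter. -/
def mono (b : ℕ → B) (n : ℕ) : NCPoly B := word (b 0) ((List.range n).map fun i => b (i + 1))

end NCPoly

open NCPoly

/-! ### Completely positive maps and distributions -/

section Maps

variable {B : Type*} [CStarAlgebra B] [PartialOrder B] [StarOrderedRing B]

/-- Complete positivity of a linear map `σ : B⟨X⟩ → B`: the matrix `[σ(Pᵢ Pⱼ*)]` is a positive
element of the C*-algebra `Mₙ(B)`, for all `n` and all `P₁, …, Pₙ ∈ B⟨X⟩`. -/
def IsCP (σ : NCPoly B →ₗ[ℂ] B) : Prop :=
  ∀ (n : ℕ) (P : Fin n → NCPoly B),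
    0 ≤ (CStarMatrix.ofMatrix (Matrix.of fun i j => σ (P i * star (P j))) :
      CStarMatrix (Fin n) (Fin n) B)

/-- Completely positive `B`-bimodule maps `μ : B⟨X⟩ → B`, normalized by `μ(b) = b` for `b ∈ B`. -/
structure IsCPBimoduleMap (μ : NCPoly B →ₗ[ℂ] B) : Prop where
  bimodule : ∀ (b c : B) (P : NCPoly B), μ (C b * P * C c) = b * μ P * c
  unital : μ 1 = 1
  cp : IsCP μ

end Maps

/-! ### Monotone convolution -/

section Convolution

variable {B : Type*} [CStarAlgebra B]

/-- The moment generating series `H(h) = ∑ₖ (μ ⊗ 1_d)[h (X h)ᵏ]` of `μ`, for a formal power series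
`h` in a (central) variable `z` with coefficients in `M_d(B)` and zero constant coefficient. Since
`h (X h)ᵏ` is divisible by `z ^ (k + 1)`, only the terms with `k < n` contribute to `z ^ n`. -/
def momentSeries (μ : NCPoly B →ₗ[ℂ] B) {d : ℕ}
    (h : PowerSeries (Matrix (Fin d) (Fin d) B)) : PowerSeries (Matrix (Fin d) (Fin d) B) :=
  let h' : PowerSeries (Matrix (Fin d) (Fin d) (NCPoly B)) :=
    PowerSeries.map ((C (B := B)).toRingHom.mapMatrix) h
  let X' : PowerSeries (Matrix (Fin d) (Fin d) (NCPoly B)) :=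
    PowerSeries.C (Matrix.diagonal fun _ => X)
  PowerSeries.mk fun n =>
    ∑ k ∈ Finset.range n, (PowerSeries.coeff n (h' * (X' * h') ^ k)).map μ

/-- `ρ = μ ▷ ν`. The defining identity `F_ρ = F_μ ∘ F_ν` of the `F`-transforms
`F(b) = H(b⁻¹)⁻¹` reads `H_ρ = H_μ ∘ H_ν` for the moment generating functions; it is imposed as an
identity of formal power series, `H_ρ(z b) = H_μ(H_ν(z b))`, for all `b ∈ M_d(B)` and all `d`. -/
def IsMonotoneConvolution (μ ν ρ : NCPoly B →ₗ[ℂ] B) : Prop :=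
  ∀ (d : ℕ) (b : Matrix (Fin d) (Fin d) B),
    momentSeries ρ (PowerSeries.monomial 1 b) =
      momentSeries μ (momentSeries ν (PowerSeries.monomial 1 b))

/-- One-parameter monotone convolution semigroups `{μ_t : t ≥ 0}` of completely positive
`B`-bimodule maps: `μ_{s+t} = μ_s ▷ μ_t`, `μ_0` is the unit of `▷` (evaluation at `X = 0`), and
`μ_t(P) → μ_0(P)` in norm as `t ↓ 0`, for every polynomial `P`. -/
structure IsMonotoneSemigroup [PartialOrder B] [StarOrderedRing B]
    (μ : ℝ≥0 → (NCPoly B →ₗ[ℂ] B)) : Prop where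
  cpBimodule : ∀ t, IsCPBimoduleMap (μ t)
  zero : μ 0 = (constTerm (B := B)).toLinearMap
  add : ∀ s t, IsMonotoneConvolution (μ s) (μ t) (μ (s + t))
  continuousAt_zero : ∀ P : NCPoly B, ContinuousAt (fun t => μ t P) 0

end Convolution

/-! ### Noncrossing partitions and monotone cumulants -/

section Cumulants

/-- Noncrossing partitions of `{1, …, n}`. -/
def IsNonCrossing {n : ℕ} (π : Finpartition (Finset.Icc 1 n)) : Prop :=
  ∀ U ∈ π.parts, ∀ V ∈ π.parts, U ≠ V →
    ¬ ∃ i ∈ U, ∃ j ∈ V, ∃ k ∈ U, ∃ l ∈ V, i < j ∧ j < k ∧ k < l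

/-- `U` covers `V`: there are `i, j ∈ U` with `i < v < j` for all `v ∈ V`. -/
def Covers (U V : Finset ℕ) : Prop := ∃ i ∈ U, ∃ j ∈ U, ∀ v ∈ V, i < v ∧ v < j

/-- `o(π)`: the number of orders on `π`, that is of bijections from the set of blocks of `π` onto a
chain with `|π|` elements such that `f U < f V` whenever `U` covers `V`. -/
def numOrders {n : ℕ} (π : Finpartition (Finset.Icc 1 n)) : ℕ :=
  Nat.card {f : π.parts ≃ Fin π.parts.card //
    ∀ U V : π.parts, Covers (U : Finset ℕ) (V : Finset ℕ) → f U < f V}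

/-- The values of `E` on the gaps to the right of the points of an increasing list
`v₁ < ⋯ < v_l` in an interval with right end point `j`:
`[E v₁ (v₂ - 1), …, E v_{l-1} (v_l - 1), E v_l j]`. -/
def gapValues {B : Type*} (E : ℕ → ℕ → B) (j : ℕ) : List ℕ → List B
  | [] => []
  | [v] => [E v j]
  | v :: w :: l => E v (w - 1) :: gapValues E j (w :: l)

variable {B : Type*} [CStarAlgebra B]

/-- Nested evaluation of `b_i X b_{i+1} X ⋯ X b_j` along the blocks `blk` of a noncrossing
partition of the positions `i + 1, …, j` (position `v` is the letter `X` between `b_{v-1}` and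
`b_v`): if `v₁ = i + 1 < v₂ < ⋯ < v_l` is the block of the first position, the result is
`κ[b_i X E₁ X E₂ ⋯ X E_l]`, where `E_m` is the nested evaluation of the part strictly between `v_m`
and `v_{m+1}` (for `m = l`: of the part after `v_l`). The first argument bounds the depth of the
recursion; any value `≥ j - i` gives the same result. -/
def nestedEval (κ : NCPoly B → B) (blk : ℕ → Finset ℕ) (b : ℕ → B) : ℕ → ℕ → ℕ → B
  | 0, i, _ => b i
  | m + 1, i, j =>
    if i = j then b i
    else κ (word (b i) (gapValues (nestedEval κ blk b m) j ((blk (i + 1)).sort (· ≤ ·))))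

/-- `K_π[b₀ X b₁ X ⋯ X bₙ]` for a functional `K` on `B₀⟨X⟩` and a noncrossing partition `π`. -/
def partitionedEval (K : ConstFree B →ₗ[ℂ] B) {n : ℕ} (π : Finpartition (Finset.Icc 1 n))
    (b : ℕ → B) : B :=
  nestedEval (fun P => K (dropConst P)) π.part b n 0 n

open Classical in
/-- `K` is the monotone cumulant functional of `μ`: a `B`-bimodule map `K : B₀⟨X⟩ → B` such that
`μ[b₀ X b₁ ⋯ X bₙ] = ∑_{π ∈ NC(n)} (o(π) / |π|!) K_π[b₀ X b₁ ⋯ X bₙ]` for all `n` and all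
`b₀, …, bₙ`. -/
structure IsMonotoneCumulant (μ : NCPoly B →ₗ[ℂ] B) (K : ConstFree B →ₗ[ℂ] B) : Prop where
  bimodule : ∀ (b c : B) (P : ConstFree B),
    K ⟨C b * (P : NCPoly B) * C c, C_mul_mul_C_mem b c P⟩ = b * K P * c
  moment_cumulant : ∀ (n : ℕ) (b : ℕ → B),
    μ (mono b n) = ∑ π ∈ (Finset.univ : Finset (Finpartition (Finset.Icc 1 n))).filter IsNonCrossing,
      ((numOrders π : ℂ) / (π.parts.card ! : ℂ)) • partitionedEval K π b

/-- `ν = ν_▷^{γ,σ}`: the monotone cumulant functional `K` of `ν` is the `B`-bimodule map with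
`K[X] = γ` and `K[X P X] = σ[P]` for all `P ∈ B⟨X⟩`. -/
def IsMonotoneNu (γ : B) (σ : NCPoly B →ₗ[ℂ] B) (ν : NCPoly B →ₗ[ℂ] B) : Prop :=
  ∃ K : ConstFree B →ₗ[ℂ] B, IsMonotoneCumulant ν K ∧
    K ⟨X, X_mem⟩ = γ ∧ ∀ P : NCPoly B, K ⟨X * P * X, X_mul_mul_X_mem P⟩ = σ P

end Cumulants

end

/-! Monotone convolution is composition of operators. For a functional `f`, let `T_f` (`convOp f`)
send a word to the sum, over all choices of letters `X` to keep, of the word in which `f` is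
evaluated on the gaps. Write `ε` for the constant term and `∂` for the free difference quotient.
Then `T_f` is the only operator with `∂ T = (T ⊗ T) ∂` and `ε T = f`, by induction on the degree
(`IsComorphism.eq_convOp`). Comparing power series with nilpotent matrix arguments gives `ρ = μ ▷ ν
↔ ρ = μ ∘ T_ν` (`isMonotoneConvolution_iff`), so `T_ρ = T_μ T_ν`, and a convolution semigroup
becomes a one-parameter semigroup of operators.

If `f` fixes the constants, `T_f - 1` lowers degrees, so `T_f = exp D` with `D` locally nilpotent,
and only finite sums occur. The logarithm is unique (`lexp_injective`). Hence `T_{μ_t} = exp(tD)`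
for rational `t`, and for real `t` by approximation from above and continuity at `0`.
Differentiating `∂ T = (T ⊗ T) ∂` yields `∂ D = (D ⊗ 1 + 1 ⊗ D) ∂`. Such a `D` is determined by `ε
D`, and for a bimodule map `ε D` killing `1` this means by `γ = ε D X` and `σ P = ε D (X P X)`. The
resulting operator is `gen γ σ`, and `evo γ σ t = ε exp(t gen γ σ)` is the semigroup.
Self-adjointness of `γ` and complete positivity of `σ` come from difference quotients at `0`.

Conversely, complete positivity of `evo` rests on the defect of the Leibniz rule for `D = gen γ σ`:
by `gen_mul`, `D(PQ) - D(P)Q - P D(Q)` collects the removed factors that straddle the product. For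
`Q = P*` and `σ` completely positive this defect is a sum of Gram matrices in smaller degree.
Interpolating between `ε exp(tD)(Pᵢ Pⱼ*)` and `ε(exp(tD) Pᵢ) ε(exp(tD) Pⱼ)*` then gives positivity
by induction on the degree (`matNonneg_evo`).

For the cumulants, `D` applied to a word removes one interval of letters and inserts the value of `ε
D` on it (`gen_posWord`). Thus `ε D^k` sums over the ways to exhaust the word in `k` removals. The
removed sets form a noncrossing partition, its removal orders are the reversed monotone orders
(`card_removals`), and the value does not depend on the order, since a stack machine reading the
word from right to left computes it in every case. Dividing by `k!` gives the moment-cumulant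
formula, so `ν_▷^{γ,σ} = evo γ σ 1`. -/

noncomputable section

open NCPoly

open scoped TensorProduct

/-! ### Exponentials of locally nilpotent operators -/

section LocNil

variable {V W : Type*} [AddCommGroup V] [Module ℂ V] [AddCommGroup W] [Module ℂ W]

/-- Locally nilpotent operators: every vector is killed by a power of `f`. -/
def LocNil (f : Module.End ℂ V) : Prop := ∀ v, ∃ N, (f ^ N) v = 0

lemma pow_apply_eq_zero_of_le {f : Module.End ℂ V} {v : V} {N k : ℕ} (h : (f ^ N) v = 0)
    (hk : N ≤ k) : (f ^ k) v = 0 := by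
  obtain ⟨m, rfl⟩ := Nat.exists_eq_add_of_le' hk
  rw [pow_add, Module.End.mul_apply, h, map_zero]

/-- Independence of the truncation point makes `psum`, defined through a chosen bound, linear, and
lets each later computation use its own bound. -/
lemma sum_range_pow_eq {f : Module.End ℂ V} {v : V} {N M : ℕ} (c : ℕ → ℂ) (hN : (f ^ N) v = 0)
    (hM : (f ^ M) v = 0) :
    ∑ k ∈ Finset.range N, c k • (f ^ k) v = ∑ k ∈ Finset.range M, c k • (f ^ k) v := by
  have key : ∀ a b : ℕ, a ≤ b → (f ^ a) v = 0 →
      ∑ k ∈ Finset.range a, c k • (f ^ k) v = ∑ k ∈ Finset.range b, c k • (f ^ k) v := by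
    intro a b hab ha
    refine Finset.sum_subset (Finset.range_mono hab) fun k _ hk => ?_
    rw [pow_apply_eq_zero_of_le ha (by simpa using hk), smul_zero]
  rcases le_total N M with h | h
  · exact key _ _ h hN
  · exact (key _ _ h hM).symm

open Classical in
/-- The power series `∑ cₖ fᵏ` in a locally nilpotent operator `f`. -/
def psum (c : ℕ → ℂ) (f : Module.End ℂ V) : Module.End ℂ V :=
  if hf : LocNil f then
    { toFun := fun v => ∑ k ∈ Finset.range (hf v).choose, c k • (f ^ k) v
      map_add' := fun v w => by
        have hv := (hf v).choose_spec
        have hw := (hf w).choose_spec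
        have hvw := (hf (v + w)).choose_spec
        set N := max (hf v).choose (hf w).choose with hN
        have h1 : (f ^ N) v = 0 := pow_apply_eq_zero_of_le hv (le_max_left _ _)
        have h2 : (f ^ N) w = 0 := pow_apply_eq_zero_of_le hw (le_max_right _ _)
        rw [sum_range_pow_eq c hv h1, sum_range_pow_eq c hw h2,
          sum_range_pow_eq c hvw (M := N) (by rw [map_add, h1, h2, add_zero]),
          ← Finset.sum_add_distrib]
        simp only [map_add, smul_add]
      map_smul' := fun z v => by
        have hv := (hf v).choose_spec
        have hzv := (hf (z • v)).choose_spec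
        rw [sum_range_pow_eq c hzv (M := (hf v).choose) (by rw [map_smul, hv, smul_zero]),
          RingHom.id_apply, Finset.smul_sum]
        simp only [map_smul, smul_comm z] }
  else 0

lemma psum_apply {f : Module.End ℂ V} (hf : LocNil f) (c : ℕ → ℂ) {v : V} {N : ℕ}
    (h : (f ^ N) v = 0) : psum c f v = ∑ k ∈ Finset.range N, c k • (f ^ k) v := by
  rw [psum, dif_pos hf]
  exact sum_range_pow_eq c (hf v).choose_spec h

/-- The exponential of a locally nilpotent operator. -/
def lexp (f : Module.End ℂ V) : Module.End ℂ V := psum (fun k => ((k ! : ℂ))⁻¹) f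

lemma lexp_apply {f : Module.End ℂ V} (hf : LocNil f) {v : V} {N : ℕ} (h : (f ^ N) v = 0) :
    lexp f v = ∑ k ∈ Finset.range N, ((k ! : ℂ))⁻¹ • (f ^ k) v :=
  psum_apply hf _ h

lemma LocNil.smul {f : Module.End ℂ V} (hf : LocNil f) (z : ℂ) : LocNil (z • f) := fun v => by
  obtain ⟨N, hN⟩ := hf v
  exact ⟨N, by rw [smul_pow, LinearMap.smul_apply, hN, smul_zero]⟩

lemma lexp_smul_apply {f : Module.End ℂ V} (hf : LocNil f) (z : ℂ) {v : V} {N : ℕ}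
    (h : (f ^ N) v = 0) :
    lexp (z • f) v = ∑ k ∈ Finset.range N, (z ^ k / (k ! : ℂ)) • (f ^ k) v := by
  rw [lexp_apply (hf.smul z) (N := N) (by rw [smul_pow, LinearMap.smul_apply, h, smul_zero])]
  refine Finset.sum_congr rfl fun k _ => ?_
  rw [smul_pow, LinearMap.smul_apply, smul_smul]
  congr 1
  rw [div_eq_mul_inv, mul_comm]

lemma locNil_zero : LocNil (0 : Module.End ℂ V) := fun _ => ⟨1, by simp⟩

lemma lexp_zero : lexp (0 : Module.End ℂ V) = 1 := by
  ext v
  rw [lexp_apply locNil_zero (N := 1) (by simp)]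
  simp

lemma comp_pow_apply {f : Module.End ℂ V} {g : Module.End ℂ W} {F : V →ₗ[ℂ] W}
    (h : ∀ v, F (f v) = g (F v)) (k : ℕ) (v : V) : F ((f ^ k) v) = (g ^ k) (F v) := by
  induction k generalizing v with
  | zero => rfl
  | succ k ih => rw [pow_succ, Module.End.mul_apply, ih, h, pow_succ, Module.End.mul_apply]

/-- Used for multiplication by constants, for insertion into a simple tensor, and for `fdq` itself,
where it turns infinitesimal identities into identities of exponentials. -/
lemma map_lexp {f : Module.End ℂ V} {g : Module.End ℂ W} (hf : LocNil f) (hg : LocNil g)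
    {F : V →ₗ[ℂ] W} (h : ∀ v, F (f v) = g (F v)) (v : V) :
    F (lexp f v) = lexp g (F v) := by
  obtain ⟨N, hN⟩ := hf v
  rw [lexp_apply hf hN, lexp_apply hg (N := N) (by rw [← comp_pow_apply h, hN, map_zero]),
    map_sum]
  simp only [map_smul, comp_pow_apply h]

/-- A common bound for the powers of two commuting locally nilpotent operators. -/
lemma exists_common_bound {f g : Module.End ℂ V} (hf : LocNil f) (hg : LocNil g)
    (hfg : Commute f g) (v : V) :
    ∃ N, ∀ i j, N ≤ i ∨ N ≤ j → (f ^ i) ((g ^ j) v) = 0 := by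
  obtain ⟨a, ha⟩ := hf v
  obtain ⟨b, hb⟩ := hg v
  refine ⟨max a b, fun i j h => ?_⟩
  rcases h with h | h
  · rw [← Module.End.mul_apply, (hfg.pow_pow i j).eq, Module.End.mul_apply,
      pow_apply_eq_zero_of_le ha (le_trans (le_max_left _ _) h), map_zero]
  · rw [pow_apply_eq_zero_of_le hb (le_trans (le_max_right _ _) h), map_zero]

lemma add_pow_apply_of_commute {f g : Module.End ℂ V} (hfg : Commute f g) (v : V) (k : ℕ) :
    ((k ! : ℂ))⁻¹ • ((f + g) ^ k) v = ∑ p ∈ Finset.HasAntidiagonal.antidiagonal k,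
      (((p.1 ! : ℂ))⁻¹ * ((p.2 ! : ℂ))⁻¹) • (f ^ p.1) ((g ^ p.2) v) := by
  rw [hfg.add_pow', LinearMap.sum_apply, Finset.smul_sum]
  refine Finset.sum_congr rfl fun p hp => ?_
  rw [LinearMap.smul_apply, Module.End.mul_apply, ← Nat.cast_smul_eq_nsmul ℂ, smul_smul]
  congr 1
  have h : p.1 + p.2 = k := by simpa using hp
  subst h
  rw [Nat.cast_add_choose]
  have := Nat.cast_ne_zero (R := ℂ).2 (p.1 + p.2).factorial_ne_zero
  field_simp

lemma locNil_add {f g : Module.End ℂ V} (hf : LocNil f) (hg : LocNil g) (hfg : Commute f g) :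
    LocNil (f + g) := fun v => by
  obtain ⟨N, hN⟩ := exists_common_bound hf hg hfg v
  refine ⟨2 * N, ?_⟩
  have h := add_pow_apply_of_commute hfg v (2 * N)
  rw [Finset.sum_eq_zero] at h
  · exact (smul_eq_zero.1 h).resolve_left
      (inv_ne_zero (Nat.cast_ne_zero.2 (Nat.factorial_ne_zero _)))
  · intro p hp
    have hp' : p.1 + p.2 = 2 * N := by simpa using hp
    rw [hN _ _ (by omega), smul_zero]

lemma lexp_add {f g : Module.End ℂ V} (hf : LocNil f) (hg : LocNil g) (hfg : Commute f g) :
    lexp (f + g) = lexp f * lexp g := by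
  ext v
  obtain ⟨N, hN⟩ := exists_common_bound hf hg hfg v
  -- If two exponents add up to `2 * N`, one of them is at least `N`.
  have hz : ((f + g) ^ (2 * N)) v = 0 := by
    have h := add_pow_apply_of_commute hfg v (2 * N)
    rw [Finset.sum_eq_zero] at h
    · exact (smul_eq_zero.1 h).resolve_left
        (inv_ne_zero (Nat.cast_ne_zero.2 (Nat.factorial_ne_zero _)))
    · intro p hp
      have hp' : p.1 + p.2 = 2 * N := by simpa using hp
      rw [hN _ _ (by omega), smul_zero]
  rw [Module.End.mul_apply, lexp_apply (locNil_add hf hg hfg) hz,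
    lexp_apply hg (N := N) (by simpa using hN 0 N (Or.inr le_rfl)), map_sum]
  simp only [map_smul]
  have h2 : ∀ j, lexp f ((g ^ j) v) =
      ∑ i ∈ Finset.range N, ((i ! : ℂ))⁻¹ • (f ^ i) ((g ^ j) v) := fun j =>
    lexp_apply hf (hN N j (Or.inl le_rfl))
  rw [Finset.sum_congr rfl fun k _ => add_pow_apply_of_commute hfg v k]
  simp only [h2, Finset.smul_sum, smul_smul]
  rw [← Finset.sum_product', Finset.sum_sigma']
  symm
  -- The square of exponents below `N` is matched with the triangle of total exponent below `2 * N`,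
  -- whose other terms vanish. The swap is due to `p.1` being the exponent of `g` and `p.2` that of
  -- `f`.
  refine Finset.sum_bij_ne_zero (fun p _ _ => ⟨p.1 + p.2, (p.2, p.1)⟩) ?_ ?_ ?_ ?_
  · intro p hp _
    simp only [Finset.mem_product, Finset.mem_range] at hp
    simp only [Finset.mem_sigma, Finset.mem_range, Finset.HasAntidiagonal.mem_antidiagonal]
    omega
  · intro p _ _ q _ _ h
    simp only [Sigma.mk.injEq, heq_eq_eq, Prod.mk.injEq] at h
    exact Prod.ext h.2.2 h.2.1
  · rintro ⟨k, i, j⟩ hk hne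
    simp only [Finset.mem_sigma, Finset.mem_range, Finset.HasAntidiagonal.mem_antidiagonal] at hk
    have hi : ¬ (N ≤ i ∨ N ≤ j) := fun h => hne (by
      show _ • (f ^ i) ((g ^ j) v) = 0
      rw [hN _ _ h, smul_zero])
    push Not at hi
    refine ⟨(j, i), ?_, ?_, ?_⟩
    · simpa using ⟨hi.2, hi.1⟩
    · rw [mul_comm]; exact hne
    · obtain ⟨_, h⟩ := hk
      subst h
      simp [add_comm]
  · intro p _ _
    rw [mul_comm]

lemma lexp_add_smul {f : Module.End ℂ V} (hf : LocNil f) (s t : ℂ) :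
    lexp ((s + t) • f) = lexp (s • f) * lexp (t • f) := by
  rw [add_smul]
  exact lexp_add (hf.smul s) (hf.smul t) (((Commute.refl f).smul_left s).smul_right t)

lemma lexp_nat_smul {f : Module.End ℂ V} (hf : LocNil f) (n : ℕ) :
    lexp ((n : ℂ) • f) = lexp f ^ n := by
  induction n with
  | zero => simp [lexp_zero]
  | succ n ih => rw [Nat.cast_succ, lexp_add_smul hf, ih, one_smul, pow_succ]

/-- A polynomial with coefficients in a vector space that vanishes at all natural numbers has
zero coefficients. -/
lemma coeff_eq_zero_of_forall_nat {N : ℕ} {u : ℕ → V}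
    (h : ∀ n : ℕ, ∑ k ∈ Finset.range N, (n : ℂ) ^ k • u k = 0) {k : ℕ} (hk : k < N) :
    u k = 0 := by
  refine (Module.forall_dual_apply_eq_zero_iff ℂ _).1 fun F => ?_
  set p : Polynomial ℂ := ∑ j ∈ Finset.range N, Polynomial.C (F (u j)) * Polynomial.X ^ j with hp
  have hp0 : p = 0 := by
    refine Polynomial.eq_zero_of_infinite_isRoot p
      ((Set.infinite_range_of_injective Nat.cast_injective).mono ?_)
    rintro _ ⟨n, rfl⟩
    have := congrArg F (h n)
    simp only [map_sum, map_smul, smul_eq_mul, map_zero] at this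
    simp only [Set.mem_ofPred_eq, Polynomial.IsRoot, hp, Polynomial.eval_finsetSum,
      Polynomial.eval_mul, Polynomial.eval_C, Polynomial.eval_pow, Polynomial.eval_X]
    rw [← this]
    exact Finset.sum_congr rfl fun j _ => mul_comm _ _
  have := congrArg (fun q => Polynomial.coeff q k) hp0
  simpa [hp, Polynomial.finsetSum_coeff, Polynomial.coeff_C_mul, Polynomial.coeff_X_pow, hk]
    using this

lemma coeff_eq_of_forall_nat {N : ℕ} {u w : ℕ → V}
    (h : ∀ n : ℕ, ∑ k ∈ Finset.range N, (n : ℂ) ^ k • u k =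
      ∑ k ∈ Finset.range N, (n : ℂ) ^ k • w k) {k : ℕ} (hk : k < N) : u k = w k := by
  refine sub_eq_zero.1 (coeff_eq_zero_of_forall_nat (u := fun k => u k - w k) (N := N) ?_ hk)
  intro n
  simp only [smul_sub, Finset.sum_sub_distrib, h n, sub_self]

/-- First order comparison of two one-parameter groups. -/
lemma first_order_eq {Z : Type*} [AddCommGroup Z] [Module ℂ Z] {f : Module.End ℂ V}
    {g : Module.End ℂ W} (hf : LocNil f) (hg : LocNil g) (F : V →ₗ[ℂ] Z) (ψ : W →ₗ[ℂ] Z)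
    {v : V} {w : W}
    (h : ∀ n : ℕ, F (lexp ((n : ℂ) • f) v) = ψ (lexp ((n : ℂ) • g) w)) :
    F (f v) = ψ (g w) := by
  obtain ⟨a, ha⟩ := hf v
  obtain ⟨b, hb⟩ := hg w
  -- At least `2`, so that the linear coefficient is among those compared.
  set N := max (max a b) 2
  have ha' : (f ^ N) v = 0 := pow_apply_eq_zero_of_le ha (by omega)
  have hb' : (g ^ N) w = 0 := pow_apply_eq_zero_of_le hb (by omega)
  have := coeff_eq_of_forall_nat (N := N) (u := fun k => ((k ! : ℂ))⁻¹ • F ((f ^ k) v))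
    (w := fun k => ((k ! : ℂ))⁻¹ • ψ ((g ^ k) w)) (fun n => by
      have := h n
      rw [lexp_smul_apply hf _ ha', lexp_smul_apply hg _ hb', map_sum, map_sum] at this
      simpa only [map_smul, smul_smul, div_eq_mul_inv] using this) (k := 1) (by omega)
  simpa using this

/-- Equal exponentials have equal `n`-th powers `exp(n f) = exp(n g)` for all natural `n`; on each
vector these are polynomials in `n`, whose linear coefficients are `f` and `g`. -/
lemma lexp_injective {f g : Module.End ℂ V} (hf : LocNil f) (hg : LocNil g)
    (h : lexp f = lexp g) : f = g := by
  ext v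
  refine first_order_eq hf hg LinearMap.id LinearMap.id fun n => ?_
  rw [lexp_nat_smul hf, lexp_nat_smul hg, h]

/-- Locally unipotent operators are exponentials. -/
lemma exists_lexp_eq {U : Module.End ℂ V} (hU : LocNil (U - 1)) :
    ∃ D : Module.End ℂ V, LocNil D ∧ lexp D = U := by
  set N := U - 1 with hNdef
  have hUN : U = 1 + N := by rw [hNdef]; abel
  -- `c j k` is the coefficient of `n ^ j` in the binomial coefficient `n.choose k`. Hence `U ^ n =
  -- ∑ⱼ n ^ j A j` with `A j = ∑ₖ c j k N ^ k`, and `A 1` is the logarithm of `U`.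
  set c : ℕ → ℕ → ℂ := fun j k => (descPochhammer ℂ k).coeff j * ((k ! : ℂ))⁻¹ with hc
  have hchoose : ∀ (n k M : ℕ), k < M → ((n.choose k : ℕ) : ℂ) =
      ∑ j ∈ Finset.range M, (n : ℂ) ^ j * c j k := by
    intro n k M hk
    have h1 : (descPochhammer ℂ k).eval (n : ℂ) =
        ∑ j ∈ Finset.range M, (descPochhammer ℂ k).coeff j * (n : ℂ) ^ j :=
      Polynomial.eval_eq_sum_range' (by rw [descPochhammer_natDegree]; exact hk) _
    rw [descPochhammer_eval_eq_descFactorial, Nat.descFactorial_eq_factorial_mul_choose] at h1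
    have h0 := Nat.cast_ne_zero (R := ℂ).2 k.factorial_ne_zero
    push_cast at h1
    rw [← mul_right_inj' h0, h1, Finset.mul_sum]
    refine Finset.sum_congr rfl fun j _ => ?_
    simp only [hc]
    field_simp
  set A : ℕ → Module.End ℂ V := fun j => psum (c j) N with hA
  have hAapp : ∀ j v M, (N ^ M) v = 0 → A j v = ∑ k ∈ Finset.range M, c j k • (N ^ k) v :=
    fun j v M h => psum_apply hU _ h
  have hpow : ∀ (n : ℕ) v M, (N ^ M) v = 0 →
      (U ^ n) v = ∑ j ∈ Finset.range M, (n : ℂ) ^ j • A j v := by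
    intro n v M hM
    have h1 : (U ^ n) v = ∑ k ∈ Finset.range M, ((n.choose k : ℕ) : ℂ) • (N ^ k) v := by
      rw [hUN, add_comm, (Commute.one_right N).add_pow, LinearMap.sum_apply]
      have h2 : ∀ k, (N ^ k * 1 ^ (n - k) * ((n.choose k : ℕ) : Module.End ℂ V)) v =
          ((n.choose k : ℕ) : ℂ) • (N ^ k) v := by
        intro k
        rw [one_pow, mul_one, ← Nat.cast_comm, ← nsmul_eq_mul, LinearMap.smul_apply,
          Nat.cast_smul_eq_nsmul]
      simp only [h2]
      have key : ∀ K, (∀ k, K ≤ k → ((n.choose k : ℕ) : ℂ) • (N ^ k) v = 0) →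
          ∑ k ∈ Finset.range K, ((n.choose k : ℕ) : ℂ) • (N ^ k) v =
          ∑ k ∈ Finset.range (max K (max M (n + 1))), ((n.choose k : ℕ) : ℂ) • (N ^ k) v := by
        intro K hK
        refine Finset.sum_subset (Finset.range_mono (le_max_left _ _)) fun k _ hk => ?_
        exact hK k (by simpa using hk)
      rw [key (n + 1) fun k hk => by rw [Nat.choose_eq_zero_of_lt hk]; simp,
        key M fun k hk => by rw [pow_apply_eq_zero_of_le hM hk, smul_zero]]
      congr 2
      omega
    rw [h1, Finset.sum_congr rfl fun k hk => by
      rw [hchoose n k M (by simpa using hk), Finset.sum_smul], Finset.sum_comm]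
    refine Finset.sum_congr rfl fun j _ => ?_
    rw [hAapp j v M hM, Finset.smul_sum]
    exact Finset.sum_congr rfl fun k _ => by rw [smul_smul]
  have hNA : ∀ j v, N (A j v) = A j (N v) := by
    intro j v
    obtain ⟨M, hM⟩ := hU v
    rw [hAapp j v M hM, hAapp j (N v) M
      (by rw [← Module.End.mul_apply, ← pow_succ, pow_succ', Module.End.mul_apply, hM, map_zero]),
      map_sum]
    refine Finset.sum_congr rfl fun k _ => ?_
    rw [map_smul, ← Module.End.mul_apply, ← pow_succ', pow_succ, Module.End.mul_apply]
  have hkill : ∀ j v M, (N ^ M) v = 0 → (N ^ M) (A j v) = 0 := by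
    intro j v M h
    rw [← comp_pow_apply (F := A j) (f := N) (g := N) (fun v => (hNA j v).symm), h, map_zero]
  -- The series `A 1` has no constant term, so each application of it lowers by one the power of `N`
  -- that kills a vector. This gives local nilpotency.
  have hc10 : c 1 0 = 0 := by simp [hc, Polynomial.coeff_one]
  have hA1 : ∀ v M, (N ^ (M + 1)) v = 0 → (N ^ M) (A 1 v) = 0 := by
    intro v M h
    rw [hAapp 1 v _ h, map_sum]
    refine Finset.sum_eq_zero fun k _ => ?_
    rcases k with _ | k
    · rw [hc10, zero_smul, map_zero]
    · rw [map_smul, ← Module.End.mul_apply, ← pow_add,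
        pow_apply_eq_zero_of_le h (by omega), smul_zero]
  have hD : LocNil (A 1) := by
    have : ∀ M v, (N ^ M) v = 0 → (A 1 ^ M) v = 0 := by
      intro M
      induction M with
      | zero => intro v h; exact h
      | succ M ih =>
        intro v h
        rw [pow_succ, Module.End.mul_apply]
        exact ih _ (hA1 v M h)
    intro v
    obtain ⟨M, hM⟩ := hU v
    exact ⟨M, this M v hM⟩
  have hA0 : ∀ v, A 0 v = v := by
    intro v
    obtain ⟨M, hM⟩ := hU v
    have hM' : (N ^ (M + 1)) v = 0 := pow_apply_eq_zero_of_le hM (by omega)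
    have h := hpow 0 v (M + 1) hM'
    rw [Finset.sum_range_succ'] at h
    simpa using h.symm
  -- Comparison of the coefficients of `m ^ 1 n ^ j` in `U ^ (m + n) = U ^ m U ^ n`, first in `m`
  -- and then in `n`. The recursion gives `A j = (A 1) ^ j / j!`, and `n = 1` then exhibits `U` as
  -- the exponential.
  have hrec : ∀ v j, ((j + 1 : ℕ) : ℂ) • A (j + 1) v = A 1 (A j v) := by
    intro v j
    obtain ⟨M0, hM0⟩ := hU v
    set M := max M0 (j + 2) with hMd
    have hM : (N ^ M) v = 0 := pow_apply_eq_zero_of_le hM0 (le_max_left _ _)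
    have hM1 : (N ^ (M + 1)) v = 0 := pow_apply_eq_zero_of_le hM (by omega)
    have h2 : ∀ n : ℕ, ∑ i ∈ Finset.range M, (n : ℂ) ^ i • (((i + 1 : ℕ) : ℂ) • A (i + 1) v) =
        ∑ i ∈ Finset.range M, (n : ℂ) ^ i • A 1 (A i v) := by
      intro n
      have h3 : ∀ m : ℕ, ∑ i ∈ Finset.range (M + 1), (m : ℂ) ^ i •
          (∑ k ∈ Finset.range (M + 1), (((k.choose i : ℕ) : ℂ) * (n : ℂ) ^ (k - i)) • A k v) =
          ∑ i ∈ Finset.range (M + 1), (m : ℂ) ^ i •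
            ∑ k ∈ Finset.range M, (n : ℂ) ^ k • A i (A k v) := by
        intro m
        have h4 := hpow (m + n) v (M + 1) hM1
        rw [pow_add, Module.End.mul_apply, hpow n v M hM, map_sum] at h4
        simp only [map_smul] at h4
        rw [Finset.sum_congr rfl fun k _ => by
          rw [hpow m (A k v) (M + 1) (hkill k v _ hM1), Finset.smul_sum]] at h4
        rw [Finset.sum_comm] at h4
        have h5 : ∀ k ∈ Finset.range (M + 1), ((m + n : ℕ) : ℂ) ^ k • A k v =
            ∑ i ∈ Finset.range (M + 1),
              (m : ℂ) ^ i • (((k.choose i : ℕ) : ℂ) * (n : ℂ) ^ (k - i)) • A k v := by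
          intro k hk
          rw [Nat.cast_add, add_pow, Finset.sum_smul]
          simp only [smul_smul]
          rw [Finset.mem_range] at hk
          have hsub : Finset.range (k + 1) ⊆ Finset.range (M + 1) :=
            Finset.range_mono (by omega)
          rw [← Finset.sum_subset hsub]
          · exact Finset.sum_congr rfl fun i _ => by congr 1; ring
          · intro i _ hi
            rw [Nat.choose_eq_zero_of_lt (by simpa using hi)]
            simp
        rw [Finset.sum_congr rfl h5] at h4
        have h6 := Finset.sum_comm.trans h4.symm
        simp only [← Finset.smul_sum] at h6
        rw [h6]
        refine Finset.sum_congr rfl fun i _ => ?_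
        rw [Finset.smul_sum]
        exact Finset.sum_congr rfl fun k _ => smul_comm _ _ _
      have h6 := coeff_eq_of_forall_nat h3 (k := 1) (by omega)
      rw [← h6, Finset.sum_range_succ']
      simp only [Nat.choose_one_right, Nat.add_sub_cancel, Nat.cast_zero,
        zero_mul, zero_smul, add_zero, smul_smul]
      exact Finset.sum_congr rfl fun k _ => by rw [mul_comm]
    exact coeff_eq_of_forall_nat h2 (k := j) (by omega)
  have hAk : ∀ j v, A j v = ((j ! : ℂ))⁻¹ • (A 1 ^ j) v := by
    intro j
    induction j with
    | zero => intro v; simp [hA0]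
    | succ j ih =>
      intro v
      have h1 := hrec v j
      have h0 : ((j + 1 : ℕ) : ℂ) ≠ 0 := Nat.cast_ne_zero.2 (Nat.succ_ne_zero j)
      rw [← inv_smul_smul₀ h0 (A (j + 1) v), h1, ih, map_smul, smul_smul, pow_succ',
        Module.End.mul_apply, Nat.factorial_succ, Nat.cast_mul, mul_inv]
  refine ⟨A 1, hD, ?_⟩
  ext v
  obtain ⟨M, hM⟩ := hU v
  obtain ⟨M', hM'⟩ := hD v
  set K := max M M'
  rw [lexp_apply hD (N := K) (pow_apply_eq_zero_of_le hM' (le_max_right _ _))]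
  have := hpow 1 v K (pow_apply_eq_zero_of_le hM (le_max_left _ _))
  rw [pow_one] at this
  rw [this]
  simp only [Nat.cast_one, one_pow, one_smul, hAk]

end LocNil

/-! ### Words, degrees and the free difference quotient -/

namespace NCPoly

variable {B : Type*} [CStarAlgebra B]

/-- The operators below are known through their behaviour under left multiplication by constants and
by `X`; this is the matching induction principle. -/
lemma induction_left {p : NCPoly B → Prop} (h1 : p 1) (hC : ∀ b P, p P → p (C b * P))
    (hX : ∀ P, p P → p (X * P)) (hadd : ∀ P Q, p P → p Q → p (P + Q)) (P : NCPoly B) : p P := by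
  have h : ∀ P : NCPoly B, ∀ Q, p Q → p (P * Q) := by
    intro P
    induction P using NCPoly.induction with
    | hC b => exact fun Q hQ => hC b Q hQ
    | hX => exact fun Q hQ => hX Q hQ
    | hadd P Q hP hQ => exact fun R hR => by rw [add_mul]; exact hadd _ _ (hP R hR) (hQ R hR)
    | hmul P Q hP hQ => exact fun R hR => by rw [mul_assoc]; exact hP _ (hQ R hR)
  simpa using h P 1 h1

@[simp] lemma word_nil (b : B) : word b [] = C b := rfl

lemma word_append_singleton (b : B) (l : List B) (c : B) :
    word b (l ++ [c]) = word b l * X * C c := by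
  simp [word, List.foldl_append]

lemma foldl_mul_left (P Q : NCPoly B) (l : List B) :
    l.foldl (fun P c => P * X * C c) (P * Q) = P * l.foldl (fun P c => P * X * C c) Q := by
  induction l generalizing Q with
  | nil => rfl
  | cons c l ih => rw [List.foldl_cons, List.foldl_cons, mul_assoc P Q X, mul_assoc P, ih]

lemma word_cons (b c : B) (l : List B) : word b (c :: l) = C b * (X * word c l) := by
  rw [word, word, List.foldl_cons, mul_assoc, foldl_mul_left]
  congr 1
  exact foldl_mul_left X (C c) l

lemma C_mul_word (b c : B) (l : List B) : C b * word c l = word (b * c) l := by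
  cases l with
  | nil => simp
  | cons d l => rw [word_cons, word_cons, map_mul, mul_assoc]

lemma word_mul_C (b c : B) (l : List B) (d : B) :
    word b (l ++ [c]) * C d = word b (l ++ [c * d]) := by
  rw [word_append_singleton, word_append_singleton, map_mul, mul_assoc]

/-- Polynomials of degree at most `n`. -/
def degLE (B : Type*) [CStarAlgebra B] (n : ℕ) : Submodule ℂ (NCPoly B) :=
  Submodule.span ℂ {P | ∃ (b : B) (l : List B), l.length ≤ n ∧ P = word b l}

lemma word_mem_degLE {b : B} {l : List B} {n : ℕ} (h : l.length ≤ n) : word b l ∈ degLE B n :=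
  Submodule.subset_span ⟨b, l, h, rfl⟩

lemma C_mem_degLE (b : B) (n : ℕ) : C b ∈ degLE B n :=
  word_mem_degLE (l := []) (Nat.zero_le n)

lemma degLE_mono {m n : ℕ} (h : m ≤ n) : degLE B m ≤ degLE B n :=
  Submodule.span_mono fun _ ⟨b, l, hl, hP⟩ => ⟨b, l, hl.trans h, hP⟩

lemma map_mem_of_word {V : Type*} [AddCommGroup V] [Module ℂ V] {n : ℕ} {f : NCPoly B →ₗ[ℂ] V}
    {S : Submodule ℂ V} (h : ∀ (b : B) (l : List B), l.length ≤ n → f (word b l) ∈ S)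
    {P : NCPoly B} (hP : P ∈ degLE B n) : f P ∈ S := by
  have : degLE B n ≤ S.comap f := Submodule.span_le.2 (by
    rintro _ ⟨b, l, hl, rfl⟩
    exact h b l hl)
  exact this hP

lemma C_mul_mem_degLE (b : B) {n : ℕ} {P : NCPoly B} (hP : P ∈ degLE B n) :
    C b * P ∈ degLE B n :=
  map_mem_of_word (f := LinearMap.mulLeft ℂ (C b)) (fun c l hl => by
    rw [LinearMap.mulLeft_apply, C_mul_word]; exact word_mem_degLE hl) hP

lemma X_mul_mem_degLE {n : ℕ} {P : NCPoly B} (hP : P ∈ degLE B n) :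
    X * P ∈ degLE B (n + 1) :=
  map_mem_of_word (f := LinearMap.mulLeft ℂ X) (fun c l hl => by
    have : X * word c l = word 1 (c :: l) := by rw [word_cons, map_one, one_mul]
    rw [LinearMap.mulLeft_apply, this]; exact word_mem_degLE (by simpa using hl)) hP

lemma mul_C_mem_degLE (d : B) {n : ℕ} {P : NCPoly B} (hP : P ∈ degLE B n) :
    P * C d ∈ degLE B n :=
  map_mem_of_word (f := LinearMap.mulRight ℂ (C d)) (fun c l hl => by
    rw [LinearMap.mulRight_apply]
    rcases List.eq_nil_or_concat l with rfl | ⟨l, e, rfl⟩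
    · rw [word_nil, ← map_mul]; exact C_mem_degLE _ _
    · rw [List.concat_eq_append] at hl ⊢
      rw [word_mul_C]; exact word_mem_degLE (by simpa using hl)) hP

lemma exists_mem_degLE (P : NCPoly B) : ∃ n, P ∈ degLE B n := by
  induction P using induction_left with
  | h1 => exact ⟨0, by simpa using C_mem_degLE (1 : B) 0⟩
  | hC b P h => exact h.imp fun n hn => C_mul_mem_degLE b hn
  | hX P h => obtain ⟨n, hn⟩ := h; exact ⟨n + 1, X_mul_mem_degLE hn⟩
  | hadd P Q hP hQ =>
    obtain ⟨n, hn⟩ := hP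
    obtain ⟨m, hm⟩ := hQ
    exact ⟨max n m, add_mem (degLE_mono (le_max_left _ _) hn) (degLE_mono (le_max_right _ _) hm)⟩

lemma linearMap_ext_word {V : Type*} [AddCommGroup V] [Module ℂ V] {f g : NCPoly B →ₗ[ℂ] V}
    (h : ∀ (b : B) (l : List B), f (word b l) = g (word b l)) : f = g := by
  ext P
  obtain ⟨n, hn⟩ := exists_mem_degLE P
  have := map_mem_of_word (f := f - g) (S := ⊥) (fun b l _ => by simp [h b l]) hn
  simpa [sub_eq_zero] using this

lemma word_eq_mono (b : B) (l : List B) :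
    ∃ c : ℕ → B, word b l = mono c l.length := by
  refine ⟨fun i => (b :: l).getD i 0, ?_⟩
  rw [mono]
  congr 1
  refine List.ext_getElem (by simp) fun i h1 h2 => ?_
  simp [h1]

lemma linearMap_ext_mono {V : Type*} [AddCommGroup V] [Module ℂ V] {f g : NCPoly B →ₗ[ℂ] V}
    (h : ∀ (n : ℕ) (b : ℕ → B), f (mono b n) = g (mono b n)) : f = g :=
  linearMap_ext_word fun b l => by
    obtain ⟨c, hc⟩ := word_eq_mono b l
    rw [hc, h]

/-- An operator that lowers degrees is locally nilpotent. -/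
lemma locNil_of_lowers {f : Module.End ℂ (NCPoly B)} (h0 : ∀ P ∈ degLE B 0, f P = 0)
    (h : ∀ n, ∀ P ∈ degLE B (n + 1), f P ∈ degLE B n) : LocNil f := by
  have : ∀ n, ∀ P ∈ degLE B n, (f ^ (n + 1)) P = 0 := by
    intro n
    induction n with
    | zero => intro P hP; simpa using h0 P hP
    | succ n ih =>
      intro P hP
      rw [pow_succ, Module.End.mul_apply]
      exact ih _ (h n P hP)
  intro P
  obtain ⟨n, hn⟩ := exists_mem_degLE P
  exact ⟨n + 1, this n P hn⟩

/-- The contraction `p ⊗ q ↦ f(p) q`. -/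
def contr (f : NCPoly B →ₗ[ℂ] B) : NCPoly B ⊗[ℂ] NCPoly B →ₗ[ℂ] NCPoly B :=
  LinearMap.mul' ℂ (NCPoly B) ∘ₗ TensorProduct.map ((C (B := B)).toLinearMap ∘ₗ f) LinearMap.id

@[simp] lemma contr_tmul (f : NCPoly B →ₗ[ℂ] B) (p q : NCPoly B) :
    contr f (p ⊗ₜ q) = C (f p) * q := rfl

/-- The representation of `B⟨X⟩` whose matrix coefficients are the identity, the free difference
quotient and the generator attached to the pair `(γ, σ)`. -/
def genRep (γ : B) (σ : NCPoly B →ₗ[ℂ] B) :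
    NCPoly B →ₐ[ℂ] Module.End ℂ (NCPoly B × (NCPoly B ⊗[ℂ] NCPoly B) × NCPoly B) :=
  let L : NCPoly B →ₐ[ℂ] Module.End ℂ (NCPoly B × (NCPoly B ⊗[ℂ] NCPoly B) × NCPoly B) :=
    (Algebra.lmul ℂ (NCPoly B × (NCPoly B ⊗[ℂ] NCPoly B) × NCPoly B)).comp
      ((AlgHom.id ℂ (NCPoly B)).prod
        ((Algebra.TensorProduct.includeLeft (R := ℂ) (S := ℂ) (A := NCPoly B) (B := NCPoly B)).prod
          (AlgHom.id ℂ (NCPoly B))))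
  -- The universal property only produces algebra homomorphisms, so the recursions are encoded in a
  -- triangular representation: `X` acts by multiplication plus `(p, u, q) ↦ (0, 1 ⊗ p, γ p + contr
  -- σ u)`.
  lift (L.comp C) (L X +
    LinearMap.prod 0 (LinearMap.prod
      (TensorProduct.mk ℂ (NCPoly B) (NCPoly B) 1 ∘ₗ LinearMap.fst ℂ _ _)
      (LinearMap.mulLeft ℂ (C γ) ∘ₗ LinearMap.fst ℂ _ _ +
        contr σ ∘ₗ LinearMap.fst ℂ _ _ ∘ₗ LinearMap.snd ℂ _ _)))

lemma genRep_C (γ : B) (σ : NCPoly B →ₗ[ℂ] B) (b : B)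
    (v : NCPoly B × (NCPoly B ⊗[ℂ] NCPoly B) × NCPoly B) :
    genRep γ σ (C b) v = (C b * v.1, (C b ⊗ₜ 1) * v.2.1, C b * v.2.2) := by
  rw [genRep, lift_C]; rfl

lemma genRep_X (γ : B) (σ : NCPoly B →ₗ[ℂ] B)
    (v : NCPoly B × (NCPoly B ⊗[ℂ] NCPoly B) × NCPoly B) :
    genRep γ σ X v = (X * v.1, (X ⊗ₜ 1) * v.2.1 + 1 ⊗ₜ v.1,
      X * v.2.2 + (C γ * v.1 + contr σ v.2.1)) := by
  rw [genRep, lift_X, LinearMap.add_apply]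
  refine Prod.ext (add_zero _) (Prod.ext rfl rfl)

/-- The free difference quotient: the derivation with `∂ b = 0` and `∂ X = 1 ⊗ 1`. -/
def fdq : NCPoly B →ₗ[ℂ] NCPoly B ⊗[ℂ] NCPoly B :=
  LinearMap.fst ℂ _ _ ∘ₗ LinearMap.snd ℂ _ _ ∘ₗ
    LinearMap.applyₗ ((1, 0, 0) : NCPoly B × (NCPoly B ⊗[ℂ] NCPoly B) × NCPoly B) ∘ₗ
      (genRep (0 : B) 0).toLinearMap

/-- The generator attached to `(γ, σ)`: it replaces each factor `X` by `γ` and each factor `X P X`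
by `σ P`. -/
def gen (γ : B) (σ : NCPoly B →ₗ[ℂ] B) : Module.End ℂ (NCPoly B) :=
  LinearMap.snd ℂ _ _ ∘ₗ LinearMap.snd ℂ _ _ ∘ₗ
    LinearMap.applyₗ ((1, 0, 0) : NCPoly B × (NCPoly B ⊗[ℂ] NCPoly B) × NCPoly B) ∘ₗ
      (genRep γ σ).toLinearMap

lemma genRep_apply_fst (γ : B) (σ : NCPoly B →ₗ[ℂ] B) (P : NCPoly B) :
    (genRep γ σ P (1, 0, 0)).1 = P := by
  induction P using induction_left with
  | h1 => simp
  | hC b P h => rw [map_mul, Module.End.mul_apply, genRep_C, h]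
  | hX P h => rw [map_mul, Module.End.mul_apply, genRep_X, h]
  | hadd P Q hP hQ => rw [map_add, LinearMap.add_apply, Prod.fst_add, hP, hQ]

lemma fdq_apply (P : NCPoly B) : fdq P = (genRep (0 : B) 0 P (1, 0, 0)).2.1 := rfl

lemma gen_apply (γ : B) (σ : NCPoly B →ₗ[ℂ] B) (P : NCPoly B) :
    gen γ σ P = (genRep γ σ P (1, 0, 0)).2.2 := rfl

@[simp] lemma fdq_one : fdq (1 : NCPoly B) = 0 := by simp [fdq_apply]

@[simp] lemma fdq_C_mul (b : B) (P : NCPoly B) : fdq (C b * P) = (C b ⊗ₜ 1) * fdq P := by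
  rw [fdq_apply, map_mul, Module.End.mul_apply, genRep_C]; rfl

@[simp] lemma fdq_X_mul (P : NCPoly B) : fdq (X * P) = (X ⊗ₜ 1) * fdq P + 1 ⊗ₜ P := by
  rw [fdq_apply, map_mul, Module.End.mul_apply, genRep_X, genRep_apply_fst]; rfl

@[simp] lemma fdq_C (b : B) : fdq (C b) = 0 := by simpa using fdq_C_mul b 1

@[simp] lemma fdq_X : fdq (X : NCPoly B) = 1 ⊗ₜ 1 := by simpa using fdq_X_mul (1 : NCPoly B)

/-- The middle component does not see the pair, so `fdq`, defined with zero data, is also the one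
occurring in the recursion of `gen γ σ`. -/
lemma genRep_apply_snd_fst (γ : B) (σ : NCPoly B →ₗ[ℂ] B) (P : NCPoly B) :
    (genRep γ σ P (1, 0, 0)).2.1 = fdq P := by
  induction P using induction_left with
  | h1 => simp
  | hC b P h => rw [map_mul, Module.End.mul_apply, genRep_C, h, fdq_C_mul]
  | hX P h => rw [map_mul, Module.End.mul_apply, genRep_X, h, fdq_X_mul, genRep_apply_fst]
  | hadd P Q hP hQ =>
    rw [map_add, LinearMap.add_apply, Prod.snd_add, Prod.fst_add, hP, hQ, map_add]

lemma fdq_mul (P Q : NCPoly B) : fdq (P * Q) = fdq P * (1 ⊗ₜ Q) + (P ⊗ₜ 1) * fdq Q := by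
  induction P using induction_left with
  | h1 => simp [← Algebra.TensorProduct.one_def]
  | hC b P h =>
    rw [mul_assoc, fdq_C_mul, h, fdq_C_mul, mul_add, mul_assoc, ← mul_assoc,
      ← mul_assoc (C b ⊗ₜ[ℂ] (1 : NCPoly B)), Algebra.TensorProduct.tmul_mul_tmul, one_mul,
      mul_assoc]
  | hX P h =>
    rw [mul_assoc, fdq_X_mul, h, fdq_X_mul, mul_add, add_mul, ← mul_assoc, ← mul_assoc,
      Algebra.TensorProduct.tmul_mul_tmul, Algebra.TensorProduct.tmul_mul_tmul, one_mul]
    abel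
  | hadd P Q hP hQ =>
    rw [add_mul, map_add, hP, hQ, map_add, TensorProduct.add_tmul]
    simp only [add_mul]
    abel

section gen

variable (γ : B) (σ : NCPoly B →ₗ[ℂ] B)

@[simp] lemma gen_one : gen γ σ 1 = 0 := by simp [gen_apply]

@[simp] lemma gen_C_mul (b : B) (P : NCPoly B) : gen γ σ (C b * P) = C b * gen γ σ P := by
  rw [gen_apply, map_mul, Module.End.mul_apply, genRep_C]; rfl

@[simp] lemma gen_X_mul (P : NCPoly B) :
    gen γ σ (X * P) = X * gen γ σ P + (C γ * P + contr σ (fdq P)) := by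
  rw [gen_apply, map_mul, Module.End.mul_apply, genRep_X, genRep_apply_fst, genRep_apply_snd_fst]
  rfl

@[simp] lemma gen_C (b : B) : gen γ σ (C b) = 0 := by simpa using gen_C_mul γ σ b 1

lemma contr_mul_right (u : NCPoly B ⊗[ℂ] NCPoly B) (Q : NCPoly B) :
    contr σ (u * (1 ⊗ₜ Q)) = contr σ u * Q := by
  induction u with
  | zero => simp
  | tmul p q => simp [mul_assoc]
  | add u v hu hv => rw [add_mul, map_add, hu, hv, map_add, add_mul]

/-- The part of the generator acting across a product: `(a ⊗ p, q ⊗ r) ↦ a σ(p q) r`. -/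
def straddle (v : NCPoly B ⊗[ℂ] NCPoly B) : NCPoly B ⊗[ℂ] NCPoly B →ₗ[ℂ] NCPoly B :=
  TensorProduct.lift (LinearMap.mk₂ ℂ (fun a p => a * contr (σ ∘ₗ LinearMap.mulLeft ℂ p) v)
    (fun a a' p => add_mul _ _ _) (fun z a p => smul_mul_assoc _ _ _)
    (fun a p p' => by
      rw [← mul_add]
      congr 1
      induction v with
      | zero => simp
      | tmul q r => simp [add_mul]
      | add u v hu hv => simp only [map_add, hu, hv]; abel)
    (fun z a p => by
      rw [← mul_smul_comm]
      congr 1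
      induction v with
      | zero => simp
      | tmul q r => simp
      | add u v hu hv => simp only [map_add, hu, hv, smul_add]))

@[simp] lemma straddle_tmul (v : NCPoly B ⊗[ℂ] NCPoly B) (a p : NCPoly B) :
    straddle σ v (a ⊗ₜ p) = a * contr (σ ∘ₗ LinearMap.mulLeft ℂ p) v := rfl

lemma straddle_lmul (u v : NCPoly B ⊗[ℂ] NCPoly B) (P : NCPoly B) :
    straddle σ v ((P ⊗ₜ 1) * u) = P * straddle σ v u := by
  induction u with
  | zero => simp
  | tmul p q => simp [mul_assoc]
  | add u v hu hv => rw [mul_add, map_add, hu, hv, map_add, mul_add]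

lemma contr_comp_mulLeft (P : NCPoly B) (u : NCPoly B ⊗[ℂ] NCPoly B) :
    contr (σ ∘ₗ LinearMap.mulLeft ℂ P) u = contr σ ((P ⊗ₜ 1) * u) := by
  induction u with
  | zero => simp
  | tmul p q => simp
  | add u v hu hv => rw [mul_add, map_add, hu, hv, map_add]

/-- A removed factor lies in `P`, lies in `Q`, or starts in `P` and ends in `Q`. The third kind is
the defect of the Leibniz rule, from which positivity will be derived. -/
lemma gen_mul (P Q : NCPoly B) : gen γ σ (P * Q) =
    gen γ σ P * Q + P * gen γ σ Q + straddle σ (fdq Q) (fdq P) := by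
  induction P using induction_left with
  | h1 => simp
  | hC b P h =>
    rw [mul_assoc, gen_C_mul, h, gen_C_mul, fdq_C_mul, straddle_lmul, mul_add, mul_add, mul_assoc,
      mul_assoc]
  | hX P h =>
    rw [mul_assoc, gen_X_mul, h, gen_X_mul, fdq_X_mul, map_add, straddle_lmul, straddle_tmul,
      contr_comp_mulLeft, fdq_mul, map_add, contr_mul_right]
    simp only [mul_add, add_mul, mul_assoc, one_mul]
    abel
  | hadd P Q hP hQ => simp only [add_mul, map_add, hP, hQ]; abel

@[simp] lemma gen_mul_C (P : NCPoly B) (b : B) : gen γ σ (P * C b) = gen γ σ P * C b := by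
  have h : ∀ u, straddle σ 0 u = 0 := fun u => by
    induction u with
    | zero => simp
    | tmul p q => simp
    | add u v hu hv => rw [map_add, hu, hv, add_zero]
  rw [gen_mul, gen_C, fdq_C, h, mul_zero, add_zero, add_zero]

/-- Tensors whose right legs have degree at most `n`. -/
def degR (B : Type*) [CStarAlgebra B] (n : ℕ) : Submodule ℂ (NCPoly B ⊗[ℂ] NCPoly B) :=
  Submodule.span ℂ {u | ∃ p q : NCPoly B, q ∈ degLE B n ∧ u = p ⊗ₜ q}

lemma tmul_mem_degR {p q : NCPoly B} {n : ℕ} (h : q ∈ degLE B n) : p ⊗ₜ[ℂ] q ∈ degR B n :=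
  Submodule.subset_span ⟨p, q, h, rfl⟩

lemma degR_mono {m n : ℕ} (h : m ≤ n) : degR B m ≤ degR B n :=
  Submodule.span_mono fun _ ⟨p, q, hq, hu⟩ => ⟨p, q, degLE_mono h hq, hu⟩

lemma map_mem_of_tmul {V : Type*} [AddCommGroup V] [Module ℂ V] {n : ℕ}
    {f : NCPoly B ⊗[ℂ] NCPoly B →ₗ[ℂ] V} {S : Submodule ℂ V}
    (h : ∀ p q : NCPoly B, q ∈ degLE B n → f (p ⊗ₜ q) ∈ S)
    {u : NCPoly B ⊗[ℂ] NCPoly B} (hu : u ∈ degR B n) : f u ∈ S := by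
  have : degR B n ≤ S.comap f := Submodule.span_le.2 (by
    rintro _ ⟨p, q, hq, rfl⟩
    exact h p q hq)
  exact this hu

lemma map_eq_of_tmul {V : Type*} [AddCommGroup V] [Module ℂ V] {n : ℕ}
    {f g : NCPoly B ⊗[ℂ] NCPoly B →ₗ[ℂ] V}
    (h : ∀ p q : NCPoly B, q ∈ degLE B n → f (p ⊗ₜ q) = g (p ⊗ₜ q))
    {u : NCPoly B ⊗[ℂ] NCPoly B} (hu : u ∈ degR B n) : f u = g u := by
  have := map_mem_of_tmul (f := f - g) (S := ⊥) (fun p q hq => by simp [h p q hq]) hu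
  simpa [sub_eq_zero] using this

lemma lmul_mem_degR (P : NCPoly B) {n : ℕ} {u : NCPoly B ⊗[ℂ] NCPoly B} (hu : u ∈ degR B n) :
    (P ⊗ₜ 1) * u ∈ degR B n :=
  map_mem_of_tmul (f := LinearMap.mulLeft ℂ (P ⊗ₜ[ℂ] (1 : NCPoly B))) (fun p q hq => by
    rw [LinearMap.mulLeft_apply, Algebra.TensorProduct.tmul_mul_tmul, one_mul]
    exact tmul_mem_degR hq) hu

lemma contr_mem_degLE {n : ℕ} {u : NCPoly B ⊗[ℂ] NCPoly B} (hu : u ∈ degR B n) :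
    contr σ u ∈ degLE B n :=
  map_mem_of_tmul (fun _ _ hq => by rw [contr_tmul]; exact C_mul_mem_degLE _ hq) hu

/-- The letter marked by `fdq` is used up. This drop in degree drives the inductions that determine
operators from their recursion. -/
lemma fdq_mem_degR {n : ℕ} {P : NCPoly B} (hP : P ∈ degLE B (n + 1)) : fdq P ∈ degR B n := by
  refine map_mem_of_word (fun b l hl => ?_) hP
  clear hP
  induction l generalizing b n with
  | nil => rw [word_nil, fdq_C]; exact zero_mem _
  | cons c l ih =>
    rw [word_cons, fdq_C_mul, fdq_X_mul]
    have hl' : l.length ≤ n := by simpa using hl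
    refine lmul_mem_degR _ (add_mem (lmul_mem_degR _ ?_) (tmul_mem_degR (word_mem_degLE hl')))
    cases l with
    | nil => rw [word_nil, fdq_C]; exact zero_mem _
    | cons d l =>
      obtain ⟨m, rfl⟩ : ∃ m, n = m + 1 := ⟨n - 1, by simp at hl'; omega⟩
      exact degR_mono (Nat.le_succ m) (ih c (n := m) hl')

lemma exists_eq_C {P : NCPoly B} (hP : P ∈ degLE B 0) : ∃ b, P = C b := by
  have : LinearMap.id (R := ℂ) P ∈ LinearMap.range (C (B := B)).toLinearMap :=
    map_mem_of_word (fun b l hl => by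
      rw [List.length_eq_zero_iff.1 (Nat.le_zero.1 hl)]; exact ⟨b, rfl⟩) hP
  obtain ⟨b, hb⟩ := this
  exact ⟨b, hb.symm⟩

lemma gen_mem_degLE {n : ℕ} {P : NCPoly B} (hP : P ∈ degLE B (n + 1)) :
    gen γ σ P ∈ degLE B n := by
  refine map_mem_of_word (fun b l hl => ?_) hP
  clear hP
  induction l generalizing b n with
  | nil => rw [word_nil, gen_C]; exact zero_mem _
  | cons c l ih =>
    rw [word_cons, gen_C_mul, gen_X_mul]
    have hl' : l.length ≤ n := by simpa using hl
    refine C_mul_mem_degLE _ (add_mem ?_ (add_mem (C_mul_mem_degLE _ (word_mem_degLE hl'))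
      (contr_mem_degLE σ (fdq_mem_degR (word_mem_degLE (by omega))))))
    cases l with
    | nil => rw [word_nil, gen_C, mul_zero]; exact zero_mem _
    | cons d l =>
      obtain ⟨m, rfl⟩ : ∃ m, n = m + 1 := ⟨n - 1, by simp at hl'; omega⟩
      exact X_mul_mem_degLE (ih c (n := m) hl')

lemma locNil_gen : LocNil (gen γ σ) :=
  locNil_of_lowers (fun P hP => by obtain ⟨b, rfl⟩ := exists_eq_C hP; exact gen_C γ σ b)
    fun _ _ hP => gen_mem_degLE γ σ hP

end gen

/-- Two operators agree if they agree on constants and agreement in degrees `≤ n` implies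
agreement in degrees `≤ n + 1`. -/
lemma eq_of_degLE_succ {V : Type*} {f g : NCPoly B → V} (h0 : ∀ b, f (C b) = g (C b))
    (h : ∀ n, (∀ P ∈ degLE B n, f P = g P) → ∀ P ∈ degLE B (n + 1), f P = g P)
    (P : NCPoly B) : f P = g P := by
  obtain ⟨n, hn⟩ := exists_mem_degLE P
  have : ∀ n, ∀ P ∈ degLE B n, f P = g P := by
    intro n
    induction n with
    | zero => intro P hP; obtain ⟨b, rfl⟩ := exists_eq_C hP; exact h0 b
    | succ n ih => exact h n ih
  exact this n P hn

end NCPoly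

/-! ### Comorphisms and coderivations of the free difference quotient -/

section TensorLexp

variable {V : Type*} [AddCommGroup V] [Module ℂ V]

lemma locNil_rTensor (W : Type*) [AddCommGroup W] [Module ℂ W] {f : Module.End ℂ V}
    (hf : LocNil f) : LocNil (LinearMap.rTensor W f) := fun u => by
  induction u with
  | zero => exact ⟨0, map_zero _⟩
  | tmul p q =>
    obtain ⟨N, hN⟩ := hf p
    exact ⟨N, by rw [LinearMap.rTensor_pow, LinearMap.rTensor_tmul, hN, TensorProduct.zero_tmul]⟩
  | add u v hu hv =>
    obtain ⟨N, hN⟩ := hu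
    obtain ⟨M, hM⟩ := hv
    exact ⟨max N M, by
      rw [map_add, pow_apply_eq_zero_of_le hN (le_max_left _ _),
        pow_apply_eq_zero_of_le hM (le_max_right _ _), add_zero]⟩

lemma locNil_lTensor (W : Type*) [AddCommGroup W] [Module ℂ W] {f : Module.End ℂ V}
    (hf : LocNil f) : LocNil (LinearMap.lTensor W f) := fun u => by
  induction u with
  | zero => exact ⟨0, map_zero _⟩
  | tmul p q =>
    obtain ⟨N, hN⟩ := hf q
    exact ⟨N, by rw [LinearMap.lTensor_pow, LinearMap.lTensor_tmul, hN, TensorProduct.tmul_zero]⟩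
  | add u v hu hv =>
    obtain ⟨N, hN⟩ := hu
    obtain ⟨M, hM⟩ := hv
    exact ⟨max N M, by
      rw [map_add, pow_apply_eq_zero_of_le hN (le_max_left _ _),
        pow_apply_eq_zero_of_le hM (le_max_right _ _), add_zero]⟩

lemma commute_rTensor_lTensor (f : Module.End ℂ V) :
    Commute (LinearMap.rTensor V f) (LinearMap.lTensor V f : Module.End ℂ (V ⊗[ℂ] V)) :=
  TensorProduct.ext' fun _ _ => rfl

/-- The operator `f ⊗ 1 + 1 ⊗ f`. -/
def tensorSum (f : Module.End ℂ V) : Module.End ℂ (V ⊗[ℂ] V) :=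
  LinearMap.rTensor V f + LinearMap.lTensor V f

@[simp] lemma tensorSum_tmul (f : Module.End ℂ V) (p q : V) :
    tensorSum f (p ⊗ₜ q) = f p ⊗ₜ q + p ⊗ₜ f q := rfl

lemma locNil_tensorSum {f : Module.End ℂ V} (hf : LocNil f) : LocNil (tensorSum f) :=
  locNil_add (locNil_rTensor V hf) (locNil_lTensor V hf) (commute_rTensor_lTensor f)

lemma tensorSum_smul (z : ℂ) (f : Module.End ℂ V) : tensorSum (z • f) = z • tensorSum f := by
  rw [tensorSum, LinearMap.rTensor_smul, LinearMap.lTensor_smul, ← smul_add, tensorSum]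

/-- The commuting summands `f ⊗ 1` and `1 ⊗ f` exponentiate separately. This is what turns
coderivations into comorphisms. -/
lemma lexp_tensorSum {f : Module.End ℂ V} (hf : LocNil f) :
    lexp (tensorSum f) = TensorProduct.map (lexp f) (lexp f) := by
  rw [tensorSum, lexp_add (locNil_rTensor V hf) (locNil_lTensor V hf) (commute_rTensor_lTensor f)]
  refine TensorProduct.ext' fun p q => ?_
  have h1 : ∀ q, lexp (LinearMap.rTensor V f) (p ⊗ₜ q) = lexp f p ⊗ₜ q := fun q =>
    (map_lexp hf (locNil_rTensor V hf) (F := (TensorProduct.mk ℂ V V).flip q)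
      (fun _ => rfl) p).symm
  have h2 : lexp (LinearMap.lTensor V f) (p ⊗ₜ q) = p ⊗ₜ lexp f q :=
    (map_lexp hf (locNil_lTensor V hf) (F := TensorProduct.mk ℂ V V p) (fun _ => rfl) q).symm
  rw [Module.End.mul_apply, h2, h1, TensorProduct.map_tmul]

end TensorLexp

namespace NCPoly

variable {B : Type*} [CStarAlgebra B]

/-- The map `p ⊗ q ↦ f(p) X T(q)`. -/
def joinX (f : NCPoly B →ₗ[ℂ] B) (T : Module.End ℂ (NCPoly B)) :
    NCPoly B ⊗[ℂ] NCPoly B →ₗ[ℂ] NCPoly B :=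
  contr f ∘ₗ LinearMap.lTensor (NCPoly B) (LinearMap.mulLeft ℂ X ∘ₗ T)

@[simp] lemma joinX_tmul (f : NCPoly B →ₗ[ℂ] B) (T : Module.End ℂ (NCPoly B)) (p q : NCPoly B) :
    joinX f T (p ⊗ₜ q) = C (f p) * (X * T q) := rfl

/-- The constant term as a linear functional. -/
abbrev constL : NCPoly B →ₗ[ℂ] B := (constTerm (B := B)).toLinearMap

lemma joinX_lmul_C (T : Module.End ℂ (NCPoly B)) (b : B) (u : NCPoly B ⊗[ℂ] NCPoly B) :
    joinX constL T ((C b ⊗ₜ 1) * u) = C b * joinX constL T u := by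
  induction u with
  | zero => simp
  | tmul p q => simp [mul_assoc]
  | add u v hu hv => rw [mul_add, map_add, hu, hv, map_add, mul_add]

lemma joinX_lmul_X (T : Module.End ℂ (NCPoly B)) (u : NCPoly B ⊗[ℂ] NCPoly B) :
    joinX constL T ((X ⊗ₜ 1) * u) = 0 := by
  induction u with
  | zero => simp
  | tmul p q => simp
  | add u v hu hv => rw [mul_add, map_add, hu, hv, add_zero]

/-- Applying the constant term to the left leg of `fdq P` leaves only the terms in which the first
letter `X` is marked. A polynomial is thus recovered from its constant term and its difference
quotient. -/
lemma eq_constTerm_add (P : NCPoly B) : P = C (constTerm P) + joinX constL 1 (fdq P) := by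
  induction P using induction_left with
  | h1 => simp
  | hC b P h => rw [fdq_C_mul, joinX_lmul_C, map_mul, constTerm_C, map_mul, ← mul_add, ← h]
  | hX P h => simp [joinX_lmul_X]
  | hadd P Q hP hQ => nth_rw 1 [hP, hQ]; simp only [map_add]; abel

/-- Both sides mark two letters `X` of a word; only the order of marking differs. -/
lemma fdq_coassoc (P : NCPoly B) :
    LinearMap.rTensor (NCPoly B) fdq (fdq P) =
      (TensorProduct.assoc ℂ (NCPoly B) (NCPoly B) (NCPoly B)).symm
        (LinearMap.lTensor (NCPoly B) fdq (fdq P)) := by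
  induction P using induction_left with
  | h1 => simp
  | hC b P h =>
    rw [fdq_C_mul]
    have h1 : ∀ u : NCPoly B ⊗[ℂ] NCPoly B,
        LinearMap.rTensor (NCPoly B) fdq ((C b ⊗ₜ 1) * u) =
          ((C b ⊗ₜ 1) ⊗ₜ 1) * LinearMap.rTensor (NCPoly B) fdq u := fun u => by
      induction u with
      | zero => simp
      | tmul p q => simp
      | add u v hu hv => rw [mul_add, map_add, hu, hv, map_add, mul_add]
    have h2 : ∀ v : NCPoly B ⊗[ℂ] (NCPoly B ⊗[ℂ] NCPoly B),
        (TensorProduct.assoc ℂ (NCPoly B) (NCPoly B) (NCPoly B)).symm ((C b ⊗ₜ 1) * v) =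
          ((C b ⊗ₜ 1) ⊗ₜ 1) * (TensorProduct.assoc ℂ _ _ _).symm v := fun v => by
      induction v with
      | zero => simp
      | tmul p w =>
        induction w with
        | zero => simp
        | tmul q r => simp
        | add u v hu hv =>
          rw [TensorProduct.tmul_add, mul_add, map_add, hu, hv, map_add, mul_add]
      | add u v hu hv => rw [mul_add, map_add, hu, hv, map_add, mul_add]
    have h3 : ∀ u : NCPoly B ⊗[ℂ] NCPoly B,
        LinearMap.lTensor (NCPoly B) fdq ((C b ⊗ₜ 1) * u) =
          (C b ⊗ₜ 1) * LinearMap.lTensor (NCPoly B) fdq u := fun u => by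
      induction u with
      | zero => simp
      | tmul p q => simp
      | add u v hu hv => rw [mul_add, map_add, hu, hv, map_add, mul_add]
    rw [h1, h3, h2, h]
  | hX P h =>
    rw [fdq_X_mul]
    have h1 : ∀ u : NCPoly B ⊗[ℂ] NCPoly B,
        LinearMap.rTensor (NCPoly B) fdq ((X ⊗ₜ 1) * u) =
          ((X ⊗ₜ 1) ⊗ₜ 1) * LinearMap.rTensor (NCPoly B) fdq u +
            (TensorProduct.assoc ℂ _ _ _).symm (1 ⊗ₜ u) := fun u => by
      induction u with
      | zero => simp
      | tmul p q => simp [TensorProduct.add_tmul]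
      | add u v hu hv =>
        rw [mul_add, map_add, hu, hv, map_add, mul_add, TensorProduct.tmul_add, map_add]
        abel
    have h2 : ∀ v : NCPoly B ⊗[ℂ] (NCPoly B ⊗[ℂ] NCPoly B),
        (TensorProduct.assoc ℂ (NCPoly B) (NCPoly B) (NCPoly B)).symm ((X ⊗ₜ 1) * v) =
          ((X ⊗ₜ 1) ⊗ₜ 1) * (TensorProduct.assoc ℂ _ _ _).symm v := fun v => by
      induction v with
      | zero => simp
      | tmul p w =>
        induction w with
        | zero => simp
        | tmul q r => simp
        | add u v hu hv =>
          rw [TensorProduct.tmul_add, mul_add, map_add, hu, hv, map_add, mul_add]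
      | add u v hu hv => rw [mul_add, map_add, hu, hv, map_add, mul_add]
    have h3 : ∀ u : NCPoly B ⊗[ℂ] NCPoly B,
        LinearMap.lTensor (NCPoly B) fdq ((X ⊗ₜ 1) * u) =
          (X ⊗ₜ 1) * LinearMap.lTensor (NCPoly B) fdq u := fun u => by
      induction u with
      | zero => simp
      | tmul p q => simp
      | add u v hu hv => rw [mul_add, map_add, hu, hv, map_add, mul_add]
    rw [map_add, map_add, h1, h3, map_add, h2, h]
    simp
  | hadd P Q hP hQ => rw [map_add, map_add, hP, hQ, map_add, map_add]

/-- Operators with `∂ T = (T ⊗ T) ∂`. -/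
def IsComorphism (T : Module.End ℂ (NCPoly B)) : Prop :=
  ∀ P, fdq (T P) = TensorProduct.map T T (fdq P)

/-- Operators with `∂ D = (D ⊗ 1 + 1 ⊗ D) ∂`. -/
def IsCoderivation (D : Module.End ℂ (NCPoly B)) : Prop :=
  ∀ P, fdq (D P) = tensorSum D (fdq P)

lemma isComorphism_one : IsComorphism (1 : Module.End ℂ (NCPoly B)) := fun P => by
  have : TensorProduct.map (1 : Module.End ℂ (NCPoly B)) (1 : Module.End ℂ (NCPoly B)) =
      LinearMap.id := TensorProduct.ext' fun _ _ => rfl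
  rw [this]
  rfl

lemma IsComorphism.mul {S T : Module.End ℂ (NCPoly B)} (hS : IsComorphism S)
    (hT : IsComorphism T) : IsComorphism (S * T) := fun P => by
  rw [Module.End.mul_apply, hS, hT, ← LinearMap.comp_apply, ← TensorProduct.map_comp]
  rfl

/-- A recursion over the first kept letter: the left leg of `fdq P` enters only through `constTerm ∘
T`, and `T` itself acts on right legs of smaller degree. -/
lemma IsComorphism.apply_eq {T : Module.End ℂ (NCPoly B)} (hT : IsComorphism T) (P : NCPoly B) :
    T P = C (constTerm (T P)) + joinX (constL ∘ₗ T) T (fdq P) := by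
  have h : joinX constL 1 ∘ₗ TensorProduct.map T T = joinX (constL ∘ₗ T) T :=
    TensorProduct.ext' fun _ _ => rfl
  nth_rw 1 [eq_constTerm_add (T P)]
  rw [hT, ← h]
  rfl

lemma eq_of_apply_eq {S T : Module.End ℂ (NCPoly B)} {f : NCPoly B →ₗ[ℂ] B}
    (hS : ∀ P, S P = C (f P) + joinX f S (fdq P)) (hT : ∀ P, T P = C (f P) + joinX f T (fdq P)) :
    S = T := by
  refine LinearMap.ext (eq_of_degLE_succ (fun b => ?_) fun n hn P hP => ?_)
  · rw [hS, hT]; simp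
  · rw [hS, hT]
    congr 1
    refine map_eq_of_tmul (fun p q hq => ?_) (fdq_mem_degR hP)
    rw [joinX_tmul, joinX_tmul, hn q hq]

lemma IsComorphism.eq {S T : Module.End ℂ (NCPoly B)} (hS : IsComorphism S)
    (hT : IsComorphism T) (h : ∀ P, constTerm (S P) = constTerm (T P)) : S = T := by
  have h' : constL ∘ₗ T = constL ∘ₗ S := LinearMap.ext fun P => (h P).symm
  exact eq_of_apply_eq (f := constL ∘ₗ S) hS.apply_eq (h' ▸ hT.apply_eq)

/-- As for comorphisms: in the expansion around the first letter, `D` acts on the left leg only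
through its constant term and on the right leg in smaller degree. -/
lemma IsCoderivation.eq {S T : Module.End ℂ (NCPoly B)} (hS : IsCoderivation S)
    (hT : IsCoderivation T) (h : ∀ P, constTerm (S P) = constTerm (T P)) : S = T := by
  refine LinearMap.ext (eq_of_degLE_succ (fun b => ?_) fun n hn P hP => ?_)
  · rw [eq_constTerm_add (S _), eq_constTerm_add (T _), hS, hT, h, fdq_C, map_zero, map_zero,
      map_zero, map_zero]
  · rw [eq_constTerm_add (S _), eq_constTerm_add (T _), hS, hT, h]
    congr 1
    have : ∀ u ∈ degR B n, (joinX constL 1 ∘ₗ tensorSum S) u = (joinX constL 1 ∘ₗ tensorSum T) u :=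
      fun u hu => map_eq_of_tmul (fun p q hq => by simp [h p, hn q hq]) hu
    exact this _ (fdq_mem_degR hP)

lemma IsCoderivation.lexp {D : Module.End ℂ (NCPoly B)} (hD : IsCoderivation D) (h : LocNil D) :
    IsComorphism (lexp D) := fun P => by
  rw [map_lexp h (locNil_tensorSum h) hD, lexp_tensorSum h]

lemma IsCoderivation.smul {D : Module.End ℂ (NCPoly B)} (hD : IsCoderivation D) (z : ℂ) :
    IsCoderivation (z • D) := fun P => by
  rw [LinearMap.smul_apply, map_smul, hD, tensorSum_smul, LinearMap.smul_apply]

/-- All powers of the exponential are comorphisms, so the identity holds for `exp(n D)` with `n`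
natural. Its part of first order in `n` is the coderivation identity. -/
lemma isCoderivation_of_lexp {D : Module.End ℂ (NCPoly B)} (h : LocNil D)
    (hD : IsComorphism (lexp D)) : IsCoderivation D := by
  have hn : ∀ n : ℕ, IsComorphism (_root_.lexp ((n : ℂ) • D)) := fun n => by
    rw [lexp_nat_smul h]
    induction n with
    | zero => exact isComorphism_one
    | succ n ih => rw [pow_succ]; exact ih.mul hD
  intro P
  refine first_order_eq h (locNil_tensorSum h) fdq LinearMap.id fun n => ?_
  rw [hn n P, ← tensorSum_smul, lexp_tensorSum (h.smul _)]
  rfl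

/-- The induction on left multiplication by `X` produces two terms with a removed factor to the left
of the marked letter: one marks after removing, the other removes after marking. Coassociativity of
`fdq` identifies them. -/
lemma isCoderivation_gen (γ : B) (σ : NCPoly B →ₗ[ℂ] B) : IsCoderivation (gen γ σ) := fun P => by
  induction P using induction_left with
  | h1 => simp
  | hC b P h =>
    rw [gen_C_mul, fdq_C_mul, h, fdq_C_mul]
    generalize fdq P = u
    induction u with
    | zero => simp
    | tmul p q => simp [mul_add]
    | add u v hu hv => simp only [mul_add, map_add, hu, hv]
  | hX P h =>
    have h1 : ∀ u : NCPoly B ⊗[ℂ] NCPoly B, tensorSum (gen γ σ) ((X ⊗ₜ 1) * u) =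
        (X ⊗ₜ 1) * tensorSum (gen γ σ) u + ((C γ ⊗ₜ 1) * u +
          LinearMap.rTensor (NCPoly B) (contr σ) (LinearMap.rTensor (NCPoly B) fdq u)) :=
      fun u => by
        induction u with
        | zero => simp
        | tmul p q => simp [mul_add, TensorProduct.add_tmul]; abel
        | add u v hu hv => simp only [mul_add, map_add, hu, hv]; abel
    have h2 : ∀ u : NCPoly B ⊗[ℂ] NCPoly B, fdq (contr σ u) =
        LinearMap.rTensor (NCPoly B) (contr σ) ((TensorProduct.assoc ℂ _ _ _).symm
          (LinearMap.lTensor (NCPoly B) fdq u)) := fun u => by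
      induction u with
      | zero => simp
      | tmul p q =>
        rw [contr_tmul, fdq_C_mul, LinearMap.lTensor_tmul]
        generalize fdq q = w
        induction w with
        | zero => simp
        | tmul r s => simp
        | add u v hu hv => simp only [mul_add, TensorProduct.tmul_add, map_add, hu, hv]
      | add u v hu hv => simp only [map_add, hu, hv]
    rw [gen_X_mul, map_add, fdq_X_mul, map_add, fdq_C_mul, fdq_X_mul, map_add, h1, h, h2,
      fdq_coassoc, tensorSum_tmul, gen_one, TensorProduct.zero_tmul]
    abel
  | hadd P Q hP hQ => simp only [map_add, hP, hQ]

lemma constTerm_contr (σ : NCPoly B →ₗ[ℂ] B) (u : NCPoly B ⊗[ℂ] NCPoly B) (Q : NCPoly B)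
    (hQ : constTerm Q = 0) : constTerm (contr σ (u * (1 ⊗ₜ Q))) = 0 := by
  rw [contr_mul_right, map_mul, hQ, mul_zero]

lemma constTerm_gen_X (γ : B) (σ : NCPoly B →ₗ[ℂ] B) : constTerm (gen γ σ X) = γ := by
  have := gen_X_mul γ σ 1
  rw [mul_one] at this
  simp [this]

/-- Every term except the one removing the whole word keeps a letter `X` at one of the ends. -/
lemma constTerm_gen_X_mul_X (γ : B) (σ : NCPoly B →ₗ[ℂ] B) (P : NCPoly B) :
    constTerm (gen γ σ (X * P * X)) = σ P := by
  rw [mul_assoc, gen_X_mul, fdq_mul, map_add, map_add, map_add, map_add,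
    constTerm_contr _ _ _ constTerm_X]
  simp

/-! ### The operator of monotone convolution by `ν` -/

/-- The representation of `B⟨X⟩` on `B⟨X⟩ ⊗ B⟨X⟩` which, reading a word from the right, keeps some
of the letters `X` and evaluates `f` on the gaps. -/
def splitRep (f : NCPoly B →ₗ[ℂ] B) : NCPoly B →ₐ[ℂ] Module.End ℂ (NCPoly B ⊗[ℂ] NCPoly B) :=
  let L : NCPoly B →ₐ[ℂ] Module.End ℂ (NCPoly B ⊗[ℂ] NCPoly B) :=
    (Algebra.lmul ℂ (NCPoly B ⊗[ℂ] NCPoly B)).comp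
      (Algebra.TensorProduct.includeLeft (R := ℂ) (S := ℂ) (A := NCPoly B) (B := NCPoly B))
  lift (L.comp C) (L X + TensorProduct.mk ℂ (NCPoly B) (NCPoly B) 1 ∘ₗ
    LinearMap.mulLeft ℂ X ∘ₗ contr f)

/-- The pairs (first gap, rest) obtained by keeping some of the letters `X` and evaluating `f` on
the gaps other than the first. -/
def split (f : NCPoly B →ₗ[ℂ] B) : NCPoly B →ₗ[ℂ] NCPoly B ⊗[ℂ] NCPoly B :=
  LinearMap.applyₗ ((1 : NCPoly B) ⊗ₜ[ℂ] (1 : NCPoly B)) ∘ₗ (splitRep f).toLinearMap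

/-- The operator `T_f` that keeps some of the letters `X`, in all possible ways, and evaluates `f`
on the gaps. -/
def convOp (f : NCPoly B →ₗ[ℂ] B) : Module.End ℂ (NCPoly B) := contr f ∘ₗ split f

variable (f : NCPoly B →ₗ[ℂ] B)

@[simp] lemma split_one : split f 1 = 1 ⊗ₜ 1 := by simp [split]

@[simp] lemma split_C_mul (b : B) (P : NCPoly B) :
    split f (C b * P) = (C b ⊗ₜ 1) * split f P := by
  have : splitRep f (C b) = LinearMap.mulLeft ℂ (C b ⊗ₜ 1) := by rw [splitRep, lift_C]; rfl
  simp [split, this]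

@[simp] lemma split_X_mul (P : NCPoly B) :
    split f (X * P) = (X ⊗ₜ 1) * split f P + 1 ⊗ₜ (X * convOp f P) := by
  have : splitRep f X = LinearMap.mulLeft ℂ (X ⊗ₜ 1) +
    TensorProduct.mk ℂ (NCPoly B) (NCPoly B) 1 ∘ₗ LinearMap.mulLeft ℂ X ∘ₗ contr f := by
      rw [splitRep, lift_X]; rfl
  simp [split, this, convOp]

/-- Either no letter is kept and the first gap is all of `P`, or `fdq` marks the first kept letter
and the operator continues on its right. -/
lemma split_eq (P : NCPoly B) : split f P =
    P ⊗ₜ 1 + LinearMap.lTensor (NCPoly B) (LinearMap.mulLeft ℂ X ∘ₗ convOp f) (fdq P) := by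
  have h : ∀ (Q : NCPoly B) (u : NCPoly B ⊗[ℂ] NCPoly B),
      LinearMap.lTensor (NCPoly B) (LinearMap.mulLeft ℂ X ∘ₗ convOp f) ((Q ⊗ₜ 1) * u) =
      (Q ⊗ₜ 1) * LinearMap.lTensor (NCPoly B) (LinearMap.mulLeft ℂ X ∘ₗ convOp f) u :=
    fun Q u => by
      induction u with
      | zero => simp
      | tmul p q => simp
      | add u v hu hv => simp only [mul_add, map_add, hu, hv]
  induction P using induction_left with
  | h1 => simp
  | hC b P ih => rw [split_C_mul, ih, fdq_C_mul, h, mul_add]; simp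
  | hX P ih => rw [split_X_mul, ih, fdq_X_mul, map_add, h, mul_add]; simp [add_assoc]
  | hadd P Q hP hQ => simp only [map_add, hP, hQ, TensorProduct.add_tmul]; abel

lemma convOp_eq (P : NCPoly B) : convOp f P = C (f P) + joinX f (convOp f) (fdq P) := by
  rw [convOp, LinearMap.comp_apply, split_eq, map_add, contr_tmul, mul_one]
  rfl

lemma constTerm_joinX (T : Module.End ℂ (NCPoly B)) (u : NCPoly B ⊗[ℂ] NCPoly B) :
    constTerm (joinX f T u) = 0 := by
  induction u with
  | zero => simp
  | tmul p q => simp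
  | add u v hu hv => rw [map_add, map_add, hu, hv, add_zero]

@[simp] lemma constTerm_convOp (P : NCPoly B) : constTerm (convOp f P) = f P := by
  rw [convOp_eq, map_add, constTerm_C, constTerm_joinX, add_zero]

lemma isComorphism_convOp : IsComorphism (convOp f) := by
  have hfun : ∀ n, (∀ P ∈ degLE B n, fdq (convOp f P) =
      TensorProduct.map (convOp f) (convOp f) (fdq P)) → ∀ P ∈ degLE B (n + 1),
      fdq (convOp f P) = TensorProduct.map (convOp f) (convOp f) (fdq P) := by
    intro n hn P hP
    -- The two summands correspond to marking the first kept letter or a later one. After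
    -- coassociativity they recombine, by `convOp_eq` on the left leg, to `T ⊗ T`.
    have h1 : ∀ u ∈ degR B n, fdq (joinX f (convOp f) u) =
        TensorProduct.map ((C (B := B)).toLinearMap ∘ₗ f) (convOp f) u +
        TensorProduct.map (joinX f (convOp f)) (convOp f) ((TensorProduct.assoc ℂ _ _ _).symm
          (LinearMap.lTensor (NCPoly B) fdq u)) := by
      intro u hu
      refine map_eq_of_tmul (f := fdq ∘ₗ joinX f (convOp f))
        (g := TensorProduct.map ((C (B := B)).toLinearMap ∘ₗ f) (convOp f) +
        TensorProduct.map (joinX f (convOp f)) (convOp f) ∘ₗ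
          (TensorProduct.assoc ℂ _ _ _).symm.toLinearMap ∘ₗ
          LinearMap.lTensor (NCPoly B) fdq) (fun p q hq => ?_) hu
      simp only [LinearMap.comp_apply, LinearMap.add_apply, joinX_tmul, fdq_C_mul, fdq_X_mul,
        hn q hq, LinearMap.lTensor_tmul, TensorProduct.map_tmul, mul_add, LinearEquiv.coe_coe]
      rw [add_comm]
      congr 1
      · simp
      · generalize fdq q = w
        induction w with
        | zero => simp
        | tmul r s => simp
        | add u v hu hv => simp only [mul_add, TensorProduct.tmul_add, map_add, hu, hv]
    rw [convOp_eq, map_add, fdq_C, zero_add, h1 _ (fdq_mem_degR hP), ← fdq_coassoc]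
    have h2 : ∀ u, TensorProduct.map ((C (B := B)).toLinearMap ∘ₗ f) (convOp f) u +
        TensorProduct.map (joinX f (convOp f)) (convOp f)
          (LinearMap.rTensor (NCPoly B) fdq u) = TensorProduct.map (convOp f) (convOp f) u := by
      intro u
      induction u with
      | zero => simp
      | tmul p q =>
        rw [TensorProduct.map_tmul, LinearMap.rTensor_tmul, TensorProduct.map_tmul,
          TensorProduct.map_tmul, ← TensorProduct.add_tmul, convOp_eq f p]
        rfl
      | add u v hu hv => simp only [map_add, ← hu, ← hv]; abel
    exact h2 _
  exact eq_of_degLE_succ (fun b => by rw [convOp_eq, fdq_C]; simp) hfun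

lemma IsComorphism.eq_convOp {T : Module.End ℂ (NCPoly B)} (hT : IsComorphism T)
    (h : ∀ P, constTerm (T P) = f P) : T = convOp f :=
  hT.eq (isComorphism_convOp f) fun P => by rw [h, constTerm_convOp]

lemma convOp_constL : convOp (constL (B := B)) = 1 :=
  (isComorphism_one.eq_convOp _ fun _ => rfl).symm

/-- Both sides are comorphisms with the same constant term. In terms of operators this is the
associativity of monotone convolution. -/
lemma convOp_comp (g : NCPoly B →ₗ[ℂ] B) :
    convOp (g ∘ₗ convOp f) = convOp g * convOp f :=
  (((isComorphism_convOp g).mul (isComorphism_convOp f)).eq_convOp _ fun P => by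
    rw [Module.End.mul_apply, constTerm_convOp]; rfl).symm

lemma split_mem_degR (b : B) (l : List B) : split f (word b l) ∈ degR B l.length := by
  induction l generalizing b with
  | nil =>
    have := split_C_mul f b 1
    rw [mul_one, split_one] at this
    rw [word_nil, this]
    exact lmul_mem_degR _ (tmul_mem_degR (by simpa using C_mem_degLE (1 : B) 0))
  | cons c l ih =>
    rw [word_cons, split_C_mul, split_X_mul]
    exact lmul_mem_degR _ (add_mem (lmul_mem_degR _ (degR_mono (Nat.le_succ _) (ih c)))
      (tmul_mem_degR (X_mul_mem_degLE (contr_mem_degLE f (ih c)))))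

lemma convOp_word_cons {f : NCPoly B →ₗ[ℂ] B} (hf : ∀ b, f (C b) = b) (b c : B) (l : List B) :
    convOp f (word b (c :: l)) = C b * (X * convOp f (word c l)) +
      contr f (((C b * X) ⊗ₜ 1) * split f (word c l)) := by
  rw [word_cons, convOp, LinearMap.comp_apply, split_C_mul, split_X_mul, mul_add, ← mul_assoc,
    map_add, Algebra.TensorProduct.tmul_mul_tmul, Algebra.TensorProduct.tmul_mul_tmul, contr_tmul,
    mul_one, mul_one, hf, one_mul, add_comm]
  rfl

lemma convOp_C {f : NCPoly B →ₗ[ℂ] B} (hf : ∀ b, f (C b) = b) (b : B) :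
    convOp f (C b) = C b := by
  rw [convOp_eq, hf, fdq_C, map_zero, add_zero]

/-- If `f` fixes the constants, keeping all letters reproduces the word; every other choice loses at
least one letter. -/
lemma convOp_sub_one_word {f : NCPoly B →ₗ[ℂ] B} (hf : ∀ b, f (C b) = b) (b : B) (l : List B)
    {n : ℕ} (hl : l.length ≤ n + 1) : (convOp f - 1) (word b l) ∈ degLE B n := by
  induction l generalizing b n with
  | nil => rw [word_nil, LinearMap.sub_apply, convOp_C hf]; simp
  | cons c l ih =>
    have hl' : l.length ≤ n := by simpa using hl
    have : (convOp f - 1) (word b (c :: l)) = C b * (X * (convOp f - 1) (word c l)) +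
        contr f (((C b * X) ⊗ₜ 1) * split f (word c l)) := by
      rw [LinearMap.sub_apply, convOp_word_cons hf, LinearMap.sub_apply, Module.End.one_apply,
        Module.End.one_apply, word_cons, mul_sub, mul_sub]
      abel
    rw [this]
    refine add_mem (C_mul_mem_degLE _ ?_) (contr_mem_degLE f (lmul_mem_degR _
      (degR_mono hl' (split_mem_degR f c l))))
    cases l with
    | nil => rw [word_nil, LinearMap.sub_apply, convOp_C hf]; simp
    | cons d l =>
      obtain ⟨m, rfl⟩ : ∃ m, n = m + 1 := ⟨n - 1, by simp at hl'; omega⟩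
      exact X_mul_mem_degLE (ih c hl')

lemma locNil_convOp_sub_one {f : NCPoly B →ₗ[ℂ] B} (hf : ∀ b, f (C b) = b) :
    LocNil (convOp f - 1) :=
  locNil_of_lowers (fun P hP => by
      obtain ⟨b, rfl⟩ := exists_eq_C hP
      rw [LinearMap.sub_apply, convOp_C hf]; simp)
    fun _ _ hP => map_mem_of_word (fun b l hl => convOp_sub_one_word hf b l hl) hP

end NCPoly

/-! ### Monotone convolution in terms of operators -/

section Convolution

variable {B : Type*} [CStarAlgebra B] {d : ℕ}

/-- The constant matrices. -/
def matC (b : Matrix (Fin d) (Fin d) B) : Matrix (Fin d) (Fin d) (NCPoly B) := b.map C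

/-- The matrix `b (X b) ^ n`. -/
def matWord (b : Matrix (Fin d) (Fin d) B) : ℕ → Matrix (Fin d) (Fin d) (NCPoly B)
  | 0 => matC b
  | n + 1 => matC b * Matrix.diagonal (fun _ => X) * matWord b n

lemma matWord_eq (b : Matrix (Fin d) (Fin d) B) (n : ℕ) :
    matWord b n = matC b * (Matrix.diagonal (fun _ => X) * matC b) ^ n := by
  induction n with
  | zero => simp [matWord]
  | succ n ih => rw [matWord, ih, pow_succ']; simp only [mul_assoc]

lemma matWord_succ_apply (b : Matrix (Fin d) (Fin d) B) (n : ℕ) (i j : Fin d) :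
    matWord b (n + 1) i j = ∑ a, C (b i a) * (X * matWord b n a j) := by
  rw [matWord, mul_assoc, Matrix.mul_apply]
  simp only [Matrix.diagonal_mul, matC, Matrix.map_apply]

/-- For `h = z b` the term `h (X h) ^ k` is homogeneous of degree `k + 1` in `z`, so a single `k`
contributes. -/
lemma momentSeries_monomial (f : NCPoly B →ₗ[ℂ] B) (b : Matrix (Fin d) (Fin d) B) (n : ℕ) :
    PowerSeries.coeff (n + 1) (momentSeries f (PowerSeries.monomial 1 b)) =
      (matWord b n).map f := by
  have h : ∀ k, PowerSeries.coeff (n + 1)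
      (PowerSeries.map ((C (B := B)).toRingHom.mapMatrix) (PowerSeries.monomial 1 b) *
        (PowerSeries.C (Matrix.diagonal fun _ => X) *
        PowerSeries.map ((C (B := B)).toRingHom.mapMatrix) (PowerSeries.monomial 1 b)) ^ k) =
      if k = n then matWord b n else 0 := by
    intro k
    have h1 : PowerSeries.map ((C (B := B)).toRingHom.mapMatrix) (PowerSeries.monomial 1 b) =
        PowerSeries.monomial 1 (matC b) := by
      ext1 m
      rw [PowerSeries.coeff_map, PowerSeries.coeff_monomial, PowerSeries.coeff_monomial]
      split_ifs
      · rfl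
      · exact map_zero _
    have h2 : ∀ k, (PowerSeries.C (Matrix.diagonal fun _ => X) *
        PowerSeries.monomial 1 (matC b)) ^ k =
        PowerSeries.monomial k ((Matrix.diagonal (fun _ => X) * matC b) ^ k) := by
      intro k
      induction k with
      | zero => rw [pow_zero, pow_zero, PowerSeries.monomial_zero_eq_C_apply, map_one]
      | succ k ih =>
        rw [pow_succ, ih, ← PowerSeries.monomial_zero_eq_C_apply, PowerSeries.monomial_mul_monomial,
          PowerSeries.monomial_mul_monomial, zero_add, ← pow_succ]
    rw [h1, h2, PowerSeries.monomial_mul_monomial, PowerSeries.coeff_monomial, matWord_eq]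
    by_cases hk : k = n
    · subst hk; simp [add_comm]
    · rw [if_neg hk, if_neg (by omega)]
  rw [momentSeries, PowerSeries.coeff_mk]
  simp only [h]
  rw [Finset.sum_eq_single n]
  · simp
  · intro k _ hk
    rw [if_neg hk]
    exact Matrix.map_zero _ (map_zero f)
  · simp

lemma momentSeries_coeff_zero (f : NCPoly B →ₗ[ℂ] B)
    (h : PowerSeries (Matrix (Fin d) (Fin d) B)) :
    PowerSeries.coeff 0 (momentSeries f h) = 0 := by
  simp [momentSeries]

/-- The first gap has `p.1` letters. The number `p.2` counts the first kept letter together with all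
letters after it, whence the exclusion of `p.2 = 0` and the shift `p.2 - 1`. -/
lemma split_matWord (f : NCPoly B →ₗ[ℂ] B) (b : Matrix (Fin d) (Fin d) B) (n : ℕ) (i j : Fin d) :
    split f (matWord b n i j) = matWord b n i j ⊗ₜ 1 +
      ∑ p ∈ Finset.HasAntidiagonal.antidiagonal n, if p.2 = 0 then 0 else
        ∑ k, matWord b p.1 i k ⊗ₜ (X * convOp f (matWord b (p.2 - 1) k j)) := by
  induction n generalizing i with
  | zero =>
    have := split_C_mul f (b i j) 1
    rw [mul_one] at this
    simp [matWord, matC, this]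
  | succ n ih =>
    rw [matWord_succ_apply, map_sum]
    simp only [split_C_mul, split_X_mul, ih]
    rw [Finset.Nat.sum_antidiagonal_succ]
    simp only [mul_add, Finset.mul_sum, mul_ite, mul_zero, Finset.sum_add_distrib,
      Algebra.TensorProduct.tmul_mul_tmul, one_mul, mul_one, TensorProduct.sum_tmul,
      matWord_succ_apply]
    rw [Finset.sum_comm]
    rw [add_assoc]
    congr 1
    rw [add_comm]
    congr 1
    refine Finset.sum_congr rfl fun p _ => ?_
    split_ifs
    · simp
    · rw [Finset.sum_comm]

/-- The matrices `T_f (b (X b) ^ (n - 1))`, for `n ≥ 1`, and `0` for `n = 0`. -/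
def convMat (f : NCPoly B →ₗ[ℂ] B) (b : Matrix (Fin d) (Fin d) B) :
    ℕ → Matrix (Fin d) (Fin d) (NCPoly B)
  | 0 => 0
  | n + 1 => (matWord b n).map (convOp f)

/-- The matrices `f (b (X b) ^ (n - 1))`, for `n ≥ 1`, and `0` for `n = 0`. -/
def momMat (f : NCPoly B →ₗ[ℂ] B) (b : Matrix (Fin d) (Fin d) B) : ℕ → Matrix (Fin d) (Fin d) B
  | 0 => 0
  | n + 1 => (matWord b n).map f

lemma coeff_momentSeries (f : NCPoly B →ₗ[ℂ] B) (b : Matrix (Fin d) (Fin d) B) (n : ℕ) :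
    PowerSeries.coeff n (momentSeries f (PowerSeries.monomial 1 b)) = momMat f b n := by
  cases n with
  | zero => rw [momentSeries_coeff_zero]; rfl
  | succ n => rw [momentSeries_monomial]; rfl

lemma convMat_eq (f : NCPoly B →ₗ[ℂ] B) (b : Matrix (Fin d) (Fin d) B) (n : ℕ) :
    convMat f b n = matC (momMat f b n) + ∑ p ∈ Finset.HasAntidiagonal.antidiagonal n,
      matC (momMat f b p.1) * (Matrix.diagonal (fun _ => X) * convMat f b p.2) := by
  have h0 : matC (0 : Matrix (Fin d) (Fin d) B) = 0 := Matrix.map_zero _ (map_zero _)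
  cases n with
  | zero => simp [convMat, momMat, h0]
  | succ n =>
    rw [Finset.Nat.sum_antidiagonal_succ]
    simp only [momMat, h0, zero_mul, zero_add]
    ext i j
    simp only [convMat, Matrix.add_apply, Matrix.map_apply, Matrix.sum_apply]
    rw [convOp, LinearMap.comp_apply, split_matWord, map_add, contr_tmul, mul_one, map_sum]
    congr 1
    refine Finset.sum_congr rfl fun p _ => ?_
    split_ifs with h
    · rw [h]; simp
    · obtain ⟨m, hm⟩ := Nat.exists_eq_succ_of_ne_zero h
      rw [hm, map_sum, Matrix.mul_apply]
      refine Finset.sum_congr rfl fun k _ => ?_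
      rw [contr_tmul, Matrix.diagonal_mul]
      rfl

lemma sum_mul_pow_succ {R : Type*} [Semiring R] (h x : R) (n : ℕ) :
    ∑ k ∈ Finset.range (n + 1), h * (x * h) ^ k =
      h + h * (x * ∑ k ∈ Finset.range n, h * (x * h) ^ k) := by
  rw [Finset.sum_range_succ', add_comm, pow_zero, mul_one, Finset.mul_sum, Finset.mul_sum]
  congr 1
  exact Finset.sum_congr rfl fun k _ => by rw [pow_succ', mul_assoc x]

/-- With `h` the inner moment series, both `∑ h (X h) ^ k` and the series of the matrices `convMat`
solve `G = h + h X G`. As `h` has no constant coefficient, this equation determines the coefficients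
one after the other. -/
lemma momentSeries_comp (f g : NCPoly B →ₗ[ℂ] B) (b : Matrix (Fin d) (Fin d) B) :
    momentSeries f (momentSeries g (PowerSeries.monomial 1 b)) =
      momentSeries (f ∘ₗ convOp g) (PowerSeries.monomial 1 b) := by
  set h' : PowerSeries (Matrix (Fin d) (Fin d) (NCPoly B)) :=
    PowerSeries.map ((C (B := B)).toRingHom.mapMatrix)
      (momentSeries g (PowerSeries.monomial 1 b)) with hh'
  set X' : PowerSeries (Matrix (Fin d) (Fin d) (NCPoly B)) :=
    PowerSeries.C (Matrix.diagonal fun _ => X) with hX'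
  have hcoeff : ∀ n, PowerSeries.coeff n h' = matC (momMat g b n) := fun n => by
    rw [hh', PowerSeries.coeff_map, coeff_momentSeries]; rfl
  have h0 : matC (momMat g b 0) = 0 := Matrix.map_zero _ (map_zero _)
  -- The first `K` terms of the geometric series suffice up to order `K`: the factor `h'` on the
  -- left raises the order by at least one.
  have key : ∀ K n, n ≤ K →
      PowerSeries.coeff n (∑ k ∈ Finset.range K, h' * (X' * h') ^ k) = convMat g b n := by
    intro K
    induction K with
    | zero =>
      intro n hn
      obtain rfl := Nat.le_zero.1 hn
      rw [Finset.range_zero, Finset.sum_empty, map_zero]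
      rfl
    | succ K ih =>
      intro n hn
      rw [sum_mul_pow_succ, map_add, hcoeff, PowerSeries.coeff_mul, convMat_eq]
      congr 1
      refine Finset.sum_congr rfl fun p hp => ?_
      have hp' : p.1 + p.2 = n := by simpa using hp
      rw [hcoeff, hX', PowerSeries.coeff_C_mul]
      rcases Nat.eq_zero_or_pos p.1 with h | h
      · rw [h, h0, zero_mul, zero_mul]
      · rw [ih p.2 (by omega)]
  ext1 n
  rw [coeff_momentSeries, momentSeries, PowerSeries.coeff_mk]
  have hmap : ∑ k ∈ Finset.range n, (PowerSeries.coeff n (h' * (X' * h') ^ k)).map f =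
      (convMat g b n).map f := by
    rw [← key n n le_rfl, map_sum]
    exact (map_sum (f.toAddMonoidHom.mapMatrix (m := Fin d) (n := Fin d)) _ _).symm
  refine hmap.trans ?_
  cases n with
  | zero => exact Matrix.map_zero _ (map_zero f)
  | succ n => rw [convMat, momMat, Matrix.map_map]; rfl

/-- The matrix with entries `b₀, b₁, …` above the diagonal. -/
def shiftMat (b : ℕ → B) (n : ℕ) : Matrix (Fin n) (Fin n) B :=
  Matrix.of fun i j => if (j : ℕ) = i + 1 then b i else 0

/-- There is only one path along the superdiagonal between two indices, so an entry of `b (X b) ^ n`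
is a single monomial with arbitrary coefficients. -/
lemma matWord_shiftMat (b : ℕ → B) (N n : ℕ) (i j : Fin N) :
    matWord (shiftMat b N) n i j =
      if (j : ℕ) = i + n + 1 then mono (fun m => b (i + m)) n else 0 := by
  induction n generalizing i with
  | zero =>
    simp only [matWord, matC, shiftMat, Matrix.map_apply, Matrix.of_apply]
    split_ifs with h
    · rfl
    · exact map_zero _
  | succ n ih =>
    rw [matWord_succ_apply]
    have hs : ∀ a, shiftMat b N i a = if (a : ℕ) = i + 1 then b i else 0 := fun _ => rfl
    simp only [ih, hs]
    split_ifs with h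
    · have hi : (i : ℕ) + 1 < N := by have := j.2; omega
      rw [Finset.sum_eq_single (⟨i + 1, hi⟩ : Fin N)]
      · have hj : (j : ℕ) = i + 1 + n + 1 := by omega
        rw [if_pos rfl, if_pos hj, mono, mono, List.range_succ_eq_map,
          List.map_cons, word_cons, List.map_map]
        simp only [Function.comp_def, Nat.succ_eq_add_one, add_zero, zero_add, add_assoc,
          add_comm 1]
      · intro a _ ha
        rw [if_neg (fun h => ha (Fin.ext h)), map_zero, zero_mul]
      · simp
    · refine Finset.sum_eq_zero fun a _ => ?_
      by_cases ha : (a : ℕ) = i + 1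
      · rw [if_neg (by omega : ¬ ((j : ℕ) = a + n + 1)), mul_zero, mul_zero]
      · rw [if_neg ha, map_zero, zero_mul]

/-- `ρ = f ▷ g` if and only if `ρ = f ∘ T_g`. -/
lemma isMonotoneConvolution_iff (f g r : NCPoly B →ₗ[ℂ] B) :
    IsMonotoneConvolution f g r ↔ r = f ∘ₗ convOp g := by
  constructor
  · intro h
    refine linearMap_ext_mono fun n b => ?_
    -- Size `n + 2` makes the corner entry `(0, n + 1)` of `b (X b) ^ n` equal to `b₀ X ⋯ X bₙ`.
    have h1 := congrArg (PowerSeries.coeff (n + 1)) (h (n + 2) (shiftMat b (n + 2)))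
    rw [momentSeries_comp, momentSeries_monomial, momentSeries_monomial] at h1
    have h2 := congrFun (congrFun h1 ⟨0, by omega⟩) ⟨n + 1, by omega⟩
    simpa [matWord_shiftMat] using h2
  · rintro rfl d b
    rw [momentSeries_comp]

end Convolution

/-! ### Derivatives of one-parameter groups -/

section Deriv

variable {V W : Type*} [AddCommGroup V] [Module ℂ V] [AddCommGroup W] [Module ℂ W]
variable {E : Type*} [NormedAddCommGroup E] [NormedSpace ℂ E]

lemma hasDerivAt_pow_div_factorial (k : ℕ) (z : ℂ) :
    HasDerivAt (fun z : ℂ => z ^ (k + 1) / ((k + 1)! : ℂ)) (z ^ k / (k ! : ℂ)) z := by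
  refine ((hasDerivAt_pow (k + 1) z).div_const ((k + 1)! : ℂ)).congr_deriv ?_
  have h1 := Nat.cast_ne_zero (R := ℂ).2 k.factorial_ne_zero
  have h2 : ((k + 1 : ℕ) : ℂ) ≠ 0 := Nat.cast_ne_zero.2 (Nat.succ_ne_zero k)
  rw [Nat.factorial_succ, Nat.cast_mul, Nat.add_sub_cancel]
  field_simp

lemma hasDerivAt_lexp {f : Module.End ℂ V} (hf : LocNil f) (F : V →ₗ[ℂ] E) (v : V) (z : ℂ) :
    HasDerivAt (fun z : ℂ => F (lexp (z • f) v)) (F (lexp (z • f) (f v))) z := by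
  obtain ⟨N, hN⟩ := hf v
  have hN1 : (f ^ (N + 1)) v = 0 := pow_apply_eq_zero_of_le hN (Nat.le_succ N)
  have h1 : (fun z : ℂ => F (lexp (z • f) v)) = fun z =>
      ∑ k ∈ Finset.range N, (z ^ (k + 1) / ((k + 1)! : ℂ)) • F ((f ^ (k + 1)) v) + F v := by
    funext z
    rw [lexp_smul_apply hf z hN1, map_sum, Finset.sum_range_succ']
    simp
  have h2 : F (lexp (z • f) (f v)) =
      ∑ k ∈ Finset.range N, (z ^ k / (k ! : ℂ)) • F ((f ^ (k + 1)) v) := by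
    rw [lexp_smul_apply hf z (N := N)
      (by rw [← Module.End.mul_apply, ← pow_succ]; exact hN1), map_sum]
    simp only [map_smul, ← Module.End.mul_apply, ← pow_succ]
  rw [h1, h2]
  exact (HasDerivAt.fun_sum fun k _ => (hasDerivAt_pow_div_factorial k z).smul_const _).add_const _

lemma continuous_lexp {f : Module.End ℂ V} (hf : LocNil f) (F : V →ₗ[ℂ] E) (v : V) :
    Continuous fun z : ℂ => F (lexp (z • f) v) :=
  continuous_iff_continuousAt.2 fun z => (hasDerivAt_lexp hf F v z).continuousAt

/-- The derivative of `s ↦ e^{(t-s)D} m e^{sL}`. -/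
lemma hasDerivAt_lexp_comp {L : Module.End ℂ V} {D : Module.End ℂ W} (hL : LocNil L)
    (hD : LocNil D) (m : V →ₗ[ℂ] W) (F : W →ₗ[ℂ] E) (v : V) (t z : ℂ) :
    HasDerivAt (fun z : ℂ => F (lexp ((t - z) • D) (m (lexp (z • L) v))))
      (F (lexp ((t - z) • D) (m (L (lexp (z • L) v)) - D (m (lexp (z • L) v))))) z := by
  obtain ⟨N, hN⟩ := hL v
  have hN1 : (L ^ (N + 1)) v = 0 := pow_apply_eq_zero_of_le hN (Nat.le_succ N)
  -- Only the exponential on the right is expanded as a polynomial in `z`; the other one is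
  -- differentiated by `hasDerivAt_lexp`.
  set G : ℕ → ℂ → E := fun k z => F (lexp ((t - z) • D) (m ((L ^ k) v))) with hG
  have hG' : ∀ k, HasDerivAt (G k) (-F (lexp ((t - z) • D) (D (m ((L ^ k) v))))) z := by
    intro k
    exact ((hasDerivAt_lexp hD F (m ((L ^ k) v)) (t - z)).scomp z
      ((hasDerivAt_id z).const_sub t)).congr_deriv (neg_one_smul _ _)
  have hLv : ∀ z, lexp (z • L) v =
      ∑ k ∈ Finset.range N, (z ^ (k + 1) / ((k + 1)! : ℂ)) • (L ^ (k + 1)) v + v := by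
    intro z
    rw [lexp_smul_apply hL z hN1, Finset.sum_range_succ']
    simp
  have h1 : (fun z : ℂ => F (lexp ((t - z) • D) (m (lexp (z • L) v)))) = fun z =>
      ∑ k ∈ Finset.range N, (z ^ (k + 1) / ((k + 1)! : ℂ)) • G (k + 1) z + G 0 z := by
    funext z
    rw [hLv]
    simp [hG]
  rw [h1]
  have h2 : L (lexp (z • L) v) = ∑ k ∈ Finset.range N, (z ^ k / (k ! : ℂ)) • (L ^ (k + 1)) v := by
    rw [lexp_smul_apply hL z hN, map_sum]
    simp only [map_smul, ← Module.End.mul_apply, ← pow_succ']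
  have h3 := (HasDerivAt.fun_sum (u := Finset.range N) fun k _ =>
    (hasDerivAt_pow_div_factorial k z).smul (hG' (k + 1))).add (hG' 0)
  refine h3.congr_deriv ?_
  rw [map_sub, map_sub, h2, hLv]
  simp only [map_sum, map_add, map_smul, hG, Finset.sum_add_distrib, smul_neg,
    Finset.sum_neg_distrib, pow_zero, Module.End.one_apply]
  abel

lemma continuous_lexp_comp {L : Module.End ℂ V} {D : Module.End ℂ W} (hL : LocNil L)
    (hD : LocNil D) (m : V →ₗ[ℂ] W) (F : W →ₗ[ℂ] E) (v : V) (t : ℂ) :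
    Continuous fun z : ℂ => F (lexp ((t - z) • D) (m (lexp (z • L) v))) :=
  continuous_iff_continuousAt.2 fun z => (hasDerivAt_lexp_comp hL hD m F v t z).continuousAt

end Deriv

/-! ### Monotonicity along curves in an ordered C*-algebra -/

section Order

variable {E : Type*} [CStarAlgebra E] [PartialOrder E] [StarOrderedRing E]

lemma nonneg_iff_exists_mul_star {a : E} : 0 ≤ a ↔ ∃ b, a = b * star b :=
  CStarAlgebra.nonneg_iff_eq_mul_star_self

/-- The increment is the integral of the derivative, and the integral of a positive function is
positive. -/
lemma le_of_hasDerivAt_nonpos {f f' : ℂ → E} {t : ℝ} (ht : 0 ≤ t)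
    (hf : ∀ z, HasDerivAt f (f' z) z) (hc : Continuous f')
    (hneg : ∀ s : ℝ, s ∈ Set.Icc 0 t → 0 ≤ -f' s) : f t ≤ f 0 := by
  have hd : ∀ s : ℝ, HasDerivAt (fun s : ℝ => f s) (f' s) s := fun s => by
    have := (hf s).scomp s Complex.ofRealCLM.hasDerivAt
    simpa using! this
  have hc' : Continuous fun s : ℝ => f' s := hc.comp Complex.continuous_ofReal
  have h := intervalIntegral.integral_eq_sub_of_hasDerivAt (a := 0) (b := t)
    (fun s _ => hd s) (hc'.intervalIntegrable _ _)
  have h2 : 0 ≤ ∫ s in (0 : ℝ)..t, -f' s := by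
    rw [intervalIntegral.integral_of_le ht]
    refine MeasureTheory.integral_nonneg_of_ae ?_
    filter_upwards [MeasureTheory.ae_restrict_mem measurableSet_Ioc] with s hs
    exact hneg s (Set.Ioc_subset_Icc_self hs)
  rw [intervalIntegral.integral_neg, h] at h2
  simpa using h2

end Order

/-! ### Complete positivity -/

section CP

variable {B : Type*} [CStarAlgebra B] [PartialOrder B] [StarOrderedRing B]

/-- Positivity of a matrix over `B`. -/
def MatNonneg {n : ℕ} (x : Fin n → Fin n → B) : Prop :=
  0 ≤ (CStarMatrix.ofMatrix (Matrix.of x) : CStarMatrix (Fin n) (Fin n) B)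

lemma MatNonneg.exists_factor {n : ℕ} {x : Fin n → Fin n → B} (h : MatNonneg x) :
    ∃ c : Fin n → Fin n → B, ∀ i j, x i j = ∑ m, c i m * star (c j m) := by
  obtain ⟨y, hy⟩ := nonneg_iff_exists_mul_star.1 h
  refine ⟨fun i j => y i j, fun i j => ?_⟩
  have := congrArg (fun M : CStarMatrix (Fin n) (Fin n) B => M i j) hy
  simpa [CStarMatrix.mul_apply, CStarMatrix.star_apply] using this

lemma matNonneg_mul_star {n : ℕ} (c : Fin n → B) : MatNonneg fun i j => c i * star (c j) := by
  rcases n with _ | n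
  · have : (CStarMatrix.ofMatrix (Matrix.of fun i j : Fin 0 => c i * star (c j)) :
      CStarMatrix (Fin 0) (Fin 0) B) = 0 := by ext i; exact i.elim0
    exact this.ge
  -- The vector `c` is placed in the first column of a square matrix that is zero elsewhere.
  · refine nonneg_iff_exists_mul_star.2
      ⟨CStarMatrix.ofMatrix (Matrix.of fun i j => if j = 0 then c i else 0), ?_⟩
    ext i j
    simp [CStarMatrix.mul_apply, CStarMatrix.star_apply]

lemma MatNonneg.sum {n : ℕ} {ι : Type*} {s : Finset ι} {x : ι → Fin n → Fin n → B}
    (h : ∀ a ∈ s, MatNonneg (x a)) : MatNonneg fun i j => ∑ a ∈ s, x a i j := by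
  have : (CStarMatrix.ofMatrix (Matrix.of fun i j => ∑ a ∈ s, x a i j) :
      CStarMatrix (Fin n) (Fin n) B) =
      ∑ a ∈ s, CStarMatrix.ofMatrix (Matrix.of (x a)) := by
    classical
    clear h
    induction s using Finset.induction_on with
    | empty => ext i j; simp
    | insert a s ha ih =>
      rw [Finset.sum_insert ha, ← ih]
      ext i j
      simp [Finset.sum_insert ha]
  rw [MatNonneg, this]
  exact Finset.sum_nonneg h

/-- A Gram factorization of the matrix, for arbitrary finite index types; later the index runs over
all tensor legs of several polynomials at once. -/
lemma IsCP.exists_factor {f : NCPoly B →ₗ[ℂ] B} (hf : IsCP f) {ι : Type*} [Fintype ι]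
    (P : ι → NCPoly B) :
    ∃ c : ι → Fin (Fintype.card ι) → B, ∀ i j,
      f (P i * star (P j)) = ∑ m, c i m * star (c j m) := by
  obtain ⟨c, hc⟩ := MatNonneg.exists_factor (hf _ (P ∘ (Fintype.equivFin ι).symm))
  refine ⟨fun i => c (Fintype.equivFin ι i), fun i j => ?_⟩
  simpa using hc (Fintype.equivFin ι i) (Fintype.equivFin ι j)

/-- The off-diagonal entries of the Gram matrix of the pair `1, P` are adjoint to each other. -/
lemma IsCP.map_star {f : NCPoly B →ₗ[ℂ] B} (hf : IsCP f) (P : NCPoly B) :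
    f (star P) = star (f P) := by
  obtain ⟨c, hc⟩ := hf.exists_factor ![1, P]
  have h1 := hc 0 1
  have h2 := hc 1 0
  simp only [Matrix.cons_val_zero, Matrix.cons_val_one, one_mul, star_one, mul_one] at h1 h2
  rw [h1, h2, star_sum]
  simp

lemma IsCP.smul {f : NCPoly B →ₗ[ℂ] B} (hf : IsCP f) (t : ℝ≥0) : IsCP (((t : ℝ) : ℂ) • f) := by
  intro n P
  obtain ⟨c, hc⟩ := hf.exists_factor P
  have h : MatNonneg fun i j => ∑ m, ((((Real.sqrt t : ℝ) : ℂ) • c i m) *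
      star (((Real.sqrt t : ℝ) : ℂ) • c j m)) :=
    MatNonneg.sum fun m _ => matNonneg_mul_star fun i => ((Real.sqrt t : ℝ) : ℂ) • c i m
  have h2 : ((t : ℝ) : ℂ) = ((Real.sqrt t : ℝ) : ℂ) * ((Real.sqrt t : ℝ) : ℂ) := by
    rw [← Complex.ofReal_mul, Real.mul_self_sqrt t.coe_nonneg]
  have h3 : (fun i j => (((t : ℝ) : ℂ) • f) (P i * star (P j))) =
      fun i j => ∑ m, ((((Real.sqrt t : ℝ) : ℂ) • c i m) *
        star (((Real.sqrt t : ℝ) : ℂ) • c j m)) := by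
    funext i j
    simp only [LinearMap.smul_apply, hc, Finset.smul_sum, star_smul,
      Complex.star_def, Complex.conj_ofReal, smul_mul_smul_comm, h2]
  exact h3 ▸ h

end CP

/-! ### Compatibility of the generator with the involution -/

namespace NCPoly

section Star

variable {B : Type*} [CStarAlgebra B]

/-- Reversing a word exchanges the two legs of `fdq`. A single list of legs serves `P` and `star P`,
so that the straddling term for `P * star P` can be written as a Gram expression; the degree bound
is kept on the legs that stay outside `σ`. -/
lemma exists_fdq_list {n : ℕ} {P : NCPoly B} (hP : P ∈ degLE B (n + 1)) :
    ∃ l : List (NCPoly B × NCPoly B), (∀ x ∈ l, x.1 ∈ degLE B n) ∧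
      fdq P = (l.map fun x => x.1 ⊗ₜ x.2).sum ∧
      fdq (star P) = (l.map fun x => star x.2 ⊗ₜ star x.1).sum := by
  refine Submodule.span_induction ?_ ?_ ?_ ?_ hP
  · rintro _ ⟨b, l, hl, rfl⟩
    clear hP
    induction l generalizing b n with
    | nil => exact ⟨[], by simp, by simp, by simp⟩
    | cons c l ih =>
      have hl' : l.length ≤ n := by simpa using hl
      obtain ⟨L, h1, h2, h3⟩ : ∃ L : List (NCPoly B × NCPoly B),
          (∀ x ∈ L, C b * (X * x.1) ∈ degLE B n) ∧
          fdq (word c l) = (L.map fun x => x.1 ⊗ₜ x.2).sum ∧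
          fdq (star (word c l)) = (L.map fun x => star x.2 ⊗ₜ star x.1).sum := by
        cases l with
        | nil => exact ⟨[], by simp, by simp, by simp⟩
        | cons d l =>
          obtain ⟨m, rfl⟩ : ∃ m, n = m + 1 := ⟨n - 1, by simp at hl'; omega⟩
          obtain ⟨L, h1, h2, h3⟩ := ih c hl'
          exact ⟨L, fun x hx => C_mul_mem_degLE _ (X_mul_mem_degLE (h1 x hx)), h2, h3⟩
      refine ⟨(C b, word c l) :: L.map fun x => (C b * (X * x.1), x.2), ?_, ?_, ?_⟩
      · intro x hx
        rcases List.mem_cons.1 hx with rfl | hx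
        · exact C_mem_degLE _ _
        · obtain ⟨y, hy, rfl⟩ := List.mem_map.1 hx
          exact h1 y hy
      · rw [word_cons, fdq_C_mul, fdq_X_mul, h2, mul_add, List.map_cons, List.sum_cons, add_comm]
        simp [← List.sum_map_mul_left, Function.comp_def, List.map_map]
      · rw [word_cons, star_mul, star_mul, star_X, star_C, fdq_mul, fdq_mul, fdq_C, fdq_X, h3]
        simp [add_mul, ← List.sum_map_mul_right, Function.comp_def, List.map_map, add_comm,
          mul_assoc]
  · exact ⟨[], by simp, by simp, by simp⟩
  · rintro P Q - - ⟨L, h1, h2, h3⟩ ⟨M, k1, k2, k3⟩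
    refine ⟨L ++ M, ?_, ?_, ?_⟩
    · intro x hx
      rcases List.mem_append.1 hx with hx | hx
      · exact h1 x hx
      · exact k1 x hx
    · simp [h2, k2]
    · simp [h3, k3]
  · rintro z P - ⟨L, h1, h2, h3⟩
    refine ⟨L.map fun x => (z • x.1, x.2), ?_, ?_, ?_⟩
    · intro x hx
      obtain ⟨y, hy, rfl⟩ := List.mem_map.1 hx
      exact Submodule.smul_mem _ _ (h1 y hy)
    · rw [map_smul, h2, List.smul_sum]
      simp [Function.comp_def, List.map_map, TensorProduct.smul_tmul']
    · rw [star_smul, map_smul, h3, List.smul_sum]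
      simp [Function.comp_def, List.map_map, TensorProduct.tmul_smul]

lemma exists_fdq_sum {n : ℕ} {P : NCPoly B} (hP : P ∈ degLE B (n + 1)) :
    ∃ (N : ℕ) (a p : Fin N → NCPoly B), (∀ k, a k ∈ degLE B n) ∧
      fdq P = ∑ k, a k ⊗ₜ p k ∧ fdq (star P) = ∑ k, star (p k) ⊗ₜ star (a k) := by
  obtain ⟨l, h1, h2, h3⟩ := exists_fdq_list hP
  refine ⟨l.length, fun k => l[k].1, fun k => l[k].2, fun k => h1 _ (List.getElem_mem _), ?_, ?_⟩
  · rw [h2, ← Fin.sum_univ_fun_getElem]; rfl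
  · rw [h3, ← Fin.sum_univ_fun_getElem]; rfl

variable {γ : B} {σ : NCPoly B →ₗ[ℂ] B}

lemma gen_star (hγ : IsSelfAdjoint γ) (hσ : ∀ P, σ (star P) = star (σ P)) (P : NCPoly B) :
    gen γ σ (star P) = star (gen γ σ P) := by
  induction P using induction_left with
  | h1 => simp
  | hC b P h => rw [star_mul, star_C, gen_mul_C, h, gen_C_mul, star_mul, star_C]
  | hX P h =>
    obtain ⟨n, hn⟩ := exists_mem_degLE P
    obtain ⟨N, a, p, -, h2, h3⟩ := exists_fdq_sum (degLE_mono (Nat.le_succ n) hn)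
    have hX1 : gen γ σ X = C γ := by simpa using gen_X_mul γ σ 1
    rw [star_mul, star_X, gen_mul, h, hX1, gen_X_mul, h2, h3, fdq_X]
    simp only [map_sum, straddle_tmul, contr_tmul, star_add, star_mul, star_X, star_C, star_sum,
      hγ.star_eq, LinearMap.comp_apply, LinearMap.mulLeft_apply, hσ, mul_one, add_assoc]
  | hadd P Q hP hQ => simp only [star_add, map_add, hP, hQ]

lemma lexp_gen_star (hγ : IsSelfAdjoint γ) (hσ : ∀ P, σ (star P) = star (σ P)) (t : ℝ)
    (P : NCPoly B) : lexp ((t : ℂ) • gen γ σ) (star P) = star (lexp ((t : ℂ) • gen γ σ) P) := by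
  have hpow : ∀ (k : ℕ) P, (gen γ σ ^ k) (star P) = star ((gen γ σ ^ k) P) := by
    intro k
    induction k with
    | zero => intro P; rfl
    | succ k ih =>
      intro P
      rw [pow_succ, Module.End.mul_apply, gen_star hγ hσ, ih, Module.End.mul_apply]
  obtain ⟨N, hN⟩ := locNil_gen γ σ P
  rw [lexp_smul_apply (locNil_gen γ σ) _ hN,
    lexp_smul_apply (locNil_gen γ σ) _ (N := N) (by rw [hpow, hN, star_zero]), star_sum]
  refine Finset.sum_congr rfl fun k _ => ?_
  rw [hpow, star_smul]
  simp

lemma lexp_gen_mem_degLE (γ : B) (σ : NCPoly B →ₗ[ℂ] B) (z : ℂ) {n : ℕ} {P : NCPoly B}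
    (hP : P ∈ degLE B n) : lexp (z • gen γ σ) P ∈ degLE B n := by
  have hg : ∀ P ∈ degLE B n, gen γ σ P ∈ degLE B n := fun P hP =>
    gen_mem_degLE γ σ (degLE_mono (Nat.le_succ n) hP)
  have hpow : ∀ k, (gen γ σ ^ k) P ∈ degLE B n := by
    intro k
    induction k with
    | zero => exact hP
    | succ k ih => rw [pow_succ', Module.End.mul_apply]; exact hg _ ih
  obtain ⟨N, hN⟩ := locNil_gen γ σ P
  rw [lexp_smul_apply (locNil_gen γ σ) _ hN]
  exact Submodule.sum_mem _ fun k _ => Submodule.smul_mem _ _ (hpow k)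

end Star

end NCPoly

/-! ### The semigroup generated by a pair `(γ, σ)` -/

section Evo

variable {B : Type*} [CStarAlgebra B]

/-- The functional `ε ∘ exp(z D)`, where `D` is the generator attached to `(γ, σ)`. -/
def evo (γ : B) (σ : NCPoly B →ₗ[ℂ] B) (z : ℂ) : NCPoly B →ₗ[ℂ] B :=
  constL ∘ₗ lexp (z • gen γ σ)

lemma lexp_gen_C_mul (γ : B) (σ : NCPoly B →ₗ[ℂ] B) (z : ℂ) (b : B) (P : NCPoly B) :
    lexp (z • gen γ σ) (C b * P) = C b * lexp (z • gen γ σ) P :=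
  (map_lexp ((locNil_gen γ σ).smul z) ((locNil_gen γ σ).smul z)
    (F := LinearMap.mulLeft ℂ (C b)) (fun v => by simp) P).symm

lemma lexp_gen_mul_C (γ : B) (σ : NCPoly B →ₗ[ℂ] B) (z : ℂ) (b : B) (P : NCPoly B) :
    lexp (z • gen γ σ) (P * C b) = lexp (z • gen γ σ) P * C b :=
  (map_lexp ((locNil_gen γ σ).smul z) ((locNil_gen γ σ).smul z)
    (F := LinearMap.mulRight ℂ (C b)) (fun v => by simp) P).symm

lemma lexp_gen_C (γ : B) (σ : NCPoly B →ₗ[ℂ] B) (z : ℂ) (b : B) :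
    lexp (z • gen γ σ) (C b) = C b := by
  rw [lexp_smul_apply (locNil_gen γ σ) z (N := 1) (by simp)]
  simp

lemma evo_bimodule (γ : B) (σ : NCPoly B →ₗ[ℂ] B) (z : ℂ) (b c : B) (P : NCPoly B) :
    evo γ σ z (C b * P * C c) = b * evo γ σ z P * c := by
  simp [evo, lexp_gen_C_mul, lexp_gen_mul_C]

lemma evo_C (γ : B) (σ : NCPoly B →ₗ[ℂ] B) (z : ℂ) (b : B) : evo γ σ z (C b) = b := by
  simp [evo, lexp_gen_C]

lemma evo_zero (γ : B) (σ : NCPoly B →ₗ[ℂ] B) : evo γ σ 0 = constL := by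
  ext P
  simp [evo, lexp_zero]

/-- The exponential of a coderivation is a comorphism, hence the operator of its own constant term.
The semigroup law for `evo` thereby reduces to that of exponentials. -/
lemma convOp_evo (γ : B) (σ : NCPoly B →ₗ[ℂ] B) (z : ℂ) :
    convOp (evo γ σ z) = lexp (z • gen γ σ) :=
  ((((isCoderivation_gen γ σ).smul z).lexp ((locNil_gen γ σ).smul z)).eq_convOp _
    fun _ => rfl).symm

lemma evo_add (γ : B) (σ : NCPoly B →ₗ[ℂ] B) (s t : ℂ) :
    evo γ σ (s + t) = evo γ σ s ∘ₗ convOp (evo γ σ t) := by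
  rw [convOp_evo, evo, lexp_add_smul (locNil_gen γ σ)]
  rfl

lemma gen_smul (γ : B) (σ : NCPoly B →ₗ[ℂ] B) (z : ℂ) : gen (z • γ) (z • σ) = z • gen γ σ := by
  ext P
  induction P using induction_left with
  | h1 => simp
  | hC b P h => simp [h]
  | hX P h =>
    have hc : ∀ u, contr (z • σ) u = z • contr σ u := fun u => by
      induction u with
      | zero => simp
      | tmul p q => simp
      | add u v hu hv => rw [map_add, hu, hv, map_add, smul_add]
    simp [h, hc]
  | hadd P Q hP hQ => rw [map_add, map_add, hP, hQ]

/-- The generator is linear in the pair, so time can be absorbed into `(γ, σ)`. -/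
lemma evo_smul (γ : B) (σ : NCPoly B →ₗ[ℂ] B) (z : ℂ) :
    evo (z • γ) (z • σ) 1 = evo γ σ z := by
  rw [evo, gen_smul, one_smul, evo]

lemma continuous_evo (γ : B) (σ : NCPoly B →ₗ[ℂ] B) (P : NCPoly B) :
    Continuous fun z => evo γ σ z P :=
  continuous_lexp (locNil_gen γ σ) constL P

lemma hasDerivAt_evo (γ : B) (σ : NCPoly B →ₗ[ℂ] B) (P : NCPoly B) :
    HasDerivAt (fun z => evo γ σ z P) (constTerm (gen γ σ P)) 0 := by
  have := hasDerivAt_lexp (locNil_gen γ σ) constL P 0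
  rw [zero_smul, lexp_zero] at this
  exact this

lemma straddle_eq_sum (σ : NCPoly B →ₗ[ℂ] B) {N M : ℕ} (a p : Fin N → NCPoly B)
    (q r : Fin M → NCPoly B) :
    straddle σ (∑ l, q l ⊗ₜ r l) (∑ k, a k ⊗ₜ p k) =
      ∑ k, ∑ l, a k * (C (σ (p k * q l)) * r l) := by
  simp [Finset.mul_sum]

/-- Passing from functions of two indices to matrices. -/
def ofMatL (k : ℕ) : (Fin k → Fin k → B) →L[ℂ] CStarMatrix (Fin k) (Fin k) B :=
  (CStarMatrix.ofMatrixL (m := Fin k) (n := Fin k) (A := B)).toContinuousLinearMap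

lemma continuous_ofMatL {k : ℕ} {f : ℂ → Fin k → Fin k → B}
    (h : ∀ i j, Continuous fun z => f z i j) : Continuous fun z => ofMatL k (f z) :=
  (ofMatL k).continuous.comp (continuous_pi fun i => continuous_pi (h i))

end Evo

/-! ### Complete positivity of the generated semigroup -/

section Positivity

variable {B : Type*} [CStarAlgebra B] [PartialOrder B] [StarOrderedRing B]

/-- The straddling part of the generator maps Gram matrices to sums of Gram matrices. -/
lemma exists_straddle_eq {σ : NCPoly B →ₗ[ℂ] B} (hσ : IsCP σ) {n k : ℕ} {P : Fin k → NCPoly B}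
    (hP : ∀ i, P i ∈ degLE B (n + 1)) :
    ∃ (M : ℕ) (Q : Fin M → Fin k → NCPoly B), (∀ m i, Q m i ∈ degLE B n) ∧
      ∀ i j, straddle σ (fdq (star (P j))) (fdq (P i)) = ∑ m, Q m i * star (Q m j) := by
  choose N a p ha hp hq using fun i => exists_fdq_sum (hP i)
  -- The map `σ` is factored on the right legs of all the `P i` simultaneously; the factors are then
  -- absorbed into the left legs, which have smaller degree.
  obtain ⟨c, hc⟩ := hσ.exists_factor (fun x : Σ i : Fin k, Fin (N i) => p x.1 x.2)
  refine ⟨_, fun m i => ∑ l, a i l * C (c ⟨i, l⟩ m), fun m i => Submodule.sum_mem _ fun l _ =>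
    mul_C_mem_degLE _ (ha i l), fun i j => ?_⟩
  rw [hp, hq, straddle_eq_sum]
  have h1 : ∀ (l : Fin (N i)) (l' : Fin (N j)), σ (p i l * star (p j l')) =
      ∑ m, c ⟨i, l⟩ m * star (c ⟨j, l'⟩ m) := fun l l' => hc ⟨i, l⟩ ⟨j, l'⟩
  simp only [h1, map_sum, map_mul, star_sum, star_mul, star_C, Finset.sum_mul, Finset.mul_sum,
    mul_assoc]
  rw [Finset.sum_comm]
  have h2 : ∀ y : Fin (N j), (∑ x : Fin (N i), ∑ m, a i x * (C (c ⟨i, x⟩ m) *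
      (C (star (c ⟨j, y⟩ m)) * star (a j y)))) = ∑ m, ∑ x : Fin (N i), a i x * (C (c ⟨i, x⟩ m) *
      (C (star (c ⟨j, y⟩ m)) * star (a j y))) := fun y => Finset.sum_comm
  simp only [h2]
  rw [Finset.sum_comm]

lemma matNonneg_iff {k : ℕ} {x : Fin k → Fin k → B} : MatNonneg x ↔ 0 ≤ ofMatL k x := Iff.rfl

lemma hasDerivAt_ofMatL {k : ℕ} {f f' : ℂ → Fin k → Fin k → B} {z : ℂ}
    (h : ∀ i j, HasDerivAt (fun z => f z i j) (f' z i j) z) :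
    HasDerivAt (fun z => ofMatL k (f z)) (ofMatL k (f' z)) z := by
  have h1 : HasDerivAt f (f' z) z := by
    rw [hasDerivAt_pi]
    intro i
    rw [hasDerivAt_pi]
    exact h i
  exact (ofMatL k).hasFDerivAt.comp_hasDerivAt z h1

/-- Along `s ↦ ε exp((t-s)D) (exp(sD) Pᵢ · exp(sD) Pⱼ*)` the derivative is minus `ε exp((t-s)D)` of
the straddling term. That term is a sum of Gram matrices of smaller degree, so the derivative is
nonpositive by induction. The value at `s = 0`, the matrix in question, therefore dominates the
value at `s = t`, which is a Gram matrix over `B`. -/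
lemma matNonneg_evo {γ : B} {σ : NCPoly B →ₗ[ℂ] B} (hγ : IsSelfAdjoint γ) (hσ : IsCP σ) (n : ℕ) :
    ∀ (k : ℕ) (P : Fin k → NCPoly B), (∀ i, P i ∈ degLE B n) → ∀ t : ℝ, 0 ≤ t →
      MatNonneg fun i j => evo γ σ t (P i * star (P j)) := by
  have hend : ∀ (t : ℂ) (b c : B), evo γ σ t (C b * C c) = b * c := fun t b c => by
    rw [← map_mul, evo_C]
  induction n with
  | zero =>
    intro k P hP t _
    choose b hb using fun i => exists_eq_C (hP i)
    simp only [hb, star_C, hend]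
    exact matNonneg_mul_star b
  | succ n ih =>
    intro k P hP t ht
    set D := gen γ σ with hD
    have hDn : LocNil D := locNil_gen γ σ
    have hLn : LocNil (tensorSum D) := locNil_tensorSum hDn
    set m := LinearMap.mul' ℂ (NCPoly B) with hm
    set u : Fin k → Fin k → NCPoly B ⊗[ℂ] NCPoly B := fun i j => P i ⊗ₜ star (P j) with hu
    set f : ℂ → Fin k → Fin k → B := fun z i j =>
      constL (lexp (((t : ℂ) - z) • D) (m (lexp (z • tensorSum D) (u i j)))) with hf
    -- The negative of the Leibniz defect of `D`.
    set m' : NCPoly B ⊗[ℂ] NCPoly B →ₗ[ℂ] NCPoly B := m ∘ₗ tensorSum D - D ∘ₗ m with hm'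
    set f' : ℂ → Fin k → Fin k → B := fun z i j =>
      constL (lexp (((t : ℂ) - z) • D) (m' (lexp (z • tensorSum D) (u i j)))) with hf'
    have hder : ∀ z, HasDerivAt (fun z => ofMatL k (f z)) (ofMatL k (f' z)) z := fun z =>
      hasDerivAt_ofMatL fun i j => hasDerivAt_lexp_comp hLn hDn m constL (u i j) t z
    have hcont : Continuous fun z => ofMatL k (f' z) :=
      continuous_ofMatL fun i j => continuous_lexp_comp hLn hDn m' constL (u i j) t
    have hlexp : ∀ (s : ℝ) i j, lexp ((s : ℂ) • tensorSum D) (u i j) =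
        lexp ((s : ℂ) • D) (P i) ⊗ₜ star (lexp ((s : ℂ) • D) (P j)) := by
      intro s i j
      rw [← tensorSum_smul, lexp_tensorSum (hDn.smul _), hu, TensorProduct.map_tmul,
        lexp_gen_star hγ hσ.map_star]
    have hneg : ∀ s : ℝ, s ∈ Set.Icc 0 t → 0 ≤ -ofMatL k (f' s) := by
      intro s hs
      obtain ⟨M, Q, hQ, hsum⟩ := exists_straddle_eq hσ
        (P := fun i => lexp ((s : ℂ) • D) (P i)) fun i => lexp_gen_mem_degLE γ σ s (hP i)
      have h1 : -f' s = fun i j => ∑ l, evo γ σ ((t - s : ℝ) : ℂ) (Q l i * star (Q l j)) := by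
        funext i j
        have h2 : m' (lexp ((s : ℂ) • tensorSum D) (u i j)) =
            -∑ l, Q l i * star (Q l j) := by
          rw [← hsum, hlexp, hm', LinearMap.sub_apply, LinearMap.comp_apply, LinearMap.comp_apply,
            tensorSum_tmul, map_add, hm, LinearMap.mul'_apply, LinearMap.mul'_apply,
            LinearMap.mul'_apply, hD, gen_mul]
          abel
        simp only [Pi.neg_apply, hf', h2, map_neg, neg_neg, map_sum, Complex.ofReal_sub]
        rfl
      rw [← map_neg, h1]
      exact matNonneg_iff.1 (MatNonneg.sum fun l _ => ih k (Q l) (hQ l) _ (sub_nonneg.2 hs.2))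
    have hle := le_of_hasDerivAt_nonpos ht hder hcont hneg
    have h0 : f 0 = fun i j => evo γ σ t (P i * star (P j)) := by
      funext i j
      simp only [hf, sub_zero, zero_smul, lexp_zero, Module.End.one_apply]
      rfl
    have h1 : f t = fun i j => constTerm (lexp ((t : ℂ) • D) (P i)) *
        star (constTerm (lexp ((t : ℂ) • D) (P j))) := by
      have hstar : ∀ Q : NCPoly B, constTerm (star Q) = star (constTerm Q) := fun Q => by
        induction Q using induction_left with
        | h1 => simp
        | hC b P h => simp [h]
        | hX P h => simp
        | hadd P Q hP hQ => simp [hP, hQ]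
      funext i j
      simp only [hf, sub_self, zero_smul, lexp_zero, Module.End.one_apply, hlexp, hm,
        LinearMap.mul'_apply]
      exact (map_mul constTerm _ _).trans (by rw [hstar])
    rw [← h0]
    refine matNonneg_iff.2 (le_trans ?_ hle)
    rw [h1]
    exact matNonneg_iff.1 (matNonneg_mul_star _)

lemma isCP_evo {γ : B} {σ : NCPoly B →ₗ[ℂ] B} (hγ : IsSelfAdjoint γ) (hσ : IsCP σ) (t : ℝ≥0) :
    IsCP (evo γ σ (t : ℝ)) := by
  intro k P
  choose n hn using fun i => exists_mem_degLE (P i)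
  exact matNonneg_evo hγ hσ (Finset.univ.sup n) k P
    (fun i => degLE_mono (Finset.le_sup (Finset.mem_univ i)) (hn i)) t t.2

lemma isMonotoneSemigroup_evo {γ : B} {σ : NCPoly B →ₗ[ℂ] B} (hγ : IsSelfAdjoint γ)
    (hσ : IsCP σ) : IsMonotoneSemigroup fun t : ℝ≥0 => evo γ σ (t : ℝ) where
  cpBimodule t :=
    { bimodule := evo_bimodule γ σ _
      unital := by simpa using evo_C γ σ (t : ℝ) 1
      cp := isCP_evo hγ hσ t }
  zero := by simpa using evo_zero γ σ
  add s t := by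
    rw [isMonotoneConvolution_iff, ← evo_add]
    push_cast
    rfl
  continuousAt_zero P := by
    have : Continuous fun t : ℝ≥0 => evo γ σ ((t : ℝ) : ℂ) P :=
      (continuous_evo γ σ P).comp (Complex.continuous_ofReal.comp NNReal.continuous_coe)
    exact this.continuousAt

end Positivity

/-! ### The generator of a monotone convolution semigroup -/

section Generator

variable {B : Type*} [CStarAlgebra B]

/-- Every word is `b`, `b X c` or `b (X w X) c`. -/
lemma bimodule_ext {f g : NCPoly B →ₗ[ℂ] B} (hf : ∀ b c P, f (C b * P * C c) = b * f P * c)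
    (hg : ∀ b c P, g (C b * P * C c) = b * g P * c) (h1 : f 1 = g 1) (hX : f X = g X)
    (hXX : ∀ P, f (X * P * X) = g (X * P * X)) : f = g := by
  refine linearMap_ext_word fun b l => ?_
  cases l with
  | nil =>
    have := hf b 1 1
    have := hg b 1 1
    simp_all
  | cons c l =>
    rcases List.eq_nil_or_concat l with rfl | ⟨l, d, rfl⟩
    · rw [word_cons, word_nil, ← mul_assoc, hf, hg, hX]
    · have h : word b (c :: l.concat d) = C b * (X * word c l * X) * C d := by
        rw [List.concat_eq_append, word_cons, word_append_singleton]
        simp only [mul_assoc]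
      rw [h, hf, hg, hXX]

/-- The generator as a limit of positive multiples of the maps of the semigroup, through which
adjoints and positivity pass to the limit. Vanishing of the constant term removes the subtraction of
the value at `0`. -/
lemma tendsto_inv_smul_evo (γ : B) (σ : NCPoly B →ₗ[ℂ] B) {P : NCPoly B}
    (hP : constTerm P = 0) :
    Filter.Tendsto (fun n : ℕ => ((((n : ℝ≥0) + 1 : ℝ≥0) : ℝ) : ℂ) •
      evo γ σ ((((n : ℝ≥0) + 1)⁻¹ : ℝ≥0) : ℝ) P) Filter.atTop (nhds (constTerm (gen γ σ P))) := by
  have h := (hasDerivAt_evo γ σ P).tendsto_slope_zero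
  have h0 : evo γ σ 0 P = 0 := by rw [evo_zero]; exact hP
  simp only [zero_add, h0, sub_zero] at h
  have hlim : Filter.Tendsto (fun n : ℕ => (((((n : ℝ≥0) + 1)⁻¹ : ℝ≥0) : ℝ) : ℂ)) Filter.atTop
      (nhdsWithin 0 {0}ᶜ) := by
    rw [tendsto_nhdsWithin_iff]
    constructor
    · have h1 : Filter.Tendsto (fun n : ℕ => 1 / ((n : ℝ) + 1)) Filter.atTop (nhds 0) :=
        tendsto_one_div_add_atTop_nhds_zero_nat
      have h2 := (Complex.continuous_ofReal.tendsto 0).comp h1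
      simpa [Function.comp_def] using h2
    · refine Filter.Eventually.of_forall fun n => ?_
      have : ((n : ℂ) + 1) ≠ 0 := by exact_mod_cast Nat.succ_ne_zero n
      simpa using this
  refine (h.comp hlim).congr fun n => ?_
  simp

end Generator

/-! ### From a convolution semigroup to its pair -/

section Semigroup

variable {B : Type*} [CStarAlgebra B] [PartialOrder B] [StarOrderedRing B]

lemma IsCPBimoduleMap.map_C {f : NCPoly B →ₗ[ℂ] B} (hf : IsCPBimoduleMap f) (b : B) :
    f (C b) = b := by
  have := hf.bimodule b 1 1
  simpa [hf.unital] using this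

/-- The operators `T_{μ_t}` form a one-parameter semigroup. -/
lemma IsMonotoneSemigroup.convOp_add {μ : ℝ≥0 → (NCPoly B →ₗ[ℂ] B)} (h : IsMonotoneSemigroup μ)
    (s t : ℝ≥0) : convOp (μ (s + t)) = convOp (μ s) * convOp (μ t) := by
  rw [(isMonotoneConvolution_iff _ _ _).1 (h.add s t), convOp_comp]

lemma IsMonotoneSemigroup.convOp_nat_mul {μ : ℝ≥0 → (NCPoly B →ₗ[ℂ] B)}
    (h : IsMonotoneSemigroup μ) (n : ℕ) (t : ℝ≥0) : convOp (μ (n * t)) = convOp (μ t) ^ n := by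
  induction n with
  | zero => rw [Nat.cast_zero, zero_mul, h.zero, convOp_constL, pow_zero]
  | succ n ih => rw [Nat.cast_succ, add_mul, one_mul, h.convOp_add, ih, pow_succ]

/-- Each operator has a logarithm. Uniqueness of logarithms relates them at commensurable times, and
continuity at `0` extends the formula from rational to real times. -/
lemma IsMonotoneSemigroup.exists_operator {μ : ℝ≥0 → (NCPoly B →ₗ[ℂ] B)}
    (h : IsMonotoneSemigroup μ) : ∃ D : Module.End ℂ (NCPoly B), LocNil D ∧ IsCoderivation D ∧
      ∀ (t : ℝ≥0) P, μ t P = constTerm (lexp (((t : ℝ) : ℂ) • D) P) := by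
  have hU : ∀ t, ∃ D : Module.End ℂ (NCPoly B), LocNil D ∧ lexp D = convOp (μ t) := fun t =>
    exists_lexp_eq (locNil_convOp_sub_one (h.cpBimodule t).map_C)
  obtain ⟨D, hD, hD1⟩ := hU 1
  have hrat : ∀ (a m : ℕ), convOp (μ ((a : ℝ≥0) * ((m + 1 : ℕ) : ℝ≥0)⁻¹)) =
      lexp (((a : ℂ) * ((m + 1 : ℕ) : ℂ)⁻¹) • D) := by
    intro a m
    obtain ⟨E, hE, hE1⟩ := hU (((m + 1 : ℕ) : ℝ≥0)⁻¹)
    have hm : ((m + 1 : ℕ) : ℂ) ≠ 0 := Nat.cast_ne_zero.2 (Nat.succ_ne_zero m)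
    have hm' : ((m + 1 : ℕ) : ℝ≥0) ≠ 0 := Nat.cast_ne_zero.2 (Nat.succ_ne_zero m)
    have h1 : ((m + 1 : ℕ) : ℂ) • E = D := by
      refine lexp_injective (hE.smul _) hD ?_
      rw [lexp_nat_smul hE, hE1, ← h.convOp_nat_mul, mul_inv_cancel₀ hm', hD1]
    rw [h.convOp_nat_mul, ← hE1, ← lexp_nat_smul hE, ← h1, smul_smul, mul_assoc,
      inv_mul_cancel₀ hm, mul_one]
  refine ⟨D, hD, isCoderivation_of_lexp hD (hD1 ▸ isComorphism_convOp _), fun t P => ?_⟩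
  -- Rational approximation from above: `q m - t` is then a genuine time tending to `0`, where
  -- continuity is assumed.
  set q : ℕ → ℝ≥0 := fun m => (⌈t * ((m + 1 : ℕ) : ℝ≥0)⌉₊ : ℝ≥0) * ((m + 1 : ℕ) : ℝ≥0)⁻¹ with hq
  have hqt : ∀ m, t ≤ q m := fun m => by
    have hm' : (0 : ℝ≥0) < ((m + 1 : ℕ) : ℝ≥0) := Nat.cast_pos.2 (Nat.succ_pos m)
    simp only [hq]
    rw [← div_eq_mul_inv, le_div_iff₀ hm']
    exact Nat.le_ceil _
  have hqlim : Filter.Tendsto q Filter.atTop (nhds t) := by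
    have hub : ∀ m, q m ≤ t + ((m + 1 : ℕ) : ℝ≥0)⁻¹ := fun m => by
      have hm' : ((m + 1 : ℕ) : ℝ≥0) ≠ 0 := Nat.cast_ne_zero.2 (Nat.succ_ne_zero m)
      calc q m ≤ (t * ((m + 1 : ℕ) : ℝ≥0) + 1) * ((m + 1 : ℕ) : ℝ≥0)⁻¹ :=
            mul_le_mul_left (Nat.ceil_lt_add_one (zero_le)).le _
        _ = t + ((m + 1 : ℕ) : ℝ≥0)⁻¹ := by
            rw [add_mul, one_mul, mul_assoc, mul_inv_cancel₀ hm', mul_one]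
    have hlim : Filter.Tendsto (fun m : ℕ => t + ((m + 1 : ℕ) : ℝ≥0)⁻¹) Filter.atTop
        (nhds (t + 0)) :=
      tendsto_const_nhds.add
        ((tendsto_inv_atTop_nhds_zero_nat (𝕜 := ℝ≥0)).comp (Filter.tendsto_add_atTop_nat 1))
    rw [add_zero] at hlim
    exact tendsto_of_tendsto_of_tendsto_of_le_of_le tendsto_const_nhds hlim hqt hub
  have hsub : Filter.Tendsto (fun m => q m - t) Filter.atTop (nhds 0) := by
    have := hqlim.sub (tendsto_const_nhds (x := t))
    rwa [tsub_self] at this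
  have hμ0 : ∀ Q, μ 0 Q = constTerm Q := fun Q => by rw [h.zero]; rfl
  -- Since `μ_q = μ_{q-t} ∘ T_{μ_t}`, convergence at `q m` is continuity at `0` tested on the fixed
  -- polynomial `T_{μ_t} P`.
  have hl1 : Filter.Tendsto (fun m => μ (q m) P) Filter.atTop (nhds (μ t P)) := by
    have h1 := (h.continuousAt_zero (convOp (μ t) P)).tendsto.comp hsub
    rw [hμ0, constTerm_convOp] at h1
    refine h1.congr fun m => ?_
    have h2 := (isMonotoneConvolution_iff _ _ _).1 (h.add (q m - t) t)
    rw [tsub_add_cancel_of_le (hqt m)] at h2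
    rw [h2]
    rfl
  have hl2 : Filter.Tendsto (fun m => μ (q m) P) Filter.atTop
      (nhds (constTerm (lexp (((t : ℝ) : ℂ) • D) P))) := by
    have hc := ((continuous_lexp hD (constL (B := B)) P).comp
      (Complex.continuous_ofReal.comp NNReal.continuous_coe)).tendsto t
    refine (hc.comp hqlim).congr fun m => ?_
    rw [← constTerm_convOp (μ (q m)), hq, hrat]
    simp
  exact tendsto_nhds_unique hl1 hl2

/-- Every monotone convolution semigroup is generated by a pair `(γ, σ)`. -/
theorem IsMonotoneSemigroup.exists_eq_evo {μ : ℝ≥0 → (NCPoly B →ₗ[ℂ] B)}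
    (h : IsMonotoneSemigroup μ) : ∃ (γ : B) (σ : NCPoly B →ₗ[ℂ] B),
      IsSelfAdjoint γ ∧ IsCP σ ∧ ∀ t : ℝ≥0, μ t = evo γ σ (t : ℝ) := by
  obtain ⟨D, hD, hcod, hμ⟩ := h.exists_operator
  set γ := constTerm (D X)
  set σ : NCPoly B →ₗ[ℂ] B :=
    constL ∘ₗ D ∘ₗ LinearMap.mulRight ℂ X ∘ₗ LinearMap.mulLeft ℂ X with hσ
  have hμn : ∀ (n : ℕ) P, constL (lexp ((n : ℂ) • D) P) = μ n P := fun n P => by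
    rw [hμ]; simp
  have hbim : ∀ b c P, constTerm (D (C b * P * C c)) = b * constTerm (D P) * c := by
    intro b c P
    refine first_order_eq hD hD constL
      (LinearMap.mulRight ℂ c ∘ₗ LinearMap.mulLeft ℂ b ∘ₗ constL) fun n => ?_
    rw [hμn, LinearMap.comp_apply, LinearMap.comp_apply, hμn, (h.cpBimodule _).bimodule]
    rfl
  -- First-order comparison with the zero operator, as `μ n 1 = 1` for all `n`.
  have h1 : constTerm (D 1) = 0 := by
    have := first_order_eq (W := NCPoly B) hD locNil_zero (constL (B := B)) constL
      (v := 1) (w := 1) fun n => by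
        rw [hμn, (h.cpBimodule _).unital, smul_zero, lexp_zero]; simp
    simpa using this
  have hgen : gen γ σ = D := by
    refine (isCoderivation_gen γ σ).eq hcod fun P => ?_
    have : constL ∘ₗ gen γ σ = constL ∘ₗ D := by
      refine bimodule_ext (fun b c P => ?_) hbim ?_ ?_ fun P => ?_
      · simp
      · exact (by simp : constTerm (gen γ σ 1) = 0).trans h1.symm
      · exact constTerm_gen_X γ σ
      · exact constTerm_gen_X_mul_X γ σ P
    exact LinearMap.congr_fun this P
  have hevo : ∀ t : ℝ≥0, μ t = evo γ σ (t : ℝ) := fun t => by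
    ext P
    rw [hμ, evo, hgen]
    rfl
  refine ⟨γ, σ, ?_, fun k P => ?_, hevo⟩
  · have hl := tendsto_inv_smul_evo γ σ (P := X) constTerm_X
    rw [constTerm_gen_X] at hl
    refine tendsto_nhds_unique ((continuous_star.tendsto γ).comp hl) (hl.congr fun n => ?_)
    rw [Function.comp_apply, ← hevo, star_smul, ← (h.cpBimodule _).cp.map_star, star_X]
    simp
  -- Complete positivity of the maps at time `1 / (n + 1)`, applied to the polynomials `X P i` and
  -- rescaled, converges to the positivity condition for `σ`.
  · have hl : ∀ i j, Filter.Tendsto (fun n : ℕ => ((((n : ℝ≥0) + 1 : ℝ≥0) : ℝ) : ℂ) •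
        evo γ σ ((((n : ℝ≥0) + 1)⁻¹ : ℝ≥0) : ℝ) (X * P i * star (X * P j))) Filter.atTop
        (nhds (σ (P i * star (P j)))) := fun i j => by
      have h2 : X * P i * star (X * P j) = X * (P i * star (P j)) * X := by
        rw [star_mul, star_X]; simp only [mul_assoc]
      rw [h2, ← constTerm_gen_X_mul_X γ σ]
      exact tendsto_inv_smul_evo γ σ (by simp)
    have hl2 : Filter.Tendsto (fun n : ℕ => ofMatL k fun i j =>
        ((((n : ℝ≥0) + 1 : ℝ≥0) : ℝ) : ℂ) •
        evo γ σ ((((n : ℝ≥0) + 1)⁻¹ : ℝ≥0) : ℝ) (X * P i * star (X * P j))) Filter.atTop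
        (nhds (ofMatL k fun i j => σ (P i * star (P j)))) :=
      ((ofMatL k).continuous.tendsto _).comp (tendsto_pi_nhds.2 fun i =>
        tendsto_pi_nhds.2 fun j => hl i j)
    refine matNonneg_iff.2 (ge_of_tendsto hl2 (Filter.Eventually.of_forall fun n => ?_))
    have h3 := (h.cpBimodule ((n : ℝ≥0) + 1)⁻¹).cp.smul ((n : ℝ≥0) + 1) k fun i => X * P i
    rw [hevo] at h3
    exact h3

end Semigroup

/-! ### Expansion of the generator on words -/

section Intervals

/-- The nonempty subsets of `S` that are intervals of `S`. -/
def intervals (S : Finset ℕ) : Finset (Finset ℕ) :=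
  S.powerset.filter fun V => V.Nonempty ∧ ∀ a ∈ V, ∀ c ∈ V, ∀ u ∈ S, a < u → u < c → u ∈ V

lemma mem_intervals {S V : Finset ℕ} : V ∈ intervals S ↔
    V ⊆ S ∧ V.Nonempty ∧ ∀ a ∈ V, ∀ c ∈ V, ∀ u ∈ S, a < u → u < c → u ∈ V := by
  rw [intervals, Finset.mem_filter, Finset.mem_powerset]

/-- For `v` below `S`, an interval avoiding `v` is an interval of `S`, and one containing `v` is the
initial segment ending at its maximum `c`. -/
lemma sum_intervals_insert {A : Type*} [AddCommMonoid A] {v : ℕ} {S : Finset ℕ}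
    (hv : ∀ u ∈ S, v < u) (f : Finset ℕ → A) :
    ∑ V ∈ intervals (insert v S), f V =
      ∑ V ∈ intervals S, f V + ∑ c ∈ insert v S, f ((insert v S).filter (· ≤ c)) := by
  have hvS : v ∉ S := fun h => lt_irrefl v (hv v h)
  have hle : ∀ u ∈ insert v S, v ≤ u := fun u hu => by
    rcases Finset.mem_insert.1 hu with rfl | hu
    · exact le_rfl
    · exact (hv u hu).le
  have hunion : intervals (insert v S) =
      intervals S ∪ (insert v S).image fun c => (insert v S).filter (· ≤ c) := by
    ext V
    rw [Finset.mem_union, Finset.mem_image, mem_intervals, mem_intervals]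
    constructor
    · rintro ⟨hVS, hne, hV⟩
      by_cases hvV : v ∈ V
      · right
        refine ⟨V.max' hne, hVS (V.max'_mem hne), ?_⟩
        ext u
        rw [Finset.mem_filter]
        constructor
        · rintro ⟨hu, hle'⟩
          rcases (hle u hu).eq_or_lt with rfl | h1
          · exact hvV
          · rcases hle'.eq_or_lt with rfl | h2
            · exact V.max'_mem hne
            · exact hV v hvV _ (V.max'_mem hne) u hu h1 h2
        · exact fun hu => ⟨hVS hu, V.le_max' u hu⟩
      · left
        refine ⟨fun u hu => ?_, hne, fun a ha c hc u hu => hV a ha c hc u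
          (Finset.mem_insert_of_mem hu)⟩
        rcases Finset.mem_insert.1 (hVS hu) with rfl | h
        · exact absurd hu hvV
        · exact h
    · rintro (⟨hVS, hne, hV⟩ | ⟨c, hc, rfl⟩)
      · refine ⟨hVS.trans (Finset.subset_insert _ _), hne, fun a ha c hc u hu h1 h2 => ?_⟩
        rcases Finset.mem_insert.1 hu with rfl | hu
        · exact absurd (hv a (hVS ha)) h1.not_gt
        · exact hV a ha c hc u hu h1 h2
      · refine ⟨Finset.filter_subset _ _, ⟨c, Finset.mem_filter.2 ⟨hc, le_rfl⟩⟩,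
          fun a _ d hd u hu _ h2 => Finset.mem_filter.2 ⟨hu, ?_⟩⟩
        exact h2.le.trans (Finset.mem_filter.1 hd).2
  have hdisj : Disjoint (intervals S)
      ((insert v S).image fun c => (insert v S).filter (· ≤ c)) := by
    rw [Finset.disjoint_left]
    intro V hV hV'
    obtain ⟨c, hc, rfl⟩ := Finset.mem_image.1 hV'
    exact hvS ((mem_intervals.1 hV).1 (Finset.mem_filter.2 ⟨Finset.mem_insert_self _ _, hle c hc⟩))
  have hinj : Set.InjOn (fun c => (insert v S).filter (· ≤ c)) (insert v S : Finset ℕ) := by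
    intro c hc d hd h
    refine le_antisymm ?_ ?_
    · have : c ∈ (insert v S).filter (· ≤ c) := Finset.mem_filter.2 ⟨hc, le_rfl⟩
      rw [show (insert v S).filter (· ≤ c) = (insert v S).filter (· ≤ d) from h] at this
      exact (Finset.mem_filter.1 this).2
    · have : d ∈ (insert v S).filter (· ≤ d) := Finset.mem_filter.2 ⟨hd, le_rfl⟩
      rw [← show (insert v S).filter (· ≤ c) = (insert v S).filter (· ≤ d) from h] at this
      exact (Finset.mem_filter.1 this).2
  rw [hunion, Finset.sum_union hdisj, Finset.sum_image hinj]

end Intervals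

/-! ### Successive removal of intervals from a word -/

section Cut

variable {B : Type*}

/-- Increasing positions. -/
abbrev PosSorted (L : List (ℕ × B)) : Prop := (L.map Prod.fst).Pairwise (· < ·)

/-- The set of positions. -/
def posn (L : List (ℕ × B)) : Finset ℕ := (L.map Prod.fst).toFinset

lemma mem_posn {L : List (ℕ × B)} {v : ℕ} : v ∈ posn L ↔ ∃ a ∈ L, a.1 = v := by
  simp [posn]

lemma posn_cons (a : ℕ × B) (L : List (ℕ × B)) : posn (a :: L) = insert a.1 (posn L) := by
  simp [posn]

lemma PosSorted.lt {a : ℕ × B} {L : List (ℕ × B)} (h : PosSorted (a :: L)) :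
    ∀ u ∈ posn L, a.1 < u := by
  intro u hu
  rw [PosSorted, List.map_cons, List.pairwise_cons] at h
  exact h.1 u (by simpa [posn] using hu)

lemma PosSorted.tail {a : ℕ × B} {L : List (ℕ × B)} (h : PosSorted (a :: L)) : PosSorted L := by
  rw [PosSorted, List.map_cons, List.pairwise_cons] at h
  exact h.2

/-- An interval that has been left is not entered again, so `takeWhile` and `dropWhile` separate it
from the letters after it. -/
lemma filter_eq_dropWhile {V : Finset ℕ} {a : ℕ × B} {L : List (ℕ × B)} (hL : PosSorted (a :: L))
    (hV : ∀ b ∈ V, ∀ c ∈ V, ∀ u ∈ posn (a :: L), b < u → u < c → u ∈ V) (ha : a.1 ∈ V) :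
    ∀ b ∈ (a :: L).dropWhile (·.1 ∈ V), b.1 ∉ V := by
  induction L generalizing a with
  | nil => simp [ha]
  | cons d L ih =>
    by_cases hd : d.1 ∈ V
    · have h1 : (a :: d :: L).dropWhile (·.1 ∈ V) = (d :: L).dropWhile (·.1 ∈ V) := by
        simp [ha]
      rw [h1]
      exact ih hL.tail (fun b hb c hc u hu => hV b hb c hc u
        (by rw [posn_cons]; exact Finset.mem_insert_of_mem hu)) hd
    · have h1 : (a :: d :: L).dropWhile (·.1 ∈ V) = d :: L := by simp [ha, hd]
      rw [h1]
      intro b hb hbV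
      rcases List.mem_cons.1 hb with rfl | hb
      · exact hd hbV
      · exact hd (hV _ ha _ hbV d.1 (by simp [posn]) (hL.lt _ (by simp [posn]))
          (hL.tail.lt _ (mem_posn.2 ⟨b, hb, rfl⟩)))

variable [CStarAlgebra B]

/-- The word `x X y₁ X y₂ ⋯` for a list of pairs (position, coefficient `yᵢ`). -/
def posWord (x : B) (L : List (ℕ × B)) : NCPoly B := word x (L.map Prod.snd)

lemma posWord_nil (x : B) : posWord x [] = C x := rfl

lemma posWord_cons (x : B) (a : ℕ × B) (L : List (ℕ × B)) :
    posWord x (a :: L) = C x * (X * posWord a.2 L) := word_cons _ _ _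

lemma C_mul_posWord (x y : B) (L : List (ℕ × B)) : C x * posWord y L = posWord (x * y) L :=
  C_mul_word _ _ _

/-- Removal of the factors at the positions in `V`, where the preceding coefficient is replaced by
the value of `f` on the removed subword. -/
def cut (f : NCPoly B → B) (V : Finset ℕ) : B → List (ℕ × B) → B × List (ℕ × B)
  | x, [] => (x, [])
  | x, a :: L =>
    if a.1 ∈ V then
      (f (posWord x ((a :: L).takeWhile (·.1 ∈ V))), (a :: L).dropWhile (·.1 ∈ V))
    else (x, (a.1, (cut f V a.2 L).1) :: (cut f V a.2 L).2)

lemma takeWhile_congr {α : Type*} {p q : α → Bool} {L : List α} (h : ∀ a ∈ L, p a = q a) :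
    L.takeWhile p = L.takeWhile q ∧ L.dropWhile p = L.dropWhile q := by
  induction L with
  | nil => simp
  | cons a L ih =>
    have h1 := h a (by simp)
    have h2 := ih fun b hb => h b (by simp [hb])
    simp only [List.takeWhile_cons, List.dropWhile_cons, h1, h2.1, h2.2, and_self]

/-- The free difference quotient of a word, contracted with a functional. -/
lemma contr_fdq_posWord {h : NCPoly B →ₗ[ℂ] B} (hh : ∀ P c, h (P * C c) = h P * c) (y : B)
    {L : List (ℕ × B)} (hL : PosSorted L) :
    contr (h ∘ₗ LinearMap.mulRight ℂ X) (fdq (posWord y L)) =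
      ∑ c ∈ posn L, posWord (h (posWord y (L.takeWhile (·.1 ≤ c)))) (L.dropWhile (·.1 ≤ c)) := by
  -- The functional varies because the prefix `C y * X` is absorbed into it at each step.
  induction L generalizing y h with
  | nil => simp [posWord, posn]
  | cons a L ih =>
    have hnot : a.1 ∉ posn L := fun h => lt_irrefl _ (hL.lt _ h)
    have h1 : contr (h ∘ₗ LinearMap.mulRight ℂ X)
        ((C y ⊗ₜ 1) * ((X ⊗ₜ 1) * fdq (posWord a.2 L))) =
        contr ((h ∘ₗ LinearMap.mulLeft ℂ (C y * X)) ∘ₗ LinearMap.mulRight ℂ X)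
          (fdq (posWord a.2 L)) := by
      generalize fdq (posWord a.2 L) = u
      induction u with
      | zero => simp
      | tmul p q => simp [mul_assoc]
      | add u v hu hv => simp only [mul_add, map_add, hu, hv]
    rw [posWord_cons, fdq_C_mul, fdq_X_mul, mul_add, map_add, h1,
      ih (h := h ∘ₗ LinearMap.mulLeft ℂ (C y * X))
        (fun P c => by simp only [LinearMap.comp_apply, LinearMap.mulLeft_apply, ← mul_assoc, hh])
        a.2 hL.tail, posn_cons, Finset.sum_insert hnot, add_comm]
    congr 1
    · have h2 : (L.takeWhile (·.1 ≤ a.1)) = [] ∧ L.dropWhile (·.1 ≤ a.1) = L := by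
        cases L with
        | nil => simp
        | cons d L =>
          have := hL.lt d.1 (by simp [posn])
          simp [this]
      simp only [List.takeWhile_cons, List.dropWhile_cons, le_refl, decide_true, if_true, h2,
        Algebra.TensorProduct.tmul_mul_tmul, mul_one, one_mul, contr_tmul, LinearMap.comp_apply,
        LinearMap.mulRight_apply]
      rw [C_mul_posWord, posWord_cons, posWord_nil, ← mul_assoc, hh]
    · refine Finset.sum_congr rfl fun c hc => ?_
      have hac := (hL.lt c hc).le
      simp only [List.takeWhile_cons, List.dropWhile_cons, hac, decide_true, if_true,
        LinearMap.comp_apply, LinearMap.mulLeft_apply]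
      rw [posWord_cons, mul_assoc]

/-- The generator on a word: a sum over the intervals of positions. -/
lemma gen_posWord (γ : B) (σ : NCPoly B →ₗ[ℂ] B) (x : B) {L : List (ℕ × B)} (hL : PosSorted L) :
    gen γ σ (posWord x L) = ∑ V ∈ intervals (posn L),
      posWord (cut (fun P => constTerm (gen γ σ P)) V x L).1
        (cut (fun P => constTerm (gen γ σ P)) V x L).2 := by
  set f : NCPoly B → B := fun P => constTerm (gen γ σ P) with hf
  induction L generalizing x with
  | nil =>
    have : intervals (posn ([] : List (ℕ × B))) = ∅ := by
      ext V
      rw [mem_intervals]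
      simp only [posn, List.map_nil, List.toFinset_nil, Finset.subset_empty, Finset.notMem_empty,
        iff_false, not_and]
      rintro rfl h
      exact absurd h Finset.not_nonempty_empty
    rw [this, posWord_nil, gen_C, Finset.sum_empty]
  | cons a L ih =>
    have hnot : a.1 ∉ posn L := fun h => lt_irrefl _ (hL.lt _ h)
    rw [posn_cons, sum_intervals_insert hL.lt, posWord_cons, gen_C_mul, gen_X_mul, mul_add,
      ih a.2 hL.tail]
    congr 1
    · rw [Finset.mul_sum, Finset.mul_sum]
      refine Finset.sum_congr rfl fun V hV => ?_
      have haV : a.1 ∉ V := fun h => hnot ((mem_intervals.1 hV).1 h)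
      rw [cut, if_neg haV, posWord_cons]
    -- The intervals that start at the first position: the single letter gives the term with `γ`,
    -- the longer ones are those whose last letter is marked by `fdq`, and give `σ`.
    · set h : NCPoly B →ₗ[ℂ] B :=
        constL ∘ₗ gen γ σ ∘ₗ LinearMap.mulLeft ℂ (C x * X) with hh
      have hC : ∀ P c, h (P * C c) = h P * c := fun P c => by
        simp only [hh, LinearMap.comp_apply, LinearMap.mulLeft_apply, ← mul_assoc, gen_mul_C]
        simp
      have hq := contr_fdq_posWord hC a.2 hL.tail
      have h1 : contr (h ∘ₗ LinearMap.mulRight ℂ X) (fdq (posWord a.2 L)) =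
          C x * contr σ (fdq (posWord a.2 L)) := by
        generalize fdq (posWord a.2 L) = u
        induction u with
        | zero => simp
        | tmul p q =>
          have : h (p * X) = x * σ p := by
            have e : C x * X * (p * X) = C x * (X * p * X) := by simp only [mul_assoc]
            simp only [hh, LinearMap.comp_apply, LinearMap.mulLeft_apply, e, gen_C_mul]
            simp [constTerm_gen_X_mul_X]
          simp [this, mul_assoc]
        | add u v hu hv => simp only [mul_add, map_add, hu, hv]
      rw [mul_add, ← h1, hq, Finset.sum_insert hnot]
      have hcut : ∀ c, a.1 ≤ c → cut f ((insert a.1 (posn L)).filter (· ≤ c)) x (a :: L) =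
          (f (posWord x ((a :: L).takeWhile (·.1 ≤ c))), (a :: L).dropWhile (·.1 ≤ c)) := by
        intro c hc
        have hmem : a.1 ∈ (insert a.1 (posn L)).filter (· ≤ c) :=
          Finset.mem_filter.2 ⟨Finset.mem_insert_self _ _, hc⟩
        rw [cut, if_pos hmem]
        have := takeWhile_congr (L := a :: L)
          (p := fun b => decide (b.1 ∈ (insert a.1 (posn L)).filter (· ≤ c)))
          (q := fun b => decide (b.1 ≤ c)) fun b hb => by
            have : b.1 ∈ insert a.1 (posn L) := by
              rw [← posn_cons]; exact mem_posn.2 ⟨b, hb, rfl⟩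
            simp [Finset.mem_filter, this]
        rw [this.1, this.2]
      congr 1
      · have h2 : (L.takeWhile (·.1 ≤ a.1)) = [] ∧ L.dropWhile (·.1 ≤ a.1) = L := by
          cases L with
          | nil => simp
          | cons d L =>
            have := hL.lt d.1 (by simp [posn])
            simp [this]
        rw [hcut _ le_rfl]
        simp only [List.takeWhile_cons, List.dropWhile_cons, le_refl, decide_true, if_true, h2]
        have h3 : f (posWord x [a]) = x * γ * a.2 := by
          have e : posWord x [a] = C x * X * C a.2 := by
            rw [posWord_cons, posWord_nil, mul_assoc]
          rw [e, hf]
          simp only [gen_mul_C, gen_C_mul, map_mul, constTerm_C, constTerm_gen_X]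
        rw [h3, ← C_mul_posWord, map_mul, mul_assoc]
      · refine Finset.sum_congr rfl fun c hc => ?_
        have hac := (hL.lt c hc).le
        rw [hcut _ hac]
        simp only [List.takeWhile_cons, List.dropWhile_cons, hac, decide_true, if_true]
        rw [posWord_cons, ← mul_assoc]
        rfl

lemma map_fst_cut (f : NCPoly B → B) {V : Finset ℕ} (x : B) {L : List (ℕ × B)}
    (hL : PosSorted L) (hV : ∀ b ∈ V, ∀ c ∈ V, ∀ u ∈ posn L, b < u → u < c → u ∈ V) :
    (cut f V x L).2.map Prod.fst = (L.map Prod.fst).filter (· ∉ V) := by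
  induction L generalizing x with
  | nil => simp [cut]
  | cons a L ih =>
    rw [cut]
    split_ifs with ha
    · have h1 := filter_eq_dropWhile hL hV ha
      have h2 : ∀ b ∈ (a :: L).takeWhile (·.1 ∈ V), b.1 ∈ V := fun b hb => by
        simpa using List.mem_takeWhile_imp hb
      conv_rhs => rw [← List.takeWhile_append_dropWhile (p := fun b : ℕ × B => b.1 ∈ V)
        (l := a :: L)]
      rw [List.map_append, List.filter_append, List.filter_eq_nil_iff.2, List.nil_append,
        List.filter_eq_self.2]
      · intro v hv
        obtain ⟨b, hb, rfl⟩ := List.mem_map.1 hv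
        simpa using h1 b hb
      · intro v hv
        obtain ⟨b, hb, rfl⟩ := List.mem_map.1 hv
        simpa using h2 b hb
    · rw [List.map_cons, ih a.2 hL.tail fun b hb c hc u hu => hV b hb c hc u
        (by rw [posn_cons]; exact Finset.mem_insert_of_mem hu), List.map_cons,
        List.filter_cons_of_pos (by simpa using ha)]

lemma posSorted_cut (f : NCPoly B → B) {V : Finset ℕ} (x : B) {L : List (ℕ × B)}
    (hL : PosSorted L) (hV : V ∈ intervals (posn L)) : PosSorted (cut f V x L).2 := by
  rw [PosSorted, map_fst_cut f x hL (mem_intervals.1 hV).2.2]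
  exact hL.filter _

lemma posn_cut (f : NCPoly B → B) {V : Finset ℕ} (x : B) {L : List (ℕ × B)}
    (hL : PosSorted L) (hV : V ∈ intervals (posn L)) : posn (cut f V x L).2 = posn L \ V := by
  rw [posn, map_fst_cut f x hL (mem_intervals.1 hV).2.2, List.toFinset_filter, posn,
    Finset.sdiff_eq_filter]
  simp

/-- The sequences `V₁, …, V_k` that exhaust `S`, where each `Vᵢ` is an interval of
`S \ (V₁ ∪ ⋯ ∪ V_{i-1})`. -/
def removals : ℕ → Finset ℕ → Finset (List (Finset ℕ))
  | 0, S => if S = ∅ then {[]} else ∅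
  | k + 1, S => (intervals S).biUnion fun V => (removals k (S \ V)).image (V :: ·)

lemma sum_removals_succ {A : Type*} [AddCommMonoid A] (k : ℕ) (S : Finset ℕ)
    (f : List (Finset ℕ) → A) :
    ∑ l ∈ removals (k + 1) S, f l = ∑ V ∈ intervals S, ∑ l ∈ removals k (S \ V), f (V :: l) := by
  rw [removals, Finset.sum_biUnion]
  · refine Finset.sum_congr rfl fun V _ => ?_
    rw [Finset.sum_image]
    intro l _ l' _ h
    exact List.tail_eq_of_cons_eq h
  · intro V _ W _ hVW
    rw [Function.onFun, Finset.disjoint_left]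
    intro l hl hl'
    obtain ⟨l1, _, rfl⟩ := Finset.mem_image.1 hl
    obtain ⟨l2, _, h⟩ := Finset.mem_image.1 hl'
    exact hVW (List.head_eq_of_cons_eq h).symm

/-- The value obtained by removing the blocks of a list one after the other. -/
def removalValue (f : NCPoly B → B) : List (Finset ℕ) → B → List (ℕ × B) → B
  | [], x, _ => x
  | V :: l, x, L => removalValue f l (cut f V x L).1 (cut f V x L).2

/-- Each factor of the power removes one interval. The final constant term discards every word with
letters left, so only exhausting sequences remain. -/
lemma constTerm_gen_pow_posWord (γ : B) (σ : NCPoly B →ₗ[ℂ] B) (k : ℕ) (x : B)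
    {L : List (ℕ × B)} (hL : PosSorted L) :
    constTerm ((gen γ σ ^ k) (posWord x L)) = ∑ l ∈ removals k (posn L),
      removalValue (fun P => constTerm (gen γ σ P)) l x L := by
  induction k generalizing x L with
  | zero =>
    rw [pow_zero, Module.End.one_apply, removals]
    cases L with
    | nil => simp [posn, posWord, removalValue]
    | cons a L =>
      have : posn (a :: L) ≠ ∅ := by rw [posn_cons]; exact Finset.insert_ne_empty _ _
      rw [if_neg this, posWord_cons]
      simp
  | succ k ih =>
    rw [pow_succ, Module.End.mul_apply, gen_posWord γ σ x hL, map_sum, map_sum, sum_removals_succ]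
    refine Finset.sum_congr rfl fun V hV => ?_
    rw [ih _ (posSorted_cut _ x hL hV), posn_cut _ x hL hV]
    rfl

end Cut

/-! ### Nested evaluations by a stack machine -/

section Stack

variable {B : Type*}

/-- The letters at the positions `i + 1, …, j`. -/
def letters (b : ℕ → B) (i j : ℕ) : List (ℕ × B) :=
  (List.range' (i + 1) (j - i)).map fun v => (v, b v)

lemma letters_append (b : ℕ → B) {i j k : ℕ} (hij : i ≤ j) (hjk : j ≤ k) :
    letters b i j ++ letters b j k = letters b i k := by
  obtain ⟨m, rfl⟩ := Nat.exists_eq_add_of_le hij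
  obtain ⟨n, rfl⟩ := Nat.exists_eq_add_of_le hjk
  rw [letters, letters, letters, ← List.map_append]
  congr 1
  have := List.range'_append (s := i + 1) (m := m) (n := n) (step := 1)
  rw [show i + m - i = m by omega, show i + m + n - (i + m) = n by omega,
    show i + m + n - i = m + n by omega, ← this]
  congr 2
  omega

lemma letters_succ (b : ℕ → B) {i j : ℕ} (hij : i < j) :
    letters b i j = (i + 1, b (i + 1)) :: letters b (i + 1) j := by
  rw [letters, letters, show j - i = (j - (i + 1)) + 1 by omega, List.range'_succ, List.map_cons]

lemma posSorted_letters (b : ℕ → B) (i j : ℕ) : PosSorted (letters b i j) := by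
  rw [PosSorted, letters, List.map_map]
  simpa [Function.comp_def] using List.pairwise_lt_range' (s := i + 1) (n := j - i)

lemma posn_letters (b : ℕ → B) (n : ℕ) : posn (letters b 0 n) = Finset.Icc 1 n := by
  ext v
  rw [posn, letters, List.map_map]
  simp [Function.comp_def, List.mem_range'_1]
  omega

lemma length_gapValues (E : ℕ → ℕ → B) (j : ℕ) (l : List ℕ) :
    (gapValues E j l).length = l.length := by
  induction l with
  | nil => rfl
  | cons v l ih =>
    cases l with
    | nil => rfl
    | cons w l => rw [gapValues, List.length_cons, ih]; rfl

variable [CStarAlgebra B]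

open Classical in
/-- One step of the evaluation of a word from right to left. The state consists of the coefficient
lists of the blocks that have been entered but not completed, and of the value of the part read
since then. -/
def stackStep (κ : NCPoly B → B) (blk : ℕ → Finset ℕ) (a : ℕ × B) (st : List (List B) × B) :
    List (List B) × B :=
  let g := a.2 * st.2 :: if ∀ v ∈ blk a.1, v ≤ a.1 then [] else st.1.headD []
  let s := if ∀ v ∈ blk a.1, v ≤ a.1 then st.1 else st.1.tail
  if ∀ v ∈ blk a.1, a.1 ≤ v then (s, κ (word 1 g)) else (g :: s, 1)

/-- The evaluation of a word from right to left. -/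
def stackRun (κ : NCPoly B → B) (blk : ℕ → Finset ℕ) (L : List (ℕ × B)) (st : List (List B) × B) :
    List (List B) × B :=
  L.foldr (stackStep κ blk) st

variable {κ : NCPoly B → B} {blk : ℕ → Finset ℕ}

lemma stackStep_congr {v : ℕ} {c d : B} {st st' : List (List B) × B} (h1 : st.1 = st'.1)
    (h2 : c * st.2 = d * st'.2) : stackStep κ blk (v, c) st = stackStep κ blk (v, d) st' := by
  simp only [stackStep, h1, h2]

lemma stackRun_append (L M : List (ℕ × B)) (st : List (List B) × B) :
    stackRun κ blk (L ++ M) st = stackRun κ blk L (stackRun κ blk M st) :=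
  List.foldr_append

lemma stackRun_cons (a : ℕ × B) (L : List (ℕ × B)) (st : List (List B) × B) :
    stackRun κ blk (a :: L) st = stackStep κ blk a (stackRun κ blk L st) := rfl

/-- Multiplication of the last entry of a list. -/
def mulLast (r : B) : List B → List B
  | [] => []
  | [b] => [b * r]
  | b :: c :: l => b :: mulLast r (c :: l)

lemma word_mulLast (r : B) (x y : B) (l : List B) :
    word x (mulLast r (y :: l)) = word x (y :: l) * C r := by
  induction l generalizing x y with
  | nil => simp [mulLast, word_cons, mul_assoc]
  | cons c l ih => rw [mulLast, word_cons, ih, word_cons x y]; simp only [mul_assoc]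

open Classical in
lemma stackRun_part {V : Finset ℕ} (hV : ∀ v ∈ V, blk v = V) {a : ℕ × B} {A : List (ℕ × B)}
    (hA : PosSorted (a :: A)) (hAV : posn (a :: A) ⊆ V)
    (hlt : ∀ v ∈ V, v ∉ posn (a :: A) → v < a.1) (s : List (List B)) (r : B) :
    stackRun κ blk (a :: A) (s, r) = if ∀ v ∈ V, a.1 ≤ v then
      (s, κ (word 1 (mulLast r ((a :: A).map Prod.snd)))) else
      (mulLast r ((a :: A).map Prod.snd) :: s, 1) := by
  have haV : blk a.1 = V := hV _ (hAV (by simp [posn]))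
  induction A generalizing a with
  | nil =>
    have hmax : ∀ v ∈ V, v ≤ a.1 := fun v hv => by
      by_cases h : v = a.1
      · exact h.le
      · exact (hlt v hv (by simpa [posn] using h)).le
    simp only [stackRun, List.foldr_cons, List.foldr_nil, stackStep, haV]
    simp only [if_pos hmax, List.map_cons, List.map_nil, mulLast]
  | cons d A ih =>
    have had : a.1 < d.1 := hA.lt _ (by simp [posn])
    have haV' : a.1 ∈ V := hAV (by simp [posn])
    have hdV : d.1 ∈ V := hAV (by simp [posn])
    have h1 := ih hA.tail (fun v hv => hAV (by rw [posn_cons]; exact Finset.mem_insert_of_mem hv))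
      (fun v hv hv' => by
        by_cases h : v = a.1
        · rwa [h]
        · refine (hlt v hv fun h' => ?_).trans had
          rw [posn_cons, Finset.mem_insert] at h'
          exact h'.elim h hv') (hV _ hdV)
    have hmin : ¬ ∀ v ∈ V, d.1 ≤ v := fun h => (h _ haV').not_gt had
    have hmax : ¬ ∀ v ∈ V, v ≤ a.1 := fun h => (h _ hdV).not_gt had
    rw [if_neg hmin] at h1
    rw [stackRun_cons, h1]
    simp only [stackStep, haV]
    simp only [if_neg hmax, List.headD_cons, List.tail_cons, mul_one, List.map_cons, mulLast]

lemma stackRun_block (hr : ∀ P c, κ (P * C c) = κ P * c) {V : Finset ℕ}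
    (hV : ∀ v ∈ V, blk v = V) {a : ℕ × B} {A : List (ℕ × B)}
    (hA : PosSorted (a :: A)) (hAV : posn (a :: A) = V) (s : List (List B)) (r : B) :
    stackRun κ blk (a :: A) (s, r) = (s, κ (posWord 1 (a :: A)) * r) := by
  rw [stackRun_part hV hA hAV.le (fun v hv hv' => absurd (hAV ▸ hv) hv'), if_pos, posWord,
    List.map_cons, word_mulLast, hr]
  intro v hv
  rw [← hAV, posn_cons] at hv
  rcases Finset.mem_insert.1 hv with rfl | hv
  · exact le_rfl
  · exact (hA.lt v hv).le

/-- A contiguous block leaves the stack unchanged and multiplies the current value by `κ` of the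
block, which is exactly the coefficient inserted by `cut`. The result of the machine is therefore
invariant under removals, in whatever order they are made. -/
lemma stackRun_cut (hl : ∀ b P, κ (C b * P) = b * κ P) (hr : ∀ P c, κ (P * C c) = κ P * c)
    {V : Finset ℕ} (hV : ∀ v ∈ V, blk v = V) (x : B) {L : List (ℕ × B)} (hL : PosSorted L)
    (hVL : V ∈ intervals (posn L)) (st : List (List B) × B) :
    (stackRun κ blk (cut κ V x L).2 st).1 = (stackRun κ blk L st).1 ∧
      (cut κ V x L).1 * (stackRun κ blk (cut κ V x L).2 st).2 = x * (stackRun κ blk L st).2 := by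
  induction L generalizing x with
  | nil => exact ⟨rfl, rfl⟩
  | cons a L ih =>
    obtain ⟨hsub, hne, hint⟩ := mem_intervals.1 hVL
    by_cases ha : a.1 ∈ V
    · have h1 := filter_eq_dropWhile hL hint ha
      rw [cut, if_pos ha]
      set R := (a :: L).dropWhile (·.1 ∈ V) with hR
      have h3 : (a :: L).takeWhile (·.1 ∈ V) = a :: L.takeWhile (·.1 ∈ V) := by simp [ha]
      have h4 : a :: L = (a :: L.takeWhile (·.1 ∈ V)) ++ R := by
        rw [← h3, hR, List.takeWhile_append_dropWhile]
      have h2 : ∀ b ∈ a :: L.takeWhile (·.1 ∈ V), b.1 ∈ V := fun b hb => by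
        rw [← h3] at hb
        simpa using List.mem_takeWhile_imp hb
      have hA : PosSorted (a :: L.takeWhile (·.1 ∈ V)) := by
        rw [h4] at hL
        rw [PosSorted, List.map_append, List.pairwise_append] at hL
        exact hL.1
      have hAV : posn (a :: L.takeWhile (·.1 ∈ V)) = V := by
        ext v
        rw [mem_posn]
        constructor
        · rintro ⟨b, hb, rfl⟩
          exact h2 b hb
        · intro hv
          obtain ⟨b, hb, rfl⟩ := mem_posn.1 (hsub hv)
          rw [h4, List.mem_append] at hb
          exact hb.elim (fun h => ⟨b, h, rfl⟩) fun h => absurd hv (h1 b h)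
      have h5 : stackRun κ blk (a :: L) st = ((stackRun κ blk R st).1,
          κ (posWord 1 (a :: L.takeWhile (·.1 ∈ V))) * (stackRun κ blk R st).2) := by
        conv_lhs => rw [h4]
        rw [stackRun_append, ← stackRun_block hr hV hA hAV]
      rw [h5, h3]
      refine ⟨rfl, ?_⟩
      have h6 := C_mul_posWord x 1 (a :: L.takeWhile (·.1 ∈ V))
      rw [mul_one] at h6
      rw [← h6, hl, mul_assoc]
    · rw [cut, if_neg ha]
      have := ih a.2 hL.tail (mem_intervals.2 ⟨fun v hv => ?_, hne, fun b hb c hc u hu =>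
        hint b hb c hc u (by rw [posn_cons]; exact Finset.mem_insert_of_mem hu)⟩)
      · have h := stackStep_congr (κ := κ) (blk := blk) (v := a.1) this.1 this.2
        rw [stackRun_cons, h, stackRun_cons]
        exact ⟨rfl, rfl⟩
      · have := hsub hv
        rw [posn_cons] at this
        exact (Finset.mem_insert.1 this).resolve_left fun h => ha (h ▸ hv)

lemma removalValue_eq (hl : ∀ b P, κ (C b * P) = b * κ P) (hr : ∀ P c, κ (P * C c) = κ P * c)
    {k : ℕ} (x : B) {L : List (ℕ × B)} (hL : PosSorted L) {l : List (Finset ℕ)}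
    (hlk : l ∈ removals k (posn L)) (hblk : ∀ V ∈ l, ∀ v ∈ V, blk v = V) :
    removalValue κ l x L = x * (stackRun κ blk L ([], 1)).2 := by
  induction k generalizing l x L with
  | zero =>
    rw [removals] at hlk
    split_ifs at hlk with h
    · rw [Finset.mem_singleton] at hlk
      subst hlk
      have : L = [] := by
        cases L with
        | nil => rfl
        | cons a L => rw [posn_cons] at h; exact absurd h (Finset.insert_ne_empty _ _)
      subst this
      simp [removalValue, stackRun]
    · simp at hlk
  | succ k ih =>
    rw [removals, Finset.mem_biUnion] at hlk
    obtain ⟨V, hV, hlk⟩ := hlk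
    obtain ⟨l', hl', rfl⟩ := Finset.mem_image.1 hlk
    rw [removalValue, ih _ (posSorted_cut κ x hL hV) (by rwa [posn_cut κ x hL hV])
      fun W hW => hblk W (List.mem_cons_of_mem _ hW)]
    exact (stackRun_cut hl hr (hblk V (List.mem_cons_self)) x hL hV _).2

lemma mono_eq_posWord (b : ℕ → B) (n : ℕ) : mono b n = posWord (b 0) (letters b 0 n) := by
  rw [mono, posWord, letters, List.map_map, List.range'_eq_map_range, List.map_map]
  congr 1
  refine List.map_congr_left fun i _ => ?_
  simp [add_comm]

/-- The set `{i + 1, …, j}` is a union of blocks. -/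
def BlockClosed (blk : ℕ → Finset ℕ) (i j : ℕ) : Prop :=
  ∀ v, i < v → v ≤ j → v ∈ blk v ∧ ∀ u ∈ blk v, i < u ∧ u ≤ j ∧ blk u = blk v

/-- Noncrossing systems of blocks. -/
def BlocksNonCrossing (blk : ℕ → Finset ℕ) : Prop :=
  ∀ u v, blk u ≠ blk v → ∀ i ∈ blk u, ∀ k ∈ blk u, ∀ j ∈ blk v, ∀ l ∈ blk v,
    i < j → j < k → ¬ k < l

lemma stackRun_letters_eq_step {b : ℕ → B} {v w : ℕ} {e : B} (hv : 0 < v) (hvw : v ≤ w)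
    {st : List (List B) × B}
    (h : ∃ r', stackRun κ blk (letters b v w) st = (st.1, r') ∧ b v * r' = e * st.2) :
    stackRun κ blk (letters b (v - 1) w) st = stackStep κ blk (v, e) st := by
  obtain ⟨r', h3, h4⟩ := h
  rw [letters_succ b (by omega), Nat.sub_add_cancel hv, stackRun_cons, h3]
  exact stackStep_congr rfl h4

/-- If every gap of the block acts on the machine as multiplication by its value `E`, the gaps can
be contracted into the coefficients of the block. The last two conditions in `hE` single out the
gaps. -/
lemma stackRun_letters_eq_zip {b : ℕ → B} {E : ℕ → ℕ → B} {j : ℕ} {v : ℕ} {l : List ℕ}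
    (hl : (v :: l).Pairwise (· < ·)) (hj : ∀ u ∈ v :: l, 0 < u ∧ u ≤ j)
    (hE : ∀ u w, u ∈ v :: l → u ≤ w → w ≤ j → (∀ t ∈ v :: l, t ≤ u ∨ w < t) →
      (w = j ∨ w + 1 ∈ v :: l) →
      ∀ s r, ∃ r', stackRun κ blk (letters b u w) (s, r) = (s, r') ∧ b u * r' = E u w * r)
    (st : List (List B) × B) :
    stackRun κ blk (letters b (v - 1) j) st =
      stackRun κ blk ((v :: l).zip (gapValues E j (v :: l))) st := by
  induction l generalizing v with
  | nil =>
    have hv := hj v (by simp)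
    rw [stackRun_letters_eq_step hv.1 hv.2
      (hE v j (by simp) hv.2 le_rfl (by simp) (Or.inl rfl) st.1 st.2)]
    rfl
  | cons w l ih =>
    rw [List.pairwise_cons] at hl
    have hvw : v < w := hl.1 w (by simp)
    have hw := hj w (by simp)
    have hv := hj v (by simp)
    rw [gapValues, List.zip_cons_cons, stackRun_cons, ← letters_append b (j := w - 1) (by omega)
      (by omega), stackRun_append, stackRun_letters_eq_step hv.1 (by omega)
      (hE v (w - 1) (by simp) (by omega) (by omega) ?_ (Or.inr ?_) _ _)]
    · congr 1
      refine ih hl.2 (fun u hu => hj u (List.mem_cons_of_mem _ hu)) fun u t hu hut htj h1 h2 =>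
        hE u t (List.mem_cons_of_mem _ hu) hut htj ?_ (h2.imp_right (List.mem_cons_of_mem _))
      intro t' ht'
      rcases List.mem_cons.1 ht' with rfl | ht'
      · exact Or.inl (hl.1 u hu).le
      · exact h1 t' ht'
    · intro t ht
      rcases List.mem_cons.1 ht with rfl | ht
      · exact Or.inl le_rfl
      · rcases List.mem_cons.1 ht with rfl | ht
        · right; omega
        · have := (List.pairwise_cons.1 hl.2).1 t ht
          right; omega
    · rw [Nat.sub_add_cancel (by omega)]
      simp

/-- The machine computes the nested evaluation. The coefficient `b i` precedes the first letter and
is not read by the machine, hence the factor `b i` in front of `r'`. -/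
lemma stackRun_letters (hl : ∀ b P, κ (C b * P) = b * κ P) (hr : ∀ P c, κ (P * C c) = κ P * c)
    (hnc : BlocksNonCrossing blk) (b : ℕ → B) (m : ℕ) {i j : ℕ} (hij : i ≤ j) (hm : j - i ≤ m)
    (hc : BlockClosed blk i j) (s : List (List B)) (r : B) :
    ∃ r', stackRun κ blk (letters b i j) (s, r) = (s, r') ∧
      b i * r' = nestedEval κ blk b m i j * r := by
  induction m generalizing i j s r with
  | zero =>
    obtain rfl : i = j := by omega
    exact ⟨r, by simp [letters, stackRun], rfl⟩
  | succ m ih =>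
    rw [nestedEval]
    split_ifs with h
    · subst h
      exact ⟨r, by simp [letters, stackRun], rfl⟩
    · obtain ⟨hi1, hi2⟩ := hc (i + 1) (by omega) (by omega)
      set V := blk (i + 1) with hV
      obtain ⟨v, l, hvl⟩ : ∃ v l, V.sort (· ≤ ·) = v :: l := by
        cases h : V.sort (· ≤ ·) with
        | nil =>
          have := (Finset.mem_sort (· ≤ ·)).2 hi1
          rw [h] at this
          simp at this
        | cons v l => exact ⟨v, l, rfl⟩
      have hmem : ∀ u, u ∈ v :: l ↔ u ∈ V := fun u => by rw [← hvl, Finset.mem_sort]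
      have hsort : (v :: l).Pairwise (· < ·) := by
        rw [← hvl]; exact (Finset.sortedLT_sort V).pairwise
      have hv : v = i + 1 := by
        rcases List.mem_cons.1 ((hmem _).2 hi1) with h | h
        · exact h.symm
        · have h1 := (List.pairwise_cons.1 hsort).1 _ h
          have h2 := (hi2 v ((hmem v).1 (by simp))).1
          omega
      set E := nestedEval κ blk b m with hE
      have key := stackRun_letters_eq_zip (κ := κ) (blk := blk) (b := b) (E := E) (j := j) hsort
        (fun u hu => by have := hi2 u ((hmem u).1 hu); omega) ?_ (s, r)
      · rw [hv, Nat.add_sub_cancel] at key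
        rw [hvl, key, ← hv]
        have hlen := length_gapValues E j (v :: l)
        cases hg : gapValues E j (v :: l) with
        | nil => rw [hg] at hlen; simp at hlen
        | cons e g =>
          rw [hg] at hlen
          have hfst : ((v :: l).zip (e :: g)).map Prod.fst = v :: l :=
            List.map_fst_zip hlen.ge
          have hsnd : ((v :: l).zip (e :: g)).map Prod.snd = e :: g :=
            List.map_snd_zip hlen.le
          rw [List.zip_cons_cons] at hfst hsnd ⊢
          rw [stackRun_block hr (V := V) (fun u hu => (hi2 u hu).2.2) (by rwa [PosSorted, hfst])
            (by ext u; rw [posn, hfst, List.mem_toFinset, hmem])]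
          refine ⟨_, rfl, ?_⟩
          rw [posWord, hsnd, ← mul_assoc, ← hl, C_mul_word, mul_one]
      -- Noncrossing is needed here: a block meeting a gap of `V` stays inside it, since leaving it
      -- on either side would cross `V`. So the gap is a union of blocks and the induction applies.
      · intro u w hu huw hwj hgap hend s r
        have hu' := hi2 u ((hmem u).1 hu)
        refine ih huw (by omega) ?_ s r
        intro t htu htw
        obtain ⟨h1, h2⟩ := hc t (by omega) (by omega)
        have htV : t ∉ V := fun h => by
          rcases hgap t ((hmem t).2 h) with h | h <;> omega
        have hne : V ≠ blk t := fun h => htV (h ▸ h1)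
        refine ⟨h1, fun t' ht' => ?_⟩
        have h3 := h2 t' ht'
        have ht'V : t' ∉ V := fun h => hne (by rw [← h3.2.2, (hi2 t' h).2.2])
        refine ⟨?_, ?_, h3.2.2⟩
        · by_contra hcon
          have hne1 : t' ≠ u := fun h => ht'V (h ▸ (hmem u).1 hu)
          have hne2 : t' ≠ i + 1 := fun h => ht'V (h ▸ hi1)
          exact hnc (i + 1) t hne (i + 1) hi1 u ((hmem u).1 hu) t' ht' t h1 (by omega) (by omega)
            (by omega)
        · rcases hend with rfl | hw
          · exact h3.2.1
          · by_contra hcon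
            have hne1 : t' ≠ w + 1 := fun h => ht'V (h ▸ (hmem _).1 hw)
            exact hnc (i + 1) t hne u ((hmem u).1 hu) (w + 1) ((hmem _).1 hw) t h1 t' ht'
              htu (by omega) (by omega)

end Stack

/-! ### Monotone labellings of noncrossing partitions -/

section Labellings

/-- `V` is disjoint from `U` and does not separate elements of `U`, so that `U` may be removed
before `V`. -/
def Removable (U V : Finset ℕ) : Prop :=
  Disjoint U V ∧ ∀ a ∈ U, ∀ c ∈ U, ∀ v ∈ V, a < v → ¬ v < c

/-- Being an interval of what is left amounts to a pairwise condition: no later block has a point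
strictly between two points of an earlier one. -/
lemma mem_removals {k : ℕ} {S : Finset ℕ} {l : List (Finset ℕ)} :
    l ∈ removals k S ↔ l.length = k ∧ (∀ V ∈ l, V.Nonempty) ∧ l.Pairwise Removable ∧
      ∀ v, v ∈ S ↔ ∃ V ∈ l, v ∈ V := by
  induction k generalizing S l with
  | zero =>
    rw [removals]
    constructor
    · intro h
      split_ifs at h with hS
      · rw [Finset.mem_singleton] at h
        subst h hS
        simp
      · simp at h
    · rintro ⟨h, -, -, hS⟩
      obtain rfl := List.eq_nil_of_length_eq_zero h
      rw [if_pos (Finset.eq_empty_of_forall_notMem fun v hv => by simpa using (hS v).1 hv)]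
      simp
  | succ k ih =>
    rw [removals, Finset.mem_biUnion]
    constructor
    · rintro ⟨V, hV, h⟩
      obtain ⟨l, hl, rfl⟩ := Finset.mem_image.1 h
      obtain ⟨h1, h2, h3, h4⟩ := ih.1 hl
      obtain ⟨hVS, hne, hint⟩ := mem_intervals.1 hV
      refine ⟨by rw [List.length_cons, h1], ?_, List.pairwise_cons.2 ⟨?_, h3⟩, fun v => ?_⟩
      · rintro W (_ | ⟨_, hW⟩)
        · exact hne
        · exact h2 W hW
      · intro W hW
        have hdis : ∀ v ∈ W, v ∈ S ∧ v ∉ V := fun v hv =>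
          Finset.mem_sdiff.1 ((h4 v).2 ⟨W, hW, hv⟩)
        exact ⟨Finset.disjoint_right.2 fun v hv => (hdis v hv).2, fun a ha c hc v hv hav hvc =>
          (hdis v hv).2 (hint a ha c hc v (hdis v hv).1 hav hvc)⟩
      · rw [List.exists_mem_cons_iff, ← h4, Finset.mem_sdiff]
        by_cases hv : v ∈ V
        · simp [hv, hVS hv]
        · simp [hv]
    · rintro ⟨h1, h2, h3, h4⟩
      cases l with
      | nil => simp at h1
      | cons V l =>
        rw [List.pairwise_cons] at h3
        refine ⟨V, mem_intervals.2 ⟨fun v hv => (h4 v).2 ⟨V, by simp, hv⟩, h2 V (by simp),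
          fun a ha c hc u hu hau huc => ?_⟩, Finset.mem_image.2 ⟨l, ih.2 ⟨by simpa using h1,
          fun W hW => h2 W (List.mem_cons_of_mem _ hW), h3.2, fun v => ?_⟩, rfl⟩⟩
        · obtain ⟨W, hW, huW⟩ := (h4 u).1 hu
          rcases List.mem_cons.1 hW with rfl | hW
          · exact huW
          · exact absurd huc ((h3.1 W hW).2 a ha c hc u huW hau)
        · rw [Finset.mem_sdiff, h4, List.exists_mem_cons_iff]
          constructor
          · rintro ⟨h | h, hv⟩
            · exact absurd h hv
            · exact h
          · rintro ⟨W, hW, hv⟩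
            exact ⟨Or.inr ⟨W, hW, hv⟩, Finset.disjoint_right.1 (h3.1 W hW).1 hv⟩

lemma nodup_of_mem_removals {k : ℕ} {S : Finset ℕ} {l : List (Finset ℕ)}
    (h : l ∈ removals k S) : l.Nodup := by
  obtain ⟨-, h2, h3, -⟩ := mem_removals.1 h
  refine h3.imp_of_mem fun {U V} hU _ hUV hne => ?_
  subst hne
  obtain ⟨v, hv⟩ := h2 U hU
  exact Finset.disjoint_left.1 hUV.1 hv hv

/-- The partition formed by the blocks of a list of removals. -/
lemma exists_parts_eq_toFinset {k n : ℕ} {l : List (Finset ℕ)}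
    (h : l ∈ removals k (Finset.Icc 1 n)) :
    ∃ π : Finpartition (Finset.Icc 1 n), π.parts = l.toFinset := by
  obtain ⟨-, h2, h3, h4⟩ := mem_removals.1 h
  refine ⟨⟨l.toFinset, ?_, ?_, ?_⟩, rfl⟩
  · rw [Finset.supIndep_iff_pairwiseDisjoint]
    intro U hU V hV hUV
    rw [Finset.mem_coe, List.mem_toFinset] at hU hV
    have := h3.imp (S := Disjoint) fun h => h.1
    exact this.forall hU hV hUV
  · ext v
    rw [h4]
    simp
  · intro hbot
    rw [List.mem_toFinset] at hbot
    exact (h2 _ hbot).ne_empty rfl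

variable {n : ℕ} {π : Finpartition (Finset.Icc 1 n)}

lemma isNonCrossing_of_mem_removals {k : ℕ} {l : List (Finset ℕ)}
    (h : l ∈ removals k (Finset.Icc 1 n)) (hl : l.toFinset = π.parts) : IsNonCrossing π := by
  obtain ⟨-, -, h3, -⟩ := mem_removals.1 h
  rintro U hU V hV hUV ⟨i, hi, j, hj, k, hk, m, hm, hij, hjk, hkm⟩
  rw [← hl, List.mem_toFinset] at hU hV
  have hor : l.Pairwise fun U V => Removable U V ∨ Removable V U := h3.imp Or.inl
  have : Std.Symm fun U V => Removable U V ∨ Removable V U := ⟨fun _ _ => Or.symm⟩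
  rcases hor.forall hU hV hUV with h | h
  · exact h.2 i hi k hk j hj hij hjk
  · exact h.2 j hj m hm k hk hjk hkm

/-- Without crossings, a block with one point between two points of `U` lies entirely between them.
-/
lemma removable_iff_not_covers (hπ : IsNonCrossing π) {U V : Finset ℕ} (hU : U ∈ π.parts)
    (hV : V ∈ π.parts) (hUV : U ≠ V) : Removable U V ↔ ¬ Covers U V := by
  have hdis : Disjoint U V := π.disjoint hU hV hUV
  constructor
  · rintro ⟨-, h⟩ ⟨i, hi, j, hj, hij⟩
    obtain ⟨v, hv⟩ := π.nonempty_of_mem_parts hV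
    exact h i hi j hj v hv (hij v hv).1 (hij v hv).2
  · refine fun h => ⟨hdis, fun a ha c hc v hv hav hvc => h ⟨a, ha, c, hc, fun w hw => ?_⟩⟩
    have hwa : w ≠ a := fun e => Finset.disjoint_left.1 hdis ha (e ▸ hw)
    have hwc : w ≠ c := fun e => Finset.disjoint_left.1 hdis hc (e ▸ hw)
    constructor
    · by_contra hcon
      exact hπ V hV U hU hUV.symm ⟨w, hw, a, ha, v, hv, c, hc, by omega, hav, hvc⟩
    · by_contra hcon
      exact hπ U hU V hV hUV ⟨a, ha, v, hv, c, hc, w, hw, hav, hvc, by omega⟩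

/-- Covered blocks carry larger labels and have to be removed earlier, so a removal sequence lists
the blocks by decreasing label. -/
lemma card_removals (hπ : IsNonCrossing π) :
    ((removals π.parts.card (Finset.Icc 1 n)).filter fun l => l.toFinset = π.parts).card =
      numOrders π := by
  have hmem : ∀ l : List (Finset ℕ),
      l ∈ (removals π.parts.card (Finset.Icc 1 n)).filter (fun l => l.toFinset = π.parts) ↔
        l ∈ removals π.parts.card (Finset.Icc 1 n) ∧ l.toFinset = π.parts :=
    fun l => Finset.mem_filter
  rw [numOrders, ← Nat.subtype_card _ hmem]
  symm
  -- The use of `Fin.rev` reverses the order of the labels.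
  have hF : ∀ f : π.parts ≃ Fin π.parts.card,
      (∀ U V : π.parts, Covers (U : Finset ℕ) (V : Finset ℕ) → f U < f V) →
      (List.ofFn fun i => (f.symm i.rev : Finset ℕ)) ∈ removals π.parts.card (Finset.Icc 1 n) ∧
        (List.ofFn fun i => (f.symm i.rev : Finset ℕ)).toFinset = π.parts := by
    intro f hf
    have hm : ∀ V, V ∈ (List.ofFn fun i => (f.symm i.rev : Finset ℕ)) ↔ V ∈ π.parts := by
      intro V
      rw [List.mem_ofFn]
      constructor
      · rintro ⟨i, rfl⟩
        exact (f.symm i.rev).2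
      · intro hV
        exact ⟨(f ⟨V, hV⟩).rev, by simp⟩
    refine ⟨mem_removals.2 ⟨by simp, fun V hV => π.nonempty_of_mem_parts ((hm V).1 hV), ?_,
      fun v => ?_⟩, by ext V; rw [List.mem_toFinset, hm]⟩
    · rw [List.pairwise_ofFn]
      intro i j hij
      have hne : f.symm i.rev ≠ f.symm j.rev := fun h =>
        hij.ne (Fin.rev_injective (f.symm.injective h))
      rw [removable_iff_not_covers hπ (f.symm i.rev).2 (f.symm j.rev).2
        fun h => hne (Subtype.ext h)]
      intro hcov
      have := hf _ _ hcov
      rw [Equiv.apply_symm_apply, Equiv.apply_symm_apply, Fin.rev_lt_rev] at this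
      exact lt_asymm this hij
    · simp only [hm]
      exact ⟨fun hv => π.exists_mem hv, fun ⟨V, hV, hv⟩ => π.le hV hv⟩
  refine Nat.card_eq_of_bijective (fun f => ⟨_, hF f.1 f.2⟩) ⟨fun f g hfg => ?_, fun l => ?_⟩
  · have h1 := List.ofFn_injective (congrArg Subtype.val hfg)
    refine Subtype.ext (Equiv.symm_bijective.injective (Equiv.ext fun i => Subtype.ext ?_))
    simpa using congrFun h1 i.rev
  · obtain ⟨l, hl, hlπ⟩ := l
    have hnd := nodup_of_mem_removals hl
    obtain ⟨hlen, -, h3, -⟩ := mem_removals.1 hl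
    have hlt : ∀ i : Fin π.parts.card, (i : ℕ) < l.length := fun i => by rw [hlen]; exact i.2
    have hlm : ∀ i : Fin π.parts.card, l[(i : ℕ)]'(hlt i) ∈ π.parts := fun i =>
      hlπ.le (List.mem_toFinset.2 (List.getElem_mem _))
    let g : Fin π.parts.card → π.parts := fun i => ⟨l[(i.rev : ℕ)]'(hlt i.rev), hlm i.rev⟩
    have hg : Function.Bijective g := by
      rw [Fintype.bijective_iff_injective_and_card]
      refine ⟨fun i j hij => ?_, by simp⟩
      have := (hnd.getElem_inj_iff).1 (congrArg Subtype.val hij)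
      exact Fin.rev_injective (Fin.ext this)
    refine ⟨⟨(Equiv.ofBijective g hg).symm, fun U V hUV => ?_⟩, Subtype.ext ?_⟩
    · obtain ⟨i, rfl⟩ := hg.2 U
      obtain ⟨j, rfl⟩ := hg.2 V
      rw [Equiv.ofBijective_symm_apply_apply, Equiv.ofBijective_symm_apply_apply]
      rcases lt_trichotomy i j with h | h | h
      · exact h
      · subst h
        obtain ⟨a, ha, c, hc, hac⟩ := hUV
        exact absurd (hac a ha).1 (lt_irrefl _)
      · have h4 := List.pairwise_iff_getElem.1 h3 i.rev j.rev (hlt i.rev) (hlt j.rev)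
          (Fin.rev_lt_rev.2 h)
        exact absurd hUV ((removable_iff_not_covers hπ (hlm _) (hlm _) fun e =>
          h.ne (hg.1 (Subtype.ext e)).symm).1 h4)
    · refine List.ext_getElem (by simp [hlen]) fun i h1 h2 => ?_
      have h3 : π.parts.card - (π.parts.card - (i + 1) + 1) = i := by
        rw [hlen] at h2
        omega
      simp [g, h3]

end Labellings

/-! ### Powers of the generator as sums over noncrossing partitions -/

section Evaluation

variable {B : Type*} [CStarAlgebra B] {n : ℕ} {π : Finpartition (Finset.Icc 1 n)}

lemma blocksNonCrossing_part (hπ : IsNonCrossing π) : BlocksNonCrossing π.part := by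
  intro u v huv i hi k hk j hj l hl h1 h2 h3
  have hmem : ∀ u i, i ∈ π.part u → π.part u ∈ π.parts := fun u i hi => by
    rw [π.part_mem, ← π.part_nonempty]; exact ⟨i, hi⟩
  exact hπ _ (hmem u i hi) _ (hmem v j hj) huv ⟨i, hi, j, hj, k, hk, l, hl, h1, h2, h3⟩

lemma blockClosed_part : BlockClosed π.part 0 n := by
  intro v hv hvn
  have hvS : v ∈ Finset.Icc 1 n := Finset.mem_Icc.2 ⟨hv, hvn⟩
  refine ⟨π.mem_part hvS, fun u hu => ?_⟩
  have := Finset.mem_Icc.1 (π.part_subset v hu)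
  exact ⟨by omega, this.2, π.part_eq_of_mem (π.part_mem.2 hvS) hu⟩

lemma removalValue_eq_nestedEval {κ : NCPoly B → B} (hl : ∀ b P, κ (C b * P) = b * κ P)
    (hr : ∀ P c, κ (P * C c) = κ P * c) (b : ℕ → B) {k : ℕ} {l : List (Finset ℕ)}
    (h : l ∈ removals k (Finset.Icc 1 n)) (hlπ : l.toFinset = π.parts) :
    removalValue κ l (b 0) (letters b 0 n) = nestedEval κ π.part b n 0 n := by
  have hπ := isNonCrossing_of_mem_removals h hlπ
  rw [removalValue_eq hl hr (b 0) (posSorted_letters b 0 n) (by rwa [posn_letters])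
    (blk := π.part) fun V hV v hv => π.part_eq_of_mem (by rwa [← hlπ, List.mem_toFinset]) hv]
  obtain ⟨r, h1, h2⟩ := stackRun_letters hl hr (blocksNonCrossing_part hπ) b n (Nat.zero_le n)
    le_rfl blockClosed_part [] 1
  rw [h1, h2, mul_one]

-- Removal sequences are grouped by the partition they form. All sequences in a group give the same
-- nested evaluation, their number is `numOrders π`, and the group is empty unless `π` is
-- noncrossing with `k` blocks.
open Classical in
lemma constTerm_gen_pow_mono (γ : B) (σ : NCPoly B →ₗ[ℂ] B) (k : ℕ) (b : ℕ → B) (n : ℕ) :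
    constTerm ((gen γ σ ^ k) (mono b n)) =
      ∑ π ∈ (Finset.univ : Finset (Finpartition (Finset.Icc 1 n))).filter IsNonCrossing,
        if π.parts.card = k then (numOrders π : ℂ) •
          nestedEval (fun P => constTerm (gen γ σ P)) π.part b n 0 n else 0 := by
  set κ : NCPoly B → B := fun P => constTerm (gen γ σ P) with hκ
  have hl : ∀ b P, κ (C b * P) = b * κ P := fun b P => by simp [hκ, gen_C_mul]
  have hr : ∀ P c, κ (P * C c) = κ P * c := fun P c => by simp [hκ, gen_mul_C]
  rw [mono_eq_posWord, constTerm_gen_pow_posWord _ _ _ _ (posSorted_letters b 0 n), posn_letters,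
    ← Finset.sum_fiberwise_of_maps_to (g := List.toFinset)
      (t := (Finset.univ : Finset (Finpartition (Finset.Icc 1 n))).image fun π => π.parts)
      (fun l hl => by
        obtain ⟨π, hπ⟩ := exists_parts_eq_toFinset hl
        exact Finset.mem_image.2 ⟨π, Finset.mem_univ _, hπ⟩),
    Finset.sum_image fun π _ π' _ h => Finpartition.ext h, Finset.sum_filter]
  refine Finset.sum_congr rfl fun π _ => ?_
  rw [Finset.sum_congr rfl fun l hlm => removalValue_eq_nestedEval hl hr b
    (Finset.mem_filter.1 hlm).1 (Finset.mem_filter.1 hlm).2, Finset.sum_const]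
  have hzero : (¬ IsNonCrossing π ∨ π.parts.card ≠ k) →
      ((removals k (Finset.Icc 1 n)).filter fun l => l.toFinset = π.parts) = ∅ := by
    intro h
    refine Finset.eq_empty_of_forall_notMem fun l hlm => ?_
    obtain ⟨h1, h2⟩ := Finset.mem_filter.1 hlm
    rcases h with h | h
    · exact h (isNonCrossing_of_mem_removals h1 h2)
    · rw [← h2, List.toFinset_card_of_nodup (nodup_of_mem_removals h1)] at h
      exact h (mem_removals.1 h1).1
  by_cases hπ : IsNonCrossing π
  · rw [if_pos hπ]
    split_ifs with hk
    · subst hk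
      rw [card_removals hπ, Nat.cast_smul_eq_nsmul]
    · rw [hzero (Or.inr hk), Finset.card_empty, zero_smul]
  · rw [if_neg hπ, hzero (Or.inl hπ), Finset.card_empty, zero_smul]

open Classical in
lemma evo_one_mono (γ : B) (σ : NCPoly B →ₗ[ℂ] B) (b : ℕ → B) (n : ℕ) :
    evo γ σ 1 (mono b n) =
      ∑ π ∈ (Finset.univ : Finset (Finpartition (Finset.Icc 1 n))).filter IsNonCrossing,
        ((numOrders π : ℂ) / (π.parts.card ! : ℂ)) •
          nestedEval (fun P => constTerm (gen γ σ P)) π.part b n 0 n := by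
  obtain ⟨N, hN⟩ := locNil_gen γ σ (mono b n)
  -- The bound `n + 1` guarantees that every possible number of blocks occurs in the truncated
  -- exponential.
  have hN' := pow_apply_eq_zero_of_le hN (le_max_left N (n + 1))
  rw [evo, LinearMap.comp_apply, lexp_smul_apply (locNil_gen γ σ) 1 hN', map_sum]
  have : ∀ k, constL ((((1 : ℂ) ^ k) / (k ! : ℂ)) • (gen γ σ ^ k) (mono b n)) =
      ∑ π ∈ (Finset.univ : Finset (Finpartition (Finset.Icc 1 n))).filter IsNonCrossing,
        if π.parts.card = k then ((numOrders π : ℂ) / (π.parts.card ! : ℂ)) •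
          nestedEval (fun P => constTerm (gen γ σ P)) π.part b n 0 n else 0 := by
    intro k
    rw [map_smul, AlgHom.toLinearMap_apply, constTerm_gen_pow_mono, Finset.smul_sum]
    refine Finset.sum_congr rfl fun π _ => ?_
    split_ifs with h
    · rw [smul_smul, h, one_pow, div_mul_eq_mul_div, one_mul]
    · rw [smul_zero]
  rw [Finset.sum_congr rfl fun k _ => this k, Finset.sum_comm]
  refine Finset.sum_congr rfl fun π _ => ?_
  rw [Finset.sum_ite_eq, if_pos]
  have := π.card_parts_le_card
  rw [Nat.card_Icc] at this
  rw [Finset.mem_range]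
  omega

end Evaluation

/-! ### Monotone cumulants and the correspondence -/

section Correspondence

variable {B : Type*} [CStarAlgebra B]

lemma coe_dropConst (P : NCPoly B) : (dropConst P : NCPoly B) = P - C (constTerm P) := rfl

lemma dropConst_coe (P : ConstFree B) : dropConst (P : NCPoly B) = P :=
  Subtype.ext (by rw [coe_dropConst, mem_constFree.1 P.2, map_zero, sub_zero])

/-- The bimodule map on `B₀⟨X⟩` attached to `(γ, σ)`. -/
def cumulant (γ : B) (σ : NCPoly B →ₗ[ℂ] B) : ConstFree B →ₗ[ℂ] B :=
  constL ∘ₗ gen γ σ ∘ₗ (ConstFree B).subtype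

lemma cumulant_apply (γ : B) (σ : NCPoly B →ₗ[ℂ] B) (P : ConstFree B) :
    cumulant γ σ P = constTerm (gen γ σ P) := rfl

lemma cumulant_dropConst (γ : B) (σ : NCPoly B →ₗ[ℂ] B) (P : NCPoly B) :
    cumulant γ σ (dropConst P) = constTerm (gen γ σ P) := by
  rw [cumulant_apply, coe_dropConst, map_sub, gen_C, sub_zero]

/-- Bimodule maps on `B₀⟨X⟩` are determined by their values on `X` and on the `X P X`. -/
lemma eq_cumulant {K : ConstFree B →ₗ[ℂ] B} (hK : ∀ (b c : B) (P : ConstFree B),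
    K ⟨C b * (P : NCPoly B) * C c, C_mul_mul_C_mem b c P⟩ = b * K P * c) {γ : B}
    {σ : NCPoly B →ₗ[ℂ] B} (hX : K ⟨X, X_mem⟩ = γ)
    (hXX : ∀ P : NCPoly B, K ⟨X * P * X, X_mul_mul_X_mem P⟩ = σ P) : K = cumulant γ σ := by
  have h : K ∘ₗ dropConst = constL ∘ₗ gen γ σ := by
    refine bimodule_ext (fun b c P => ?_) (fun b c P => ?_) ?_ ?_ fun P => ?_
    · simp only [LinearMap.comp_apply, ← hK]
      congr 1
      refine Subtype.ext ?_
      simp only [coe_dropConst, map_mul, constTerm_C]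
      simp only [mul_sub, sub_mul, mul_assoc]
    · simp [gen_C_mul, gen_mul_C]
    · have : dropConst (1 : NCPoly B) = 0 := Subtype.ext (by simp [coe_dropConst])
      simp [this]
    · have := dropConst_coe ⟨X, X_mem (B := B)⟩
      rw [LinearMap.comp_apply, LinearMap.comp_apply, this, hX, AlgHom.toLinearMap_apply,
        constTerm_gen_X]
    · have := dropConst_coe ⟨X * P * X, X_mul_mul_X_mem P⟩
      rw [LinearMap.comp_apply, LinearMap.comp_apply, this, hXX, AlgHom.toLinearMap_apply,
        constTerm_gen_X_mul_X]
  ext P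
  have := LinearMap.congr_fun h P
  rwa [LinearMap.comp_apply, dropConst_coe] at this

lemma cumulant_bimodule (γ : B) (σ : NCPoly B →ₗ[ℂ] B) (b c : B) (P : ConstFree B) :
    cumulant γ σ ⟨C b * (P : NCPoly B) * C c, C_mul_mul_C_mem b c P⟩ = b * cumulant γ σ P * c := by
  simp [cumulant_apply, gen_C_mul, gen_mul_C]

lemma cumulant_X (γ : B) (σ : NCPoly B →ₗ[ℂ] B) : cumulant γ σ ⟨X, X_mem⟩ = γ :=
  constTerm_gen_X γ σ

lemma cumulant_X_mul_X (γ : B) (σ : NCPoly B →ₗ[ℂ] B) (P : NCPoly B) :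
    cumulant γ σ ⟨X * P * X, X_mul_mul_X_mem P⟩ = σ P :=
  constTerm_gen_X_mul_X γ σ P

lemma partitionedEval_cumulant (γ : B) (σ : NCPoly B →ₗ[ℂ] B) {n : ℕ}
    (π : Finpartition (Finset.Icc 1 n)) (b : ℕ → B) : partitionedEval (cumulant γ σ) π b =
      nestedEval (fun P => constTerm (gen γ σ P)) π.part b n 0 n := by
  rw [partitionedEval]
  congr 1
  funext P
  exact cumulant_dropConst γ σ P

/-- The moment-cumulant formula is the expansion of the exponential on monomials, and monomials
span. -/
lemma isMonotoneCumulant_cumulant_iff {γ : B} {σ ν : NCPoly B →ₗ[ℂ] B} :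
    IsMonotoneCumulant ν (cumulant γ σ) ↔ ν = evo γ σ 1 := by
  constructor
  · intro h
    refine linearMap_ext_mono fun n b => ?_
    rw [h.moment_cumulant, evo_one_mono]
    simp only [partitionedEval_cumulant]
  · rintro rfl
    refine ⟨cumulant_bimodule γ σ, fun n b => ?_⟩
    rw [evo_one_mono]
    simp only [partitionedEval_cumulant]

lemma isMonotoneNu_iff {γ : B} {σ ν : NCPoly B →ₗ[ℂ] B} :
    IsMonotoneNu γ σ ν ↔ ν = evo γ σ 1 := by
  constructor
  · rintro ⟨K, hK, hX, hXX⟩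
    rw [eq_cumulant hK.bimodule hX hXX] at hK
    exact isMonotoneCumulant_cumulant_iff.1 hK
  · exact fun h => ⟨cumulant γ σ, isMonotoneCumulant_cumulant_iff.2 h, cumulant_X γ σ,
      cumulant_X_mul_X γ σ⟩

lemma gen_eq_of_evo_one_eq {γ γ' : B} {σ σ' : NCPoly B →ₗ[ℂ] B}
    (h : evo γ' σ' 1 = evo γ σ 1) : gen γ' σ' = gen γ σ := by
  have h1 := congrArg convOp h
  rw [convOp_evo, convOp_evo, one_smul, one_smul] at h1
  exact lexp_injective (locNil_gen γ' σ') (locNil_gen γ σ) h1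

/-- The map at time `1` determines its operator, the operator its logarithm, and the constant terms
of the logarithm the pair. -/
lemma eq_of_evo_one_eq {γ γ' : B} {σ σ' : NCPoly B →ₗ[ℂ] B}
    (h : evo γ' σ' 1 = evo γ σ 1) : γ' = γ ∧ σ' = σ := by
  have h1 := gen_eq_of_evo_one_eq h
  refine ⟨?_, LinearMap.ext fun P => ?_⟩
  · rw [← constTerm_gen_X γ' σ', h1, constTerm_gen_X]
  · rw [← constTerm_gen_X_mul_X γ' σ', h1, constTerm_gen_X_mul_X]

/-- The linear map `P ↦ K[X P X]`. -/
def sandwich (K : ConstFree B →ₗ[ℂ] B) : NCPoly B →ₗ[ℂ] B :=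
  K ∘ₗ dropConst ∘ₗ LinearMap.mulRight ℂ X ∘ₗ LinearMap.mulLeft ℂ X

lemma sandwich_apply (K : ConstFree B →ₗ[ℂ] B) (P : NCPoly B) :
    K ⟨X * P * X, X_mul_mul_X_mem P⟩ = sandwich K P :=
  (congrArg K (dropConst_coe ⟨X * P * X, X_mul_mul_X_mem P⟩)).symm

/-- Any cumulant functional is the one attached to the pair `K[X]`, `P ↦ K[X P X]`, and the map
determines that pair. -/
lemma IsMonotoneCumulant.unique {γ : B} {σ : NCPoly B →ₗ[ℂ] B} {K : ConstFree B →ₗ[ℂ] B}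
    (h : IsMonotoneCumulant (evo γ σ 1) K) : K = cumulant γ σ := by
  have h1 := eq_cumulant h.bimodule rfl (sandwich_apply K)
  rw [h1] at h
  have h2 := eq_of_evo_one_eq (isMonotoneCumulant_cumulant_iff.1 h)
  rw [h1, ← h2.1, ← h2.2]

lemma isMonotoneNu_smul_iff {γ : B} {σ ν : NCPoly B →ₗ[ℂ] B} {z : ℂ} :
    IsMonotoneNu (z • γ) (z • σ) ν ↔ ν = evo γ σ z := by
  rw [isMonotoneNu_iff, evo_smul]

lemma hasDerivWithinAt_evo (γ : B) (σ : NCPoly B →ₗ[ℂ] B) (P : NCPoly B) :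
    HasDerivWithinAt (fun t : ℝ => evo γ σ (((t.toNNReal : ℝ≥0) : ℝ) : ℂ) P)
      (constTerm (gen γ σ P)) (Set.Ici 0) 0 := by
  have h1 : HasDerivAt (fun t : ℝ => evo γ σ (t : ℂ) P) (constTerm (gen γ σ P)) 0 := by
    have h2 : HasDerivAt (fun z => evo γ σ z P) (constTerm (gen γ σ P)) ((0 : ℝ) : ℂ) := by
      simpa using hasDerivAt_evo γ σ P
    simpa [Function.comp_def] using h2.scomp (0 : ℝ) Complex.ofRealCLM.hasDerivAt
  refine h1.hasDerivWithinAt.congr (fun t ht => ?_) ?_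
  · rw [Real.coe_toNNReal t ht]
  · simp

end Correspondence

theorem mainTheorem7 {B : Type*} [CStarAlgebra B] [PartialOrder B] [StarOrderedRing B] :
    -- every pair `(γ, σ)` determines the family `ν_▷^{tγ,tσ}`, which is a semigroup
    (∀ (γ : B) (σ : NCPoly B →ₗ[ℂ] B), IsSelfAdjoint γ → IsCP σ →
      (∀ t : ℝ≥0, ∃! ν : NCPoly B →ₗ[ℂ] B,
        IsMonotoneNu (((t : ℝ) : ℂ) • γ) (((t : ℝ) : ℂ) • σ) ν) ∧
      ∀ μ : ℝ≥0 → (NCPoly B →ₗ[ℂ] B),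
        (∀ t : ℝ≥0, IsMonotoneNu (((t : ℝ) : ℂ) • γ) (((t : ℝ) : ℂ) • σ) (μ t)) →
        IsMonotoneSemigroup μ) ∧
    -- every semigroup is of this form for exactly one pair, given by the derivatives at `0` of the
    -- moments and by the monotone cumulants of `μ 1`
    (∀ μ : ℝ≥0 → (NCPoly B →ₗ[ℂ] B), IsMonotoneSemigroup μ →
      ∃ (γ : B) (σ : NCPoly B →ₗ[ℂ] B),
        IsSelfAdjoint γ ∧ IsCP σ ∧
        (∀ t : ℝ≥0, IsMonotoneNu (((t : ℝ) : ℂ) • γ) (((t : ℝ) : ℂ) • σ) (μ t)) ∧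
        (∀ (γ' : B) (σ' : NCPoly B →ₗ[ℂ] B), IsSelfAdjoint γ' → IsCP σ' →
          (∀ t : ℝ≥0, IsMonotoneNu (((t : ℝ) : ℂ) • γ') (((t : ℝ) : ℂ) • σ') (μ t)) →
          γ' = γ ∧ σ' = σ) ∧
        HasDerivWithinAt (fun t : ℝ => μ t.toNNReal NCPoly.X) γ (Set.Ici 0) 0 ∧
        (∀ P : NCPoly B,
          HasDerivWithinAt (fun t : ℝ => μ t.toNNReal (NCPoly.X * P * NCPoly.X)) (σ P) (Set.Ici 0) 0) ∧
        ∃ K : NCPoly.ConstFree B →ₗ[ℂ] B, IsMonotoneCumulant (μ 1) K ∧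
          (∀ K' : NCPoly.ConstFree B →ₗ[ℂ] B, IsMonotoneCumulant (μ 1) K' → K' = K) ∧
          K ⟨NCPoly.X, NCPoly.X_mem⟩ = γ ∧
          ∀ P : NCPoly B, K ⟨NCPoly.X * P * NCPoly.X, NCPoly.X_mul_mul_X_mem P⟩ = σ P) := by

  refine ⟨fun γ σ hγ hσ => ⟨fun t => ⟨_, isMonotoneNu_smul_iff.2 rfl, fun ν hν =>
    isMonotoneNu_smul_iff.1 hν⟩, fun μ hμ => ?_⟩, fun μ hμ => ?_⟩
  · rw [funext fun t => isMonotoneNu_smul_iff.1 (hμ t)]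
    exact isMonotoneSemigroup_evo hγ hσ
  · obtain ⟨γ, σ, hγ, hσ, h⟩ := hμ.exists_eq_evo
    have h1 : μ 1 = evo γ σ 1 := by rw [h 1]; simp
    refine ⟨γ, σ, hγ, hσ, fun t => isMonotoneNu_smul_iff.2 (h t), fun γ' σ' _ _ h' => ?_, ?_,
      fun P => ?_, cumulant γ σ, isMonotoneCumulant_cumulant_iff.2 h1, fun K' hK' => ?_,
      cumulant_X γ σ, cumulant_X_mul_X γ σ⟩
    -- Time `1` alone already determines the pair.
    · refine eq_of_evo_one_eq ?_
      rw [← h1, isMonotoneNu_smul_iff.1 (h' 1)]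
      simp
    · simp only [h]
      have := hasDerivWithinAt_evo γ σ X
      rwa [constTerm_gen_X] at this
    · simp only [h]
      have := hasDerivWithinAt_evo γ σ (X * P * X)
      rwa [constTerm_gen_X_mul_X] at this
    · rw [h1] at hK'
      exact hK'.unique

end
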